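/- **Conventions.** All processes are real-valued and indexed by an arbitrary set $T$. Convergence of processes means weak convergence of all finite-dimensional distributions. **Limit process.** A kernel $\Gamma:S\times S\to[0,\infty)$ is negative definite if it is symmetric, vanishes on the diagonal, and satisfies $\sum_{i,j}a_ia_j\Gamma(t_i,t_j)\le 0$ for all $t_1,\dots,t_m\in S$ and $a_1,\dots,a_m\in\mathbb R$ with $\sum_i a_i=0$. For such $\Gamma$, let $$M_\Gamma(t)=\max_{i\in\mathbb N}\Big(U_i+W_i(t)-\tfrac12\sigma^2(t)\Big),\qquad t\in S,$$ where for each $t$ the maximum is attained almost surely; here $\{U_i\}$ is a Poisson point process on $\mathbb R$ with intensity $e^{-u}\,du$ and, independently of it, the $W_i$ are independent copies of a zero-mean Gaussian process $W$ with $\operatorname{Var}(W(t_1)-W(t_2))=\Gamma(t_1,t_2)$ and $\sigma^2(t)=\operatorname{Var}W(t)$. A kernel $\Gamma:T\times T\to[0,\infty]$ is negative definite in the extended sense if $T$ is a disjoint union of nonempty sets $T_\alpha$ such that $\Gamma(t_1,t_2)<\infty$ if and only if $t_1,t_2$ lie in the same $T_\alpha$, and $\Gamma$ is negative definite on each $T_\alpha$.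 For such $\Gamma$, $M_\Gamma$ denotes a process on $T$ whose restriction to each $T_\alpha$ is as above and whose restrictions to the different $T_\alpha$ are mutually independent. **Theorem.** Let $u_n$ be real numbers with $\sqrt{2\pi}\,u_n e^{u_n^2/2}\sim n$ as $n\to\infty$. For every $n$, let $X_{1n},\dots,X_{nn}$ be independent copies of a zero-mean, unit-variance Gaussian process $\{X_n(t),t\in T\}$ with covariance function $r_n(t_1,t_2)=\mathbb E[X_n(t_1)X_n(t_2)]$, and suppose that for all $t_1,t_2\in T$ the limit $$\Gamma(t_1,t_2)=\lim_{n\to\infty}4\log n\,\bigl(1-r_n(t_1,t_2)\bigr)\in[0,\infty]$$ exists. Let $M_n(t)=\max_{i=1,\dots,n}X_{in}(t)$. Then $\Gamma$ is negative definite in the extended sense, a process $M_\Gamma$ exists, and for every such process $M_\Gamma$ the process $u_n(M_n-u_n)$ converges to $M_\Gamma$ as $n\to\infty$. -/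

import Mathlib

open MeasureTheory ProbabilityTheory Filter Topology
open scoped ENNReal NNReal Asymptotics

universe u

namespace GaussMax

/-- The number of indices `i` for which the random point `U i` falls into `A`. -/
noncomputable def count {Ω : Type*} (U : ℕ → Ω → ℝ) (A : Set ℝ) (ω : Ω) : ℕ∞ :=
  {i : ℕ | U i ω ∈ A}.encard

/-- The random points `U 0, U 1, …` form a Poisson point process on `ℝ` with (σ-finite) intensity
measure `μ`: the number of points in a Borel set of finite `μ`-measure is Poisson distributed with
mean the `μ`-measure of the set, and the numbers of points in disjoint Borel sets are
independent. -/
structure IsPoissonProcess {Ω : Type*} [MeasurableSpace Ω] (U : ℕ → Ω → ℝ) (μ : Measure ℝ)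
    (P : Measure Ω) : Prop where
  measurable : ∀ i, Measurable (U i)
  count_law : ∀ A : Set ℝ, MeasurableSet A → μ A ≠ ∞ → ∀ k : ℕ,
    P {ω | count U A ω = k} = poissonMeasure (μ A).toNNReal {k}
  count_indep : ∀ (m : ℕ) (A : Fin m → Set ℝ), (∀ j, MeasurableSet (A j)) →
    Pairwise (fun j l => Disjoint (A j) (A l)) → iIndepFun (fun j => count U (A j)) P

/-- The measure `e^{-u} du` on `ℝ`. -/
noncomputable def expIntensity : Measure ℝ :=
  volume.withDensity fun u => ENNReal.ofReal (Real.exp (-u))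

/-- Negative-definite kernels with values in `[0, ∞)`. Symmetry and vanishing on the diagonal are
part of the notion, so that the square root of such a kernel is a pseudo-metric. -/
structure IsNegDef {S : Type*} (Γ : S → S → ℝ) : Prop where
  nonneg : ∀ s t, 0 ≤ Γ s t
  diag : ∀ t, Γ t t = 0
  symm : ∀ s t, Γ s t = Γ t s
  sum_nonpos : ∀ (m : ℕ) (t : Fin m → S) (a : Fin m → ℝ), ∑ i, a i = 0 →
    ∑ i, ∑ j, a i * a j * Γ (t i) (t j) ≤ 0

/-- A class of the decomposition of `T` given by an equivalence relation. -/
abbrev Block {T : Type*} (s : Setoid T) (q : Quotient s) : Type _ :=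
  {t : T // Quotient.mk s t = q}

/-- The kernel `Γ` with values in `[0, ∞]` is negative definite in the extended sense, with
decomposition of `T` into the classes of `s`: `Γ` is finite exactly on pairs of points of the same
class, and its restriction to each class is negative definite. -/
structure IsExtNegDef {T : Type*} (Γ : T → T → ℝ≥0∞) (s : Setoid T) : Prop where
  ne_top_iff : ∀ t₁ t₂, Γ t₁ t₂ ≠ ∞ ↔ Quotient.mk s t₁ = Quotient.mk s t₂
  negDef : ∀ q : Quotient s, IsNegDef fun t₁ t₂ : Block s q => (Γ t₁ t₂).toReal

/-- The process `W` is a zero-mean Gaussian process with incremental variance `Γ`. -/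
structure HasIncrementalVariance {Ω S : Type*} [MeasurableSpace Ω] (W : S → Ω → ℝ)
    (Γ : S → S → ℝ) (P : Measure Ω) : Prop where
  gaussian : IsGaussianProcess W P
  mean_zero : ∀ t, ∫ ω, W t ω ∂P = 0
  incr : ∀ t₁ t₂, Var[fun ω => W t₁ ω - W t₂ ω; P] = Γ t₁ t₂

/-- For a finite-valued negative-definite kernel `Γ`: the process `M` is a pointwise maximum
`M t = max_i (U_i + W_i t - σ² t / 2)`, where `U_0, U_1, …` is a Poisson point process with
intensity `e^{-u} du`, and `W_0, W_1, …`, independent of it, are independent copies of one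
zero-mean Gaussian process with incremental variance `Γ` and variance function `σ²`. -/
def IsGaussPoissonMax {Ω S : Type*} [MeasurableSpace Ω] (Γ : S → S → ℝ) (M : S → Ω → ℝ)
    (P : Measure Ω) : Prop :=
  ∃ (U : ℕ → Ω → ℝ) (W : ℕ → S → Ω → ℝ),
    IsPoissonProcess U expIntensity P ∧
    (∀ i t, Measurable (W i t)) ∧
    HasIncrementalVariance (W 0) Γ P ∧
    (∀ i, IdentDistrib (fun ω t => W i t ω) (fun ω t => W 0 t ω) P P) ∧
    iIndepFun (fun i ω t => W i t ω) P ∧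
    IndepFun (fun ω i => U i ω) (fun ω i t => W i t ω) P ∧
    ∀ t, ∀ᵐ ω ∂P,
      IsGreatest (Set.range fun i => U i ω + W i t ω - Var[W 0 t; P] / 2) (M t ω)

/-- The process `M` is a realization of `M_Γ`, where the kernel `Γ` is negative definite in the
extended sense: on each class of the decomposition of the index set `M` is the maximum above, and
the restrictions of `M` to the different classes are independent. -/
def IsLimitProcess {Ω T : Type*} [MeasurableSpace Ω] (Γ : T → T → ℝ≥0∞) (M : T → Ω → ℝ)
    (P : Measure Ω) : Prop :=
  (∀ t, Measurable (M t)) ∧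
  ∃ s : Setoid T, IsExtNegDef Γ s ∧
    (∀ q : Quotient s, IsGaussPoissonMax (fun t₁ t₂ : Block s q => (Γ t₁ t₂).toReal)
      (fun t : Block s q => M t) P) ∧
    iIndepFun (fun (q : Quotient s) ω (t : Block s q) => M t ω) P

/-- Convergence of stochastic processes: weak convergence of the finite-dimensional
distributions. -/
def TendstoFinDim {T : Type*} {Ω : ℕ → Type*} {Ω' : Type*} [∀ n, MeasurableSpace (Ω n)]
    [MeasurableSpace Ω'] (Y : (n : ℕ) → T → Ω n → ℝ) (Z : T → Ω' → ℝ)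
    (P : (n : ℕ) → Measure (Ω n)) [∀ n, IsProbabilityMeasure (P n)]
    (P' : Measure Ω') [IsProbabilityMeasure P'] : Prop :=
  ∀ I : Finset T, TendstoInDistribution (fun n ω (t : I) => Y n t ω) atTop
    (fun ω (t : I) => Z t ω) P P'

end GaussMax

/-! The maximum stays below the levels `y` on a finite set `I` exactly when all `n` copies do. Its
distribution function is therefore `(1 - p n) ^ n`, where `p n` is the probability that a single
copy exceeds some level on `I`, and it tends to `exp (-Λ I)` once `n * p n` tends to `Λ I`. On the
limit side, the void probabilities of a marked Poisson process give the distribution function of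
`M_Γ` in this form: `Λ I` is the mean number of points `u` whose drifted path `u + W - σ² / 2`
exceeds a level on `I`, summed over the classes of the decomposition.

Expected numbers of exceeding paths are compared by adding indices to `I` one at a time; the
increment at `t` counts the paths that exceed at `t` and nowhere on `I`. For the Poisson process,
the height `z` of the path at `t` is taken as new variable. Then `e^{-u}` becomes `e^{-z}` times an
exponential tilt, under which the increments from `t` are Gaussian with mean `-Γ s t / 2` and a
covariance depending on `Γ` only (`lintegral_first_exceedance`,
`HasIncrementalVariance.map_withDensity_linComb`). For the processes `X n`, conditioning on `z = u
(X t - u)` gives a density which, multiplied by `n`, tends to `e^{-z}`, and a Gaussian path with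
mean `r z - u² (1 - r)` (`measure_exceedance_at`). Since `u² ~ 2 log n`, the quantity `u² (1 - r)`
tends to `Γ / 2`: the conditional path has the same Gaussian limit on the class of `t` and falls to
`-∞` on the other classes. Domination by `e^{-z}` identifies the increments
(`tendsto_mul_measure_exceedance_at`), and induction on `I` gives
`tendsto_mul_measure_exists_exceedance`. The distribution functions then converge everywhere, which
yields weak convergence.

For existence, positive semidefiniteness of the correlations passes to the limit and makes `Γ`
negative definite in the extended sense. Schoenberg's embedding followed by an isonormal process
supplies `W`; the Poisson process is assembled from independent Poisson clusters, one for each layer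
of unit mass of the intensity; Borel–Cantelli shows that the maximum is attained; a product space
makes the classes independent. -/

namespace GaussMax

/-! ### Weak convergence from convergence of distribution functions -/

section DistributionFunction

variable {ι : Type*} [Fintype ι]

/-- Induction on the coordinates with a lower bound: imposing `a j < x j` removes from a box the
sub-box whose upper corner has `b j` replaced by `a j`, so masses of boxes are differences of masses
already known to converge. -/
lemma tendsto_measure_box_of_tendsto_measure_Iic {μs : ℕ → Measure (ι → ℝ)}
    {μ : Measure (ι → ℝ)} [∀ n, IsProbabilityMeasure (μs n)] [IsProbabilityMeasure μ]
    (h : ∀ y, Tendsto (fun n => μs n (Set.Iic y)) atTop (𝓝 (μ (Set.Iic y))))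
    (s : Finset ι) (a b : ι → ℝ) (hab : ∀ i, a i ≤ b i) :
    Tendsto (fun n => μs n {x | (∀ i ∈ s, a i < x i) ∧ ∀ i, x i ≤ b i}) atTop
      (𝓝 (μ {x | (∀ i ∈ s, a i < x i) ∧ ∀ i, x i ≤ b i})) := by
  classical
  induction s using Finset.induction_on generalizing b with
  | empty => simpa [Set.Iic, Pi.le_def] using h b
  | insert j s hj ih =>
    have hmeas : ∀ b : ι → ℝ, MeasurableSet {x : ι → ℝ | (∀ i ∈ s, a i < x i) ∧ ∀ i, x i ≤ b i} := by
      intro b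
      measurability
    have hsub : {x : ι → ℝ | (∀ i ∈ s, a i < x i) ∧ ∀ i, x i ≤ Function.update b j (a j) i} ⊆
        {x | (∀ i ∈ s, a i < x i) ∧ ∀ i, x i ≤ b i} := by
      rintro x ⟨h1, h2⟩
      refine ⟨h1, fun i => (h2 i).trans ?_⟩
      by_cases hij : i = j
      · subst hij; simpa using hab i
      · simp [hij]
    have heq : {x : ι → ℝ | (∀ i ∈ insert j s, a i < x i) ∧ ∀ i, x i ≤ b i} =
        {x | (∀ i ∈ s, a i < x i) ∧ ∀ i, x i ≤ b i} \
        {x | (∀ i ∈ s, a i < x i) ∧ ∀ i, x i ≤ Function.update b j (a j) i} := by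
      ext x
      simp only [Finset.mem_insert, forall_eq_or_imp, Set.mem_ofPred_eq, Set.mem_sdiff, not_and,
        not_forall, not_le]
      constructor
      · rintro ⟨⟨h1, h2⟩, h3⟩
        exact ⟨⟨h2, h3⟩, fun _ => ⟨j, by simpa using h1⟩⟩
      · rintro ⟨⟨h2, h3⟩, h4⟩
        obtain ⟨i, hi⟩ := h4 h2
        by_cases hij : i = j
        · subst hij; exact ⟨⟨by simpa using hi, h2⟩, h3⟩
        · simp only [Function.update_of_ne hij] at hi
          exact absurd (h3 i) (not_le.2 hi)
    rw [heq]
    simp_rw [measure_sdiff hsub (hmeas _).nullMeasurableSet (measure_ne_top _ _)]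
    refine ENNReal.Tendsto.sub (ih b hab) (ih _ fun i => ?_) (Or.inl (measure_ne_top _ _))
    by_cases hij : i = j
    · subst hij; simp
    · simpa [hij] using hab i

/-- Half-open cells of side `1 / (k + 1)` partition the space, and the mass of each cell converges.
The cells contained in `G` exhaust it as the mesh shrinks. Convergence is assumed at every point, so
the grid need not avoid discontinuities of the limit. -/
lemma le_liminf_measure_open_of_tendsto_measure_Iic {μs : ℕ → Measure (ι → ℝ)}
    {μ : Measure (ι → ℝ)} [∀ n, IsProbabilityMeasure (μs n)] [IsProbabilityMeasure μ]
    (h : ∀ y, Tendsto (fun n => μs n (Set.Iic y)) atTop (𝓝 (μ (Set.Iic y))))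
    (G : Set (ι → ℝ)) (hG : IsOpen G) :
    μ G ≤ liminf (fun n => μs n G) atTop := by
  set c : ℕ → (ι → ℝ) → ι → ℤ := fun k x i => ⌈((k : ℝ) + 1) * x i⌉ with hc
  have hcm : ∀ k, Measurable (c k) := by
    intro k
    refine measurable_pi_lambda _ fun i => ?_
    exact Int.measurable_ceil.comp (by fun_prop)
  have hbox : ∀ k m, c k ⁻¹' {m} = {x | (∀ i ∈ Finset.univ, ((m i : ℝ) - 1) / (k + 1) < x i) ∧
      ∀ i, x i ≤ (m i : ℝ) / (k + 1)} := by
    intro k m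
    have hk : (0 : ℝ) < k + 1 := by positivity
    ext x
    simp only [Set.mem_preimage, Set.mem_singleton_iff, funext_iff, hc, Finset.mem_univ,
      true_implies, Set.mem_ofPred_eq, Int.ceil_eq_iff, forall_and, div_lt_iff₀ hk, le_div_iff₀ hk,
      mul_comm]
  have htend : ∀ k m, Tendsto (fun n => μs n (c k ⁻¹' {m})) atTop (𝓝 (μ (c k ⁻¹' {m}))) := by
    intro k m
    rw [hbox]
    refine tendsto_measure_box_of_tendsto_measure_Iic h _ _ _ fun i => ?_
    gcongr; linarith
  set S : ℕ → Set (ι → ℤ) := fun k => {m | c k ⁻¹' {m} ⊆ G} with hS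
  have hGk : ∀ k, μ (c k ⁻¹' S k) ≤ liminf (fun n => μs n G) atTop := by
    intro k
    have hsum : ∀ ν : Measure (ι → ℝ), ν (c k ⁻¹' S k) = ∑' m : S k, ν (c k ⁻¹' {(m : ι → ℤ)}) := by
      intro ν
      have : c k ⁻¹' S k = ⋃ m ∈ S k, c k ⁻¹' {m} := by ext; simp
      rw [this, measure_biUnion (Set.to_countable _)]
      · intro m _ m' _ hne
        exact Disjoint.preimage _ (by simpa using hne)
      · intro m _
        exact hcm k (measurableSet_singleton _)
    have hsub : c k ⁻¹' S k ⊆ G := fun x hx => hx rfl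
    -- Fatou's lemma for counting measure on the countably many cells inside `G`.
    calc μ (c k ⁻¹' S k) = ∫⁻ m : S k, liminf (fun n => μs n (c k ⁻¹' {(m : ι → ℤ)})) atTop
          ∂Measure.count := by
          rw [hsum, lintegral_count]
          congr with m
          exact (htend k m).liminf_eq.symm
      _ ≤ liminf (fun n => ∫⁻ m : S k, μs n (c k ⁻¹' {(m : ι → ℤ)}) ∂Measure.count) atTop :=
          lintegral_liminf_le fun n => measurable_of_countable _
      _ = liminf (fun n => μs n (c k ⁻¹' S k)) atTop := by
          simp_rw [lintegral_count, ← hsum]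
      _ ≤ _ := liminf_le_liminf (.of_forall fun n => measure_mono hsub)
  have hlim : Tendsto (fun k => μ (c k ⁻¹' S k)) atTop (𝓝 (μ G)) := by
    refine tendsto_measure_of_tendsto_indicator_of_isFiniteMeasure atTop μ
      (fun k => hcm k (S k).to_countable.measurableSet) fun x => ?_
    by_cases hx : x ∈ G
    · obtain ⟨ε, hε, hball⟩ := Metric.isOpen_iff.1 hG x hx
      obtain ⟨N, hN⟩ := exists_nat_one_div_lt hε
      filter_upwards [eventually_ge_atTop N] with k hk
      refine iff_of_true (fun z hz => hball ?_) hx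
      have hk1 : (0 : ℝ) < k + 1 := by positivity
      have hkε : 1 / ((k : ℝ) + 1) < ε := (Nat.one_div_le_one_div hk).trans_lt hN
      have hz' : z ∈ c k ⁻¹' {c k x} := hz
      have hx' : x ∈ c k ⁻¹' {c k x} := rfl
      rw [hbox] at hz' hx'
      rw [Metric.mem_ball, dist_pi_lt_iff hε]
      intro i
      refine lt_of_le_of_lt ?_ hkε
      have h1 := hz'.1 i (Finset.mem_univ _)
      have h2 := hz'.2 i
      have h3 := hx'.1 i (Finset.mem_univ _)
      have h4 := hx'.2 i
      rw [sub_div] at h1 h3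
      rw [Real.dist_eq, abs_le]
      constructor <;> linarith
    · refine .of_forall fun k => iff_of_false (fun hxk => hx (hxk rfl)) hx
  exact le_of_tendsto' hlim hGk

/-- Convergence of the distribution functions at all points implies convergence in
distribution. -/
lemma tendstoInDistribution_of_tendsto_measure_le {Ω : ℕ → Type*} {Ω' : Type*}
    [∀ n, MeasurableSpace (Ω n)] [MeasurableSpace Ω'] {P : (n : ℕ) → Measure (Ω n)}
    [∀ n, IsProbabilityMeasure (P n)] {P' : Measure Ω'} [IsProbabilityMeasure P']
    {Y : (n : ℕ) → Ω n → ι → ℝ} {Z : Ω' → ι → ℝ} (hY : ∀ n, AEMeasurable (Y n) (P n))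
    (hZ : AEMeasurable Z P')
    (h : ∀ y : ι → ℝ, Tendsto (fun n => P n {ω | ∀ i, Y n ω i ≤ y i}) atTop
      (𝓝 (P' {ω | ∀ i, Z ω i ≤ y i}))) :
    TendstoInDistribution Y atTop Z P P' := by
  have hYp : ∀ n, IsProbabilityMeasure ((P n).map (Y n)) :=
    fun n => Measure.isProbabilityMeasure_map (hY n)
  have hZp : IsProbabilityMeasure (P'.map Z) := Measure.isProbabilityMeasure_map hZ
  refine ⟨hY, hZ, tendsto_of_forall_isOpen_le_liminf_nat' fun G hG => ?_⟩
  refine le_liminf_measure_open_of_tendsto_measure_Iic (μs := fun n => (P n).map (Y n))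
    (μ := P'.map Z) (fun y => ?_) G hG
  simp_rw [Measure.map_apply_of_aemeasurable hZ measurableSet_Iic,
    fun n => Measure.map_apply_of_aemeasurable (hY n) (measurableSet_Iic (a := y))]
  exact h y

end DistributionFunction

/-! ### Poisson processes: counts and the generating functional -/

section Laplace

/-- At least `a` of the events occur iff all events of some `a`-element index set occur, and there
are only countably many finite index sets. -/
lemma measurable_encard_setOf_mem {Ω : Type*} [MeasurableSpace Ω] {E : ℕ → Set Ω}
    (hE : ∀ i, MeasurableSet (E i)) : Measurable fun ω => {i : ℕ | ω ∈ E i}.encard := by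
  have hle : ∀ a : ℕ, MeasurableSet {ω | (a : ℕ∞) ≤ {i : ℕ | ω ∈ E i}.encard} := by
    intro a
    have : {ω | (a : ℕ∞) ≤ {i : ℕ | ω ∈ E i}.encard} =
        ⋃ t : Finset ℕ, ⋃ _ : t.card = a, ⋂ i ∈ t, E i := by
      ext ω
      simp only [Set.mem_ofPred_eq, Set.mem_iUnion, Set.mem_iInter, exists_prop]
      constructor
      · intro h
        obtain ⟨t, ht, hta⟩ := Set.exists_subset_encard_eq h
        have hfin : t.Finite := Set.finite_of_encard_eq_coe hta
        refine ⟨hfin.toFinset, ?_, fun i hi => ht (by simpa using hi)⟩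
        rw [hfin.encard_eq_coe_toFinset_card] at hta
        exact_mod_cast hta
      · rintro ⟨t, rfl, h⟩
        rw [← Set.encard_coe_eq_coe_finsetCard]
        exact Set.encard_le_encard fun i hi => h i hi
    rw [this]
    exact .iUnion fun t => .iUnion fun _ => .biInter t.countable_toSet fun i _ => hE i
  refine measurable_to_countable' fun k => ?_
  induction k using ENat.recTopCoe with
  | top =>
    have : (fun ω => {i : ℕ | ω ∈ E i}.encard) ⁻¹' {⊤} =
        ⋂ a : ℕ, {ω | (a : ℕ∞) ≤ {i : ℕ | ω ∈ E i}.encard} := by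
      ext ω
      simp only [Set.mem_preimage, Set.mem_singleton_iff, Set.mem_iInter, Set.mem_ofPred_eq]
      exact ⟨fun h a => h ▸ le_top, fun h => ENat.eq_top_iff_forall_ge.2 h⟩
    rw [this]
    exact .iInter hle
  | coe k =>
    have : (fun ω => {i : ℕ | ω ∈ E i}.encard) ⁻¹' {(k : ℕ∞)} =
        {ω | (k : ℕ∞) ≤ {i : ℕ | ω ∈ E i}.encard} \
        {ω | ((k + 1 : ℕ) : ℕ∞) ≤ {i : ℕ | ω ∈ E i}.encard} := by
      ext ω
      simp only [Set.mem_preimage, Set.mem_singleton_iff, Set.mem_sdiff, Set.mem_ofPred_eq, not_le,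
        Nat.cast_add, Nat.cast_one, ENat.lt_add_one_iff (ENat.natCast_ne_top k)]
      rw [and_comm, le_antisymm_iff]
    rw [this]
    exact (hle k).diff (hle (k + 1))

namespace IsPoissonProcess

variable {Ω : Type*} [MeasurableSpace Ω] {U : ℕ → Ω → ℝ} {μ : Measure ℝ} {P : Measure Ω}

lemma measurable_count (hU : IsPoissonProcess U μ P) {A : Set ℝ} (hA : MeasurableSet A) :
    Measurable (count U A) :=
  measurable_encard_setOf_mem fun i => hU.measurable i hA

/-- Independence of the empty family of counts already says that the total mass is one. -/
lemma isProbabilityMeasure (hU : IsPoissonProcess U μ P) : IsProbabilityMeasure P :=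
  (hU.count_indep 0 (fun _ => ∅) (fun _ => MeasurableSet.empty)
    (fun i => i.elim0)).isProbabilityMeasure

/-- The Poisson weights of the finite values add up to one, leaving no mass at `⊤`. -/
lemma ae_count_ne_top (hU : IsPoissonProcess U μ P) {A : Set ℝ} (hA : MeasurableSet A)
    (hμA : μ A ≠ ∞) : ∀ᵐ ω ∂P, count U A ω ≠ ⊤ := by
  have := hU.isProbabilityMeasure
  have hset : {ω | count U A ω ≠ ⊤} = ⋃ k : ℕ, {ω | count U A ω = k} := by
    ext ω
    simp [ENat.ne_top_iff_exists, eq_comm]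
  have hmeas : ∀ k : ℕ, MeasurableSet {ω | count U A ω = k} :=
    fun k => hU.measurable_count hA (measurableSet_singleton _)
  have h1 : P {ω | count U A ω ≠ ⊤} = 1 := by
    rw [hset, measure_iUnion _ hmeas]
    · simp_rw [hU.count_law A hA hμA]
      rw [← measure_iUnion (fun i j hij => by simpa using hij) fun _ => measurableSet_singleton _,
        Set.iUnion_of_singleton, measure_univ]
    · intro i j hij
      refine Set.disjoint_left.2 fun ω (h : _ = _) (h' : _ = _) => hij ?_
      exact_mod_cast h.symm.trans h'
  refine (ae_iff_measure_eq ?_).2 (by rw [h1, measure_univ])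
  rw [hset]
  exact (MeasurableSet.iUnion hmeas).nullMeasurableSet

lemma lintegral_comp_count (hU : IsPoissonProcess U μ P) {A : Set ℝ} (hA : MeasurableSet A)
    (hμA : μ A ≠ ∞) (f : ℕ → ℝ≥0∞) :
    ∫⁻ ω, f (count U A ω).toNat ∂P = ∑' k, f k * poissonMeasure (μ A).toNNReal {k} := by
  have hmeas : Measurable fun ω => (count U A ω).toNat :=
    (measurable_of_countable ENat.toNat).comp (hU.measurable_count hA)
  rw [← lintegral_map (f := f) (measurable_of_countable f) hmeas, lintegral_countable']
  congr with k
  rw [Measure.map_apply hmeas (measurableSet_singleton k), ← hU.count_law A hA hμA]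
  congr 1
  refine measure_congr ?_
  filter_upwards [hU.ae_count_ne_top hA hμA] with ω hω
  refine propext ?_
  change (count U A ω).toNat = k ↔ count U A ω = k
  lift count U A ω to ℕ using hω with c
  simp

end IsPoissonProcess

lemma tsum_pow_mul_poissonMeasure (l : ℝ≥0) {c : ℝ≥0∞} (hc : c ≤ 1) :
    ∑' k, (1 - c) ^ k * poissonMeasure l {k} = ENNReal.ofReal (Real.exp (-(c * l).toReal)) := by
  have hc' : c ≠ ∞ := ne_top_of_le_ne_top ENNReal.one_ne_top hc
  lift c to ℝ≥0 using hc'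
  have hc1 : (c : ℝ) ≤ 1 := by exact_mod_cast hc
  have h1 : (1 - (c : ℝ≥0∞)) = ENNReal.ofReal (1 - c) := by
    rw [ENNReal.ofReal_sub 1 c.coe_nonneg]; simp
  have hsum : HasSum (fun k : ℕ => (1 - (c : ℝ)) ^ k * (Real.exp (-l) * l ^ k / k.factorial))
      (Real.exp (-(c * l))) := by
    have := (NormedSpace.expSeries_div_hasSum_exp ((1 - (c : ℝ)) * l)).mul_left (Real.exp (-l))
    rw [← Real.exp_eq_exp_ℝ, ← Real.exp_add] at this
    have h2 : -(l : ℝ) + (1 - c) * l = -(c * l) := by ring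
    rw [h2] at this
    refine this.congr_fun fun k => ?_
    rw [mul_pow]; ring
  have hterm : ∀ k : ℕ, (1 - (c : ℝ≥0∞)) ^ k * poissonMeasure l {k} =
      ENNReal.ofReal ((1 - (c : ℝ)) ^ k * (Real.exp (-l) * l ^ k / k.factorial)) := by
    intro k
    have : 0 ≤ 1 - (c : ℝ) := by linarith
    rw [poissonMeasure_singleton, h1, ← ENNReal.ofReal_pow this,
      ← ENNReal.ofReal_mul (by positivity)]
  simp_rw [hterm]
  rw [← ENNReal.ofReal_tsum_of_nonneg _ hsum.summable, hsum.tsum_eq]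
  · simp
  · intro k
    have : 0 ≤ 1 - (c : ℝ) := by linarith
    positivity

/-- Infinite products of factors at most one are written as infima of their decreasing partial
products, so that no convergence has to be discussed. -/
lemma iInf_prod_range_eq_prod {g : ℕ → ℝ≥0∞} (hg : ∀ i, g i ≤ 1) (F : Finset ℕ)
    (hF : ∀ i ∉ F, g i = 1) : ⨅ n, ∏ i ∈ Finset.range n, g i = ∏ i ∈ F, g i := by
  refine le_antisymm ?_ (le_iInf fun n => ?_)
  · refine (iInf_le _ (F.sup id + 1)).trans_eq ?_
    refine (Finset.prod_subset (fun i hi => ?_) fun i _ hi => hF i hi).symm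
    exact Finset.mem_range.2 (Nat.lt_succ_of_le (Finset.le_sup (f := id) hi))
  · have h1 : ∏ i ∈ F ∪ Finset.range n, g i = ∏ i ∈ F, g i :=
      (Finset.prod_subset Finset.subset_union_left fun i _ hi => hF i hi).symm
    rw [← h1]
    exact Finset.prod_le_prod_of_subset_of_le_one' Finset.subset_union_right fun i _ _ => hg i

namespace IsPoissonProcess

variable {Ω : Type*} [MeasurableSpace Ω] {U : ℕ → Ω → ℝ} {μ : Measure ℝ} {P : Measure Ω}

/-- Grouping the points by the value `c` of `φ` turns the product into powers `(1 - c) ^ N_c`. The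
counts `N_c` belong to disjoint level sets, hence are independent and Poisson, and the expectation
factorizes into Poisson generating functions. -/
lemma lintegral_iInf_prod_simpleFunc (hU : IsPoissonProcess U μ P) (φ : SimpleFunc ℝ ℝ≥0∞)
    (hφ : ∀ x, φ x ≤ 1) (hint : ∫⁻ x, φ x ∂μ ≠ ∞) :
    ∫⁻ ω, ⨅ n, ∏ i ∈ Finset.range n, (1 - φ (U i ω)) ∂P =
      ENNReal.ofReal (Real.exp (-(∫⁻ x, φ x ∂μ).toReal)) := by
  classical
  -- The value `0` is dropped: its level set may have infinite mass, but its points contribute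
  -- factors `1`. The other level sets have finite mass by integrability.
  set C : Finset ℝ≥0∞ := φ.range.erase 0 with hC
  have hC1 : ∀ c ∈ C, c ≤ 1 := by
    intro c hc
    obtain ⟨x, rfl⟩ := SimpleFunc.mem_range.1 (Finset.mem_of_mem_erase hc)
    exact hφ x
  have hsum : ∫⁻ x, φ x ∂μ = ∑ c ∈ C, c * μ (φ ⁻¹' {c}) := by
    rw [SimpleFunc.lintegral_eq_lintegral, SimpleFunc.lintegral, hC]
    by_cases h0 : (0 : ℝ≥0∞) ∈ φ.range
    · rw [← Finset.add_sum_erase _ _ h0]; simp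
    · rw [Finset.erase_eq_of_notMem h0]
  have hmul : ∀ c ∈ C, c * μ (φ ⁻¹' {c}) ≠ ∞ := by
    intro c hc
    refine ne_top_of_le_ne_top hint ?_
    rw [hsum]
    exact Finset.single_le_sum (f := fun c => c * μ (φ ⁻¹' {c})) (fun _ _ => zero_le) hc
  have hfin : ∀ c ∈ C, μ (φ ⁻¹' {c}) ≠ ∞ := by
    intro c hc h
    refine hmul c hc ?_
    rw [h, ENNReal.mul_top (Finset.ne_of_mem_erase hc)]
  have hAm : ∀ c, MeasurableSet (φ ⁻¹' {c}) := fun c => φ.measurableSet_fiber c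
  have hae : ∀ᵐ ω ∂P, ⨅ n, ∏ i ∈ Finset.range n, (1 - φ (U i ω)) =
      ∏ c : C, (1 - (c : ℝ≥0∞)) ^ (count U (φ ⁻¹' {(c : ℝ≥0∞)}) ω).toNat := by
    have : ∀ᵐ ω ∂P, ∀ c : C, count U (φ ⁻¹' {(c : ℝ≥0∞)}) ω ≠ ⊤ :=
      ae_all_iff.2 fun c => hU.ae_count_ne_top (hAm c) (hfin c c.2)
    filter_upwards [this] with ω hω
    have hFfin : {i | φ (U i ω) ≠ 0}.Finite := by
      have : {i | φ (U i ω) ≠ 0} = ⋃ c : C, {i | U i ω ∈ φ ⁻¹' {(c : ℝ≥0∞)}} := by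
        ext i
        simp [hC]
      rw [this]
      exact Set.finite_iUnion fun c => Set.encard_ne_top_iff.1 (hω c)
    rw [iInf_prod_range_eq_prod (fun i => tsub_le_self) hFfin.toFinset
      (fun i hi => by simp only [Set.Finite.mem_toFinset, Set.mem_ofPred_eq, not_not] at hi
                      simp [hi])]
    rw [← Finset.prod_fiberwise_of_maps_to (t := C) (g := fun i => φ (U i ω)),
      ← Finset.prod_coe_sort]
    · refine Finset.prod_congr rfl fun c _ => ?_
      rw [Finset.prod_congr rfl (g := fun _ => 1 - (c : ℝ≥0∞)), Finset.prod_const]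
      · congr 1
        have : ({i | U i ω ∈ φ ⁻¹' {(c : ℝ≥0∞)}} : Set ℕ) =
            ({i ∈ hFfin.toFinset | φ (U i ω) = c} : Finset ℕ) := by
          ext i
          simp only [Set.mem_preimage, Set.mem_singleton_iff, Set.mem_ofPred_eq,
            Finset.coe_filter, Set.Finite.mem_toFinset]
          exact ⟨fun h => ⟨h ▸ Finset.ne_of_mem_erase c.2, h⟩, fun h => h.2⟩
        rw [count, this, Set.encard_coe_eq_coe_finsetCard]
        simp
      · intro i hi
        rw [(Finset.mem_filter.1 hi).2]
    · intro i hi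
      simp only [Set.Finite.mem_toFinset, Set.mem_ofPred_eq] at hi
      simp [hC, hi]
  have hindep : iIndepFun (fun (c : C) ω =>
      (1 - (c : ℝ≥0∞)) ^ (count U (φ ⁻¹' {(c : ℝ≥0∞)}) ω).toNat) P := by
    have h := hU.count_indep C.card (fun j => φ ⁻¹' {(C.equivFin.symm j : ℝ≥0∞)})
      (fun j => hAm _) (fun j l hjl => Disjoint.preimage _ (by simpa [Subtype.ext_iff] using hjl))
    have h2 := (h.precomp C.equivFin.injective).comp
      (fun (c : C) (k : ℕ∞) => (1 - (c : ℝ≥0∞)) ^ k.toNat) (fun c => measurable_of_countable _)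
    convert h2 using 3
    simp
  rw [lintegral_congr_ae hae, lintegral_prod_eq_prod_lintegral_of_indepFun _ _ hindep, hsum]
  · rw [ENNReal.toReal_sum hmul, ← Finset.sum_neg_distrib, Real.exp_sum,
      ENNReal.ofReal_prod_of_nonneg fun _ _ => (Real.exp_pos _).le, ← Finset.prod_coe_sort C]
    refine Finset.prod_congr rfl fun c _ => ?_
    rw [hU.lintegral_comp_count (hAm c) (hfin c c.2) (fun k => (1 - (c : ℝ≥0∞)) ^ k),
      tsum_pow_mul_poissonMeasure _ (hC1 c c.2), ENNReal.coe_toNNReal (hfin c c.2)]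
  · exact fun c => (measurable_of_countable fun k : ℕ∞ => (1 - (c : ℝ≥0∞)) ^ k.toNat).comp
      (hU.measurable_count (hAm c))

/-- The generating functional of a Poisson process. -/
lemma lintegral_iInf_prod (hU : IsPoissonProcess U μ P) {f : ℝ → ℝ≥0∞} (hfm : Measurable f)
    (hf : ∀ x, f x ≤ 1) (hint : ∫⁻ x, f x ∂μ ≠ ∞) :
    ∫⁻ ω, ⨅ n, ∏ i ∈ Finset.range n, (1 - f (U i ω)) ∂P =
      ENNReal.ofReal (Real.exp (-(∫⁻ x, f x ∂μ).toReal)) := by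
  have := hU.isProbabilityMeasure
  set φ : ℕ → SimpleFunc ℝ ℝ≥0∞ := SimpleFunc.eapprox f with hφdef
  have hφf : ∀ k x, φ k x ≤ f x := fun k x => by
    rw [← SimpleFunc.iSup_eapprox_apply hfm x]; exact le_iSup (fun k => φ k x) k
  have hmono : ∀ x, Monotone fun k => φ k x :=
    fun x k l hkl => SimpleFunc.monotone_eapprox f hkl x
  have hanti : ∀ ω n, Antitone fun k => ∏ i ∈ Finset.range n, (1 - φ k (U i ω)) :=
    fun ω n k l hkl => Finset.prod_le_prod' fun i _ => tsub_le_tsub_left (hmono _ hkl) 1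
  -- The partial products decrease both in the number of factors and along the simple
  -- approximations, so the two infima may be exchanged and monotone convergence applied from above.
  have hpt : ∀ ω, ⨅ n, ∏ i ∈ Finset.range n, (1 - f (U i ω)) =
      ⨅ k, ⨅ n, ∏ i ∈ Finset.range n, (1 - φ k (U i ω)) := by
    intro ω
    rw [iInf_comm]
    congr with n
    refine tendsto_nhds_unique ?_ (tendsto_atTop_iInf (hanti ω n))
    refine ENNReal.tendsto_finsetProd_of_ne_top _ (fun i _ => ?_)
      fun i _ => ne_top_of_le_ne_top ENNReal.one_ne_top tsub_le_self
    exact ENNReal.Tendsto.sub tendsto_const_nhds (SimpleFunc.tendsto_eapprox hfm _)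
      (Or.inl ENNReal.one_ne_top)
  have hmeas : ∀ k, Measurable fun ω => ⨅ n, ∏ i ∈ Finset.range n, (1 - φ k (U i ω)) := by
    intro k
    refine .iInf fun n => Finset.measurable_prod _ fun i _ => ?_
    exact ((φ k).measurable.comp (hU.measurable i)).const_sub 1
  simp_rw [hpt]
  rw [lintegral_iInf hmeas]
  · have hφint : ∀ k, ∫⁻ x, φ k x ∂μ ≠ ∞ :=
      fun k => ne_top_of_le_ne_top hint (lintegral_mono (hφf k))
    simp_rw [fun k => hU.lintegral_iInf_prod_simpleFunc (φ k)
      (fun x => (hφf k x).trans (hf x)) (hφint k)]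
    have hlim : Tendsto (fun k => ∫⁻ x, φ k x ∂μ) atTop (𝓝 (∫⁻ x, f x ∂μ)) :=
      lintegral_tendsto_of_tendsto_of_monotone (fun k => (φ k).measurable.aemeasurable)
        (.of_forall hmono) (.of_forall fun x => SimpleFunc.tendsto_eapprox hfm x)
    refine (tendsto_nhds_unique (tendsto_atTop_iInf ?_) ?_)
    · intro k l hkl
      refine ENNReal.ofReal_le_ofReal (Real.exp_le_exp.2 (neg_le_neg ?_))
      exact ENNReal.toReal_mono (hφint l) (lintegral_mono fun x => hmono x hkl)
    · exact ENNReal.tendsto_ofReal ((Real.continuous_exp.tendsto _).comp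
        ((ENNReal.tendsto_toReal hint).comp hlim).neg)
  · intro k l hkl ω
    exact iInf_mono fun n => hanti ω n hkl
  · refine ne_top_of_le_ne_top ENNReal.one_ne_top ?_
    refine (lintegral_mono fun ω => iInf_le (fun n => ∏ i ∈ Finset.range n, (1 - φ 0 (U i ω))) 0).trans ?_
    simp

end IsPoissonProcess

end Laplace

/-! ### Void probabilities of marked Poisson processes -/

section Marked

variable {Ω E : Type*} [MeasurableSpace Ω] [MeasurableSpace E] {U : ℕ → Ω → ℝ} {W : ℕ → Ω → E}
  {μ : Measure ℝ} {P : Measure Ω}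

/-- Fubini for the independent sequences of points and marks: with the points frozen, the marks are
i.i.d. and each has to miss its own section of `D`. -/
lemma measure_forall_lt_notMem [IsProbabilityMeasure P] (hU : ∀ i, Measurable (U i))
    (hW : ∀ i, Measurable (W i)) (hid : ∀ i, IdentDistrib (W i) (W 0) P P)
    (hindep : iIndepFun W P) (hUW : IndepFun (fun ω i => U i ω) (fun ω i => W i ω) P)
    {D : Set (ℝ × E)} (hD : MeasurableSet D) (n : ℕ) :
    P {ω | ∀ i ∈ Finset.range n, (U i ω, W i ω) ∉ D} =
      ∫⁻ ω, ∏ i ∈ Finset.range n, (1 - P {ω' | (U i ω, W 0 ω') ∈ D}) ∂P := by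
  have hUm : Measurable fun ω i => U i ω := measurable_pi_lambda _ hU
  have hWm : Measurable fun ω i => W i ω := measurable_pi_lambda _ hW
  have hprod := (indepFun_iff_map_prod_eq_prod_map_map hUm.aemeasurable hWm.aemeasurable).1 hUW
  have hUp : IsProbabilityMeasure (P.map fun ω i => U i ω) :=
    Measure.isProbabilityMeasure_map hUm.aemeasurable
  have hWp : IsProbabilityMeasure (P.map fun ω i => W i ω) :=
    Measure.isProbabilityMeasure_map hWm.aemeasurable
  set G : Set ((ℕ → ℝ) × (ℕ → E)) := {p | ∀ i ∈ Finset.range n, (p.1 i, p.2 i) ∉ D} with hG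
  have hGm : MeasurableSet G := by
    have : G = ⋂ i ∈ Finset.range n, (fun p : (ℕ → ℝ) × (ℕ → E) => (p.1 i, p.2 i)) ⁻¹' Dᶜ := by
      ext; simp [hG]
    rw [this]
    exact Finset.measurableSet_biInter _ fun i _ =>
      (show Measurable fun p : (ℕ → ℝ) × (ℕ → E) => (p.1 i, p.2 i) by fun_prop) hD.compl
  have hDu : ∀ x : ℝ, MeasurableSet {e | (x, e) ∈ D} := fun x => measurable_prodMk_left hD
  have hinner : ∀ x : ℕ → ℝ, (P.map fun ω i => W i ω) (Prod.mk x ⁻¹' G) =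
      ∏ i ∈ Finset.range n, (1 - P {ω' | (x i, W 0 ω') ∈ D}) := by
    intro x
    rw [Measure.map_apply hWm (measurable_prodMk_left hGm)]
    have hset : (fun ω i => W i ω) ⁻¹' (Prod.mk x ⁻¹' G) =
        ⋂ i ∈ Finset.range n, W i ⁻¹' {e | (x i, e) ∈ D}ᶜ := by
      ext; simp [hG]
    rw [hset, hindep.measure_inter_preimage_eq_mul _ fun i _ => (hDu _).compl]
    refine Finset.prod_congr rfl fun i _ => ?_
    rw [(hid i).measure_mem_eq (hDu _).compl, Set.preimage_compl,
      prob_compl_eq_one_sub (hW 0 (hDu _))]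
    rfl
  have hLHS : P {ω | ∀ i ∈ Finset.range n, (U i ω, W i ω) ∉ D} =
      (P.map fun ω => (fun i => U i ω, fun i => W i ω)) G := by
    rw [Measure.map_apply (hUm.prodMk hWm) hGm]; rfl
  rw [hLHS, hprod, Measure.prod_apply hGm]
  simp_rw [hinner]
  rw [lintegral_map _ hUm]
  refine Finset.measurable_prod _ fun i _ => Measurable.const_sub ?_ 1
  have hm : Measurable fun x : ℝ => P {ω' | (x, W 0 ω') ∈ D} :=
    measurable_measure_prodMk_left (ν := P)
      ((show Measurable fun p : ℝ × Ω => (p.1, W 0 p.2) by fun_prop) hD)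
  exact hm.comp (measurable_pi_apply i)

/-- The void probabilities of an independently marked Poisson process. -/
lemma IsPoissonProcess.measure_forall_notMem (hU : IsPoissonProcess U μ P)
    (hW : ∀ i, Measurable (W i)) (hid : ∀ i, IdentDistrib (W i) (W 0) P P)
    (hindep : iIndepFun W P) (hUW : IndepFun (fun ω i => U i ω) (fun ω i => W i ω) P)
    {D : Set (ℝ × E)} (hD : MeasurableSet D) (hfin : ∫⁻ x, P {ω | (x, W 0 ω) ∈ D} ∂μ ≠ ∞) :
    P {ω | ∀ i, (U i ω, W i ω) ∉ D} =
      ENNReal.ofReal (Real.exp (-(∫⁻ x, P {ω | (x, W 0 ω) ∈ D} ∂μ).toReal)) := by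
  have := hU.isProbabilityMeasure
  have hm : Measurable fun x : ℝ => P {ω' | (x, W 0 ω') ∈ D} :=
    measurable_measure_prodMk_left (ν := P)
      ((show Measurable fun p : ℝ × Ω => (p.1, W 0 p.2) by fun_prop) hD)
  rw [← hU.lintegral_iInf_prod hm (fun x => prob_le_one) hfin]
  have hanti : Antitone fun (n : ℕ) ω =>
      ∏ i ∈ Finset.range n, (1 - P {ω' | (U i ω, W 0 ω') ∈ D}) := by
    intro m n hmn ω
    exact Finset.prod_le_prod_of_subset_of_le_one' (Finset.range_mono hmn)
      fun i _ _ => tsub_le_self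
  rw [lintegral_iInf]
  · simp_rw [← measure_forall_lt_notMem hU.measurable hW hid hindep hUW hD]
    have hset : {ω | ∀ i, (U i ω, W i ω) ∉ D} =
        ⋂ n : ℕ, {ω | ∀ i ∈ Finset.range n, (U i ω, W i ω) ∉ D} := by
      ext ω
      simp only [Set.mem_ofPred_eq, Set.mem_iInter, Finset.mem_range]
      exact ⟨fun h n i _ => h i, fun h i => h (i + 1) i (Nat.lt_succ_self i)⟩
    rw [hset]
    refine Antitone.measure_iInter ?_ (fun n => ?_) ⟨0, measure_ne_top _ _⟩
    · intro m n hmn ω hω i hi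
      exact hω i (Finset.range_mono hmn hi)
    · have : {ω | ∀ i ∈ Finset.range n, (U i ω, W i ω) ∉ D} =
          ⋂ i ∈ Finset.range n, (fun ω => (U i ω, W i ω)) ⁻¹' Dᶜ := by
        ext; simp
      rw [this]
      exact (Finset.measurableSet_biInter _ fun i _ =>
        ((hU.measurable i).prodMk (hW i)) hD.compl).nullMeasurableSet
  · intro n
    refine Finset.measurable_prod _ fun i _ => Measurable.const_sub ?_ 1
    exact hm.comp (hU.measurable i)
  · exact hanti
  · simp

end Marked

/-! ### Mean number of exceeding paths in the Poisson model -/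

section Exceedance

variable {Ω S : Type*} [MeasurableSpace Ω] {P : Measure Ω}

/-- The mean number of points `u` of a Poisson process with intensity `e^{-u} du`, marked with
independent copies of `ξ`, for which `u + ξ` exceeds the level `y` somewhere on `J`. -/
noncomputable def exceedance (P : Measure Ω) (ξ : S → Ω → ℝ) (y : S → ℝ) (J : Finset S) : ℝ≥0∞ :=
  ∫⁻ u, P {ω | ∃ t ∈ J, y t < u + ξ t ω} ∂expIntensity

lemma exceedance_empty (ξ : S → Ω → ℝ) (y : S → ℝ) : exceedance P ξ y ∅ = 0 := by
  simp [exceedance]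

lemma measurable_ofReal_exp_neg : Measurable fun u : ℝ => ENNReal.ofReal (Real.exp (-u)) := by
  fun_prop

lemma lintegral_expIntensity {f : ℝ → ℝ≥0∞} (hf : Measurable f) :
    ∫⁻ u, f u ∂expIntensity = ∫⁻ u, ENNReal.ofReal (Real.exp (-u)) * f u := by
  rw [expIntensity, lintegral_withDensity_eq_lintegral_mul _ measurable_ofReal_exp_neg hf]
  rfl

lemma measurableSet_first_exceedance {ξ : S → Ω → ℝ} (hξ : ∀ t, Measurable (ξ t)) (y : S → ℝ)
    (t : S) (J : Finset S) :
    MeasurableSet {p : ℝ × Ω | y t < p.1 + ξ t p.2 ∧ ∀ s ∈ J, p.1 + ξ s p.2 ≤ y s} := by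
  have : {p : ℝ × Ω | y t < p.1 + ξ t p.2 ∧ ∀ s ∈ J, p.1 + ξ s p.2 ≤ y s} =
      {p : ℝ × Ω | y t < p.1 + ξ t p.2} ∩ ⋂ s ∈ J, {p | p.1 + ξ s p.2 ≤ y s} := by
    ext; simp
  rw [this]
  refine (measurableSet_lt measurable_const ?_).inter
    (Finset.measurableSet_biInter _ fun s _ => measurableSet_le ?_ measurable_const)
  · exact measurable_fst.add ((hξ t).comp measurable_snd)
  · exact measurable_fst.add ((hξ s).comp measurable_snd)

/-- A path exceeding on `insert t J` either exceeds on `J` or does so at `t` only. This recursion in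
the index set is what the prelimit is compared with. -/
lemma exceedance_insert [DecidableEq S] [SFinite P] {ξ : S → Ω → ℝ} (hξ : ∀ t, Measurable (ξ t))
    (y : S → ℝ) (t : S) (J : Finset S) :
    exceedance P ξ y (insert t J) = exceedance P ξ y J +
      ∫⁻ u, P {ω | y t < u + ξ t ω ∧ ∀ s ∈ J, u + ξ s ω ≤ y s} ∂expIntensity := by
  have hm := measurableSet_first_exceedance hξ y t J
  have hmeas : Measurable fun u => P {ω | y t < u + ξ t ω ∧ ∀ s ∈ J, u + ξ s ω ≤ y s} :=
    measurable_measure_prodMk_left (ν := P) hm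
  rw [exceedance, exceedance, ← lintegral_add_right _ hmeas]
  congr with u
  rw [← measure_union]
  · congr 1
    ext ω
    simp only [Finset.mem_insert, exists_eq_or_imp, Set.mem_ofPred_eq, Set.mem_union]
    by_cases h : ∃ a ∈ J, y a < u + ξ a ω
    · simp [h]
    · simp only [h, or_false, false_or]
      push Not at h
      exact ⟨fun h1 => ⟨h1, h⟩, fun h1 => h1.1⟩
  · refine Set.disjoint_left.2 fun ω ⟨s, hs, h1⟩ h2 => ?_
    exact absurd (h2.2 s hs) (not_le.2 h1)
  · exact measurable_prodMk_left hm

/-- Change of variables moving the point of first exceedance to the index `t`. -/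
lemma lintegral_first_exceedance [SFinite P] {ξ : S → Ω → ℝ} (hξ : ∀ t, Measurable (ξ t))
    (y : S → ℝ) (t : S) (J : Finset S) :
    ∫⁻ u, P {ω | y t < u + ξ t ω ∧ ∀ s ∈ J, u + ξ s ω ≤ y s} ∂expIntensity =
      ∫⁻ z in Set.Ioi (y t), ENNReal.ofReal (Real.exp (-z)) *
        (P.withDensity fun ω => ENNReal.ofReal (Real.exp (ξ t ω)))
          {ω | ∀ s ∈ J, z + (ξ s ω - ξ t ω) ≤ y s} := by
  set B : Set (ℝ × Ω) := {p | y t < p.1 + ξ t p.2 ∧ ∀ s ∈ J, p.1 + ξ s p.2 ≤ y s} with hB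
  have hBm : MeasurableSet B := measurableSet_first_exceedance hξ y t J
  set C : Set (ℝ × Ω) := {p | y t < p.1 ∧ ∀ s ∈ J, p.1 + (ξ s p.2 - ξ t p.2) ≤ y s} with hC
  have hshift : ∀ p : ℝ × Ω, (p.1 - ξ t p.2, p.2) ∈ B ↔ p ∈ C := by
    intro p
    simp only [hB, hC, Set.mem_ofPred_eq, sub_add_cancel]
    refine and_congr Iff.rfl (forall₂_congr fun s _ => ?_)
    rw [sub_add_eq_add_sub, add_sub_assoc]
  have hCm : MeasurableSet C := by
    have : C = (fun p : ℝ × Ω => (p.1 - ξ t p.2, p.2)) ⁻¹' B := by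
      ext p; exact (hshift p).symm
    rw [this]
    exact (((measurable_fst.sub ((hξ t).comp measurable_snd)).prodMk measurable_snd)) hBm
  have hexpm : Measurable fun ω => ENNReal.ofReal (Real.exp (ξ t ω)) :=
    (Real.measurable_exp.comp (hξ t)).ennreal_ofReal
  have hmeasB : Measurable fun u => P {ω | (u, ω) ∈ B} :=
    measurable_measure_prodMk_left (ν := P) hBm
  change ∫⁻ u, P {ω | (u, ω) ∈ B} ∂expIntensity = _
  rw [lintegral_expIntensity hmeasB, ← lintegral_indicator measurableSet_Ioi]
  have h1 : ∀ u, ENNReal.ofReal (Real.exp (-u)) * P {ω | (u, ω) ∈ B} =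
      ∫⁻ ω, ENNReal.ofReal (Real.exp (-u)) * B.indicator 1 (u, ω) ∂P := by
    intro u
    rw [lintegral_const_mul (f := fun ω => B.indicator 1 (u, ω)) _
      ((measurable_one.indicator hBm).comp measurable_prodMk_left)]
    congr 1
    exact (lintegral_indicator_one (measurable_prodMk_left hBm)).symm
  have h2 : ∀ z, (Set.Ioi (y t)).indicator (fun z => ENNReal.ofReal (Real.exp (-z)) *
      (P.withDensity fun ω => ENNReal.ofReal (Real.exp (ξ t ω)))
        {ω | ∀ s ∈ J, z + (ξ s ω - ξ t ω) ≤ y s}) z =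
      ∫⁻ ω, ENNReal.ofReal (Real.exp (-(z - ξ t ω))) * C.indicator 1 (z, ω) ∂P := by
    intro z
    by_cases hz : z ∈ Set.Ioi (y t)
    · have hset : {ω | ∀ s ∈ J, z + (ξ s ω - ξ t ω) ≤ y s} = Prod.mk z ⁻¹' C := by
        ext ω
        simp only [hC, Set.mem_preimage, Set.mem_ofPred_eq]
        exact ⟨fun h => ⟨hz, h⟩, fun h => h.2⟩
      rw [Set.indicator_of_mem hz, hset, withDensity_apply _ (measurable_prodMk_left hCm),
        ← lintegral_indicator (measurable_prodMk_left hCm),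
        ← lintegral_const_mul _ (hexpm.indicator (measurable_prodMk_left hCm))]
      congr with ω
      rw [neg_sub, sub_eq_add_neg, Real.exp_add, ENNReal.ofReal_mul (Real.exp_pos _).le]
      by_cases h : (z, ω) ∈ C
      · rw [Set.indicator_of_mem h, Set.indicator_of_mem (show ω ∈ Prod.mk z ⁻¹' C from h)]
        simp [mul_comm]
      · rw [Set.indicator_of_notMem h, Set.indicator_of_notMem (show ω ∉ Prod.mk z ⁻¹' C from h)]
        simp
    · rw [Set.indicator_of_notMem hz]
      have : ∀ ω, C.indicator (1 : ℝ × Ω → ℝ≥0∞) (z, ω) = 0 := fun ω =>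
        Set.indicator_of_notMem (fun h => hz h.1) _
      simp [this]
  -- Both sides are now double integrals. For fixed `ω` the translation `z = u + ξ t ω` identifies
  -- them, since `e^{-u} = e^{-z} e^{ξ t ω}`.
  simp_rw [h1, h2]
  refine (lintegral_lintegral_swap ?_).trans (Eq.trans ?_ (lintegral_lintegral_swap ?_).symm)
  · refine Measurable.aemeasurable (Measurable.mul ?_ (measurable_one.indicator hBm))
    exact (Real.measurable_exp.comp measurable_fst.neg).ennreal_ofReal
  · congr with ω
    rw [← lintegral_sub_right_eq_self _ (ξ t ω)]
    congr with z
    congr 1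
    by_cases h : (z, ω) ∈ C
    · rw [Set.indicator_of_mem h, Set.indicator_of_mem ((hshift (z, ω)).2 h)]; rfl
    · rw [Set.indicator_of_notMem h,
        Set.indicator_of_notMem (fun h' => h ((hshift (z, ω)).1 h'))]
  · refine Measurable.aemeasurable (Measurable.mul ?_ (measurable_one.indicator hCm))
    exact (Real.measurable_exp.comp
      (measurable_fst.sub ((hξ t).comp measurable_snd)).neg).ennreal_ofReal

lemma lintegral_Ioi_exp_neg (a : ℝ) :
    ∫⁻ z in Set.Ioi a, ENNReal.ofReal (Real.exp (-z)) = ENNReal.ofReal (Real.exp (-a)) := by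
  rw [← ofReal_integral_eq_lintegral_ofReal (integrableOn_exp_neg_Ioi a)
    (.of_forall fun z => (Real.exp_pos _).le), integral_exp_neg_Ioi]

/-- The tilted measures have mass one, so each index adds at most `∫ e^{-z} dz` over `(y t, ∞)`,
that is `e^{-y t}`. -/
lemma exceedance_ne_top [IsProbabilityMeasure P] {ξ : S → Ω → ℝ} (hξ : ∀ t, Measurable (ξ t))
    (hexp : ∀ t, ∫⁻ ω, ENNReal.ofReal (Real.exp (ξ t ω)) ∂P = 1) (y : S → ℝ) (J : Finset S) :
    exceedance P ξ y J ≠ ∞ := by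
  classical
  induction J using Finset.induction_on with
  | empty => simp [exceedance_empty]
  | insert t J _ ih =>
    rw [exceedance_insert hξ, lintegral_first_exceedance hξ]
    refine ENNReal.add_ne_top.2 ⟨ih, ne_top_of_le_ne_top (b := ENNReal.ofReal (Real.exp (-y t)))
      ENNReal.ofReal_ne_top ?_⟩
    rw [← lintegral_Ioi_exp_neg]
    refine lintegral_mono fun z => mul_le_of_le_one_right' ?_
    refine (measure_mono (Set.subset_univ _)).trans ?_
    rw [withDensity_apply _ .univ, Measure.restrict_univ, hexp]

end Exceedance

/-! ### Exponential tilting of Gaussian vectors -/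

section GaussianTilt

variable {Ω S : Type*} [MeasurableSpace Ω] {P : Measure Ω}

lemma isGaussianProcess_linComb {X : S → Ω → ℝ} (hX : IsGaussianProcess X P) {κ ι : Type*}
    [Fintype κ] (f : κ → S) (a : ι → κ → ℝ) :
    IsGaussianProcess (fun i ω => ∑ k, a i k * X (f k) ω) P := by
  classical
  refine hX.of_isGaussianProcess fun i => ⟨Finset.univ.image f,
    ∑ k, a i k • ContinuousLinearMap.proj (R := ℝ) (φ := fun _ => ℝ)
      (⟨f k, Finset.mem_image_of_mem f (Finset.mem_univ k)⟩ : Finset.univ.image f), fun ω => ?_⟩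
  simp

lemma variance_linComb [IsFiniteMeasure P] {X : S → Ω → ℝ} (hX : ∀ s, MemLp (X s) 2 P) {κ : Type*}
    [Fintype κ] (f : κ → S) (a : κ → ℝ) :
    Var[fun ω => ∑ k, a k * X (f k) ω; P] =
      ∑ k, ∑ l, a k * a l * cov[X (f k), X (f l); P] := by
  have hm : ∀ k, MemLp (fun ω => a k * X (f k) ω) 2 P := fun k => (hX (f k)).const_mul (a k)
  rw [← covariance_self, covariance_fun_sum_fun_sum hm hm]
  · refine Finset.sum_congr rfl fun k _ => Finset.sum_congr rfl fun l _ => ?_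
    rw [covariance_const_mul_left, covariance_const_mul_right, mul_assoc]
  · exact (memLp_finsetSum _ fun k _ => hm k).aestronglyMeasurable.aemeasurable

lemma measurable_exp_sub_const {B : Ω → ℝ} (hB : Measurable B) (c : ℝ) :
    Measurable fun ω => ENNReal.ofReal (Real.exp (B ω - c)) := by
  fun_prop

lemma mgf_eq_of_hasGaussianLaw {B : Ω → ℝ} (hB : HasGaussianLaw B P) (x : ℝ) :
    mgf B P x = Real.exp (P[B] * x + Var[B; P] * x ^ 2 / 2) := by
  rw [mgf_gaussianReal hB.map_eq_gaussianReal, Real.coe_toNNReal _ (variance_nonneg _ _)]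

lemma integrable_exp_of_hasGaussianLaw {B : Ω → ℝ} (hB : HasGaussianLaw B P) :
    Integrable (fun ω => Real.exp (B ω)) P := by
  have := hB.isProbabilityMeasure
  have h : 0 < mgf B P 1 := by rw [mgf_eq_of_hasGaussianLaw hB]; positivity
  simpa using mgf_pos_iff.1 h

lemma lintegral_exp_sub_variance {B : Ω → ℝ} (hB : HasGaussianLaw B P) (h0 : P[B] = 0) :
    ∫⁻ ω, ENNReal.ofReal (Real.exp (B ω - Var[B; P] / 2)) ∂P = 1 := by
  have h1 : ∫ ω, Real.exp (B ω) ∂P = Real.exp (Var[B; P] / 2) := by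
    simpa [mgf, h0] using mgf_eq_of_hasGaussianLaw hB 1
  rw [← ofReal_integral_eq_lintegral_ofReal _ (.of_forall fun ω => (Real.exp_pos _).le)]
  · simp_rw [Real.exp_sub]
    rw [integral_div, h1, div_self (Real.exp_ne_zero _), ENNReal.ofReal_one]
  · simp_rw [Real.exp_sub]
    exact (integrable_exp_of_hasGaussianLaw hB).div_const _

/-- Exponential tilting of a Gaussian vector by one of its components. -/
lemma map_withDensity_exp {A B : Ω → ℝ} (hAB : HasGaussianLaw (fun ω => (A ω, B ω)) P)
    (hA : Measurable A) (hB : Measurable B) (hA0 : P[A] = 0) (hB0 : P[B] = 0) :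
    (P.withDensity fun ω => ENNReal.ofReal (Real.exp (B ω - Var[B; P] / 2))).map A =
      gaussianReal cov[A, B; P] Var[A; P].toNNReal := by
  have hP := hAB.isProbabilityMeasure
  set Q := P.withDensity fun ω => ENNReal.ofReal (Real.exp (B ω - Var[B; P] / 2)) with hQ
  have hdm := measurable_exp_sub_const hB (Var[B; P] / 2)
  have hQp : IsProbabilityMeasure Q := ⟨by
    rw [hQ, withDensity_apply _ .univ, Measure.restrict_univ,
      lintegral_exp_sub_variance hAB.snd hB0]⟩
  -- The moment generating function under `Q` is the Gaussian expectation of `exp (x A + B - Var B /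
  -- 2)`, whose logarithm is `x cov[A, B] + x² Var A / 2`. It is finite for all `x`, so it
  -- determines the law.
  have hmgf : mgf A Q = mgf id (gaussianReal cov[A, B; P] Var[A; P].toNNReal) := by
    ext x
    rw [mgf_id_gaussianReal, Real.coe_toNNReal _ (variance_nonneg _ _), mgf, hQ,
      integral_withDensity_eq_integral_toReal_smul hdm (.of_forall fun _ => ENNReal.ofReal_lt_top)]
    have hL : HasGaussianLaw (fun ω => x * A ω + B ω) P :=
      hAB.map_fun (x • ContinuousLinearMap.fst ℝ ℝ ℝ + ContinuousLinearMap.snd ℝ ℝ ℝ)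
    have hA2 : MemLp A 2 P := hAB.fst.memLp_two
    have hB2 : MemLp B 2 P := hAB.snd.memLp_two
    have hxA2 : MemLp (fun ω => x * A ω) 2 P := hA2.const_mul x
    have hL0 : ∫ ω, (x * A ω + B ω) ∂P = 0 := by
      rw [integral_add (hxA2.integrable one_le_two) (hB2.integrable one_le_two),
        integral_const_mul, hA0, hB0]
      simp
    have hLv : Var[fun ω => x * A ω + B ω; P] =
        x ^ 2 * Var[A; P] + 2 * x * cov[A, B; P] + Var[B; P] := by
      have := variance_add hxA2 hB2
      rw [variance_const_mul, covariance_const_mul_left] at this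
      rw [show (fun ω => x * A ω + B ω) = (fun ω => x * A ω) + B from rfl, this]
      ring
    have h1 : ∫ ω, Real.exp (x * A ω + B ω) ∂P =
        Real.exp (Var[fun ω => x * A ω + B ω; P] / 2) := by
      simpa [mgf, hL0] using mgf_eq_of_hasGaussianLaw hL 1
    have h2 : ∀ ω, (ENNReal.ofReal (Real.exp (B ω - Var[B; P] / 2))).toReal • Real.exp (x * A ω) =
        Real.exp (x * A ω + B ω) * Real.exp (-(Var[B; P] / 2)) := by
      intro ω
      rw [ENNReal.toReal_ofReal (Real.exp_pos _).le, smul_eq_mul, ← Real.exp_add, ← Real.exp_add]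
      ring_nf
    simp_rw [h2]
    rw [integral_mul_const, h1, ← Real.exp_add, hLv]
    ring_nf
  rw [← Measure.map_id (μ := gaussianReal _ _)]
  refine Measure.ext_of_complexMGF_eq hA.aemeasurable aemeasurable_id ?_
  · have hset : integrableExpSet A Q = Set.univ := by
      rw [integrableExpSet_eq_of_mgf hmgf]; simp
    ext z
    exact eqOn_complexMGF_of_mgf hmgf (by simp [hset])

end GaussianTilt

/-! ### Increments of the Gaussian process under the tilt -/

section IncrementalVariance

variable {Ω S : Type*} [MeasurableSpace Ω] {P : Measure Ω} {W : S → Ω → ℝ} {Γ : S → S → ℝ}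

lemma HasIncrementalVariance.memLp_two (hW : HasIncrementalVariance W Γ P) (t : S) :
    MemLp (W t) 2 P :=
  (hW.gaussian.hasGaussianLaw_eval t).memLp_two

lemma HasIncrementalVariance.covariance_eq (hW : HasIncrementalVariance W Γ P) (s t : S) :
    cov[W s, W t; P] = (Var[W s; P] + Var[W t; P] - Γ s t) / 2 := by
  have := hW.gaussian.isProbabilityMeasure
  have h := variance_sub (hW.memLp_two s) (hW.memLp_two t)
  rw [show W s - W t = fun ω => W s ω - W t ω from rfl, hW.incr] at h
  linarith

/-- Under the measure tilted by `W t`, the increments of the drifted process `W - σ² / 2` from `t`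
form a Gaussian process whose law depends only on the incremental variance. -/
lemma HasIncrementalVariance.map_withDensity_linComb (hW : HasIncrementalVariance W Γ P)
    (hWm : ∀ t, Measurable (W t)) (t : S) {κ : Type*} [Fintype κ] (f : κ → S) (θ : κ → ℝ) :
    (P.withDensity fun ω => ENNReal.ofReal (Real.exp (W t ω - Var[W t; P] / 2))).map
      (fun ω => ∑ k, θ k * ((W (f k) ω - Var[W (f k); P] / 2) - (W t ω - Var[W t; P] / 2))) =
    gaussianReal (-∑ k, θ k * Γ (f k) t / 2)
      (∑ k, ∑ l, θ k * θ l * ((Γ (f k) t + Γ (f l) t - Γ (f k) (f l)) / 2)).toNNReal := by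
  have hP := hW.gaussian.isProbabilityMeasure
  set A : Ω → ℝ := fun ω => ∑ k, θ k * (W (f k) ω - W t ω) with hA
  have hAm : Measurable A := Finset.measurable_sum _ fun k _ =>
    ((hWm _).sub (hWm t)).const_mul _
  -- Both components are linear combinations of values of `W` indexed by `Option κ`, where `none`
  -- stands for the base point `t`.
  have hAB : HasGaussianLaw (fun ω => (A ω, W t ω)) P := by
    have h := isGaussianProcess_linComb hW.gaussian (κ := Option κ) (ι := Bool)
      (fun o => o.elim t f) (fun b o => if b then o.elim (-∑ k, θ k) θ else o.elim 1 0)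
    convert h.hasGaussianLaw_prodMk (s := true) (t := false) using 3 with ω
    · simp [Fintype.sum_option, hA, mul_sub, Finset.sum_mul]
      ring
    · simp [Fintype.sum_option]
  have hint : ∀ s, Integrable (W s) P := fun s => (hW.memLp_two s).integrable one_le_two
  have hA0 : P[A] = 0 := by
    change ∫ ω, ∑ k, θ k * (W (f k) ω - W t ω) ∂P = 0
    have hincint : ∀ k, Integrable (fun ω => θ k * (W (f k) ω - W t ω)) P :=
      fun k => Integrable.const_mul ((hint (f k)).sub (hint t)) (θ k)
    rw [integral_finsetSum _ fun k _ => hincint k]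
    refine Finset.sum_eq_zero fun k _ => ?_
    rw [integral_const_mul, integral_sub (hint _) (hint t), hW.mean_zero, hW.mean_zero]
    simp
  have hinc : ∀ k, MemLp (fun ω => W (f k) ω - W t ω) 2 P :=
    fun k => (hW.memLp_two _).sub (hW.memLp_two t)
  have hcov : cov[A, W t; P] = ∑ k, θ k * ((Var[W (f k); P] - Var[W t; P] - Γ (f k) t) / 2) := by
    rw [hA, covariance_fun_sum_left (fun k => (hinc k).const_mul (θ k)) (hW.memLp_two t)]
    refine Finset.sum_congr rfl fun k _ => ?_
    rw [covariance_const_mul_left, covariance_fun_sub_left (hW.memLp_two _) (hW.memLp_two t)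
      (hW.memLp_two t), covariance_self (hWm t).aemeasurable, hW.covariance_eq]
    ring
  have hvar : Var[A; P] =
      ∑ k, ∑ l, θ k * θ l * ((Γ (f k) t + Γ (f l) t - Γ (f k) (f l)) / 2) := by
    refine (variance_linComb (X := fun k ω => W (f k) ω - W t ω) hinc id θ).trans ?_
    refine Finset.sum_congr rfl fun k _ => Finset.sum_congr rfl fun l _ => ?_
    simp only [id]
    rw [covariance_fun_sub_fun_sub (hW.memLp_two _) (hW.memLp_two t) (hW.memLp_two _)
      (hW.memLp_two t), covariance_self (hWm t).aemeasurable, hW.covariance_eq, hW.covariance_eq,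
      covariance_comm, hW.covariance_eq]
    ring
  -- The tilt moves the mean of `A` by `cov[A, W t]`. Adding the drifts cancels all variances of `W`
  -- and leaves `-Γ / 2`, so the choice of `W` with incremental variance `Γ` does not matter.
  have hmain := map_withDensity_exp hAB hAm (hWm t) hA0 (hW.mean_zero t)
  have hfun : (fun ω => ∑ k, θ k * ((W (f k) ω - Var[W (f k); P] / 2) -
      (W t ω - Var[W t; P] / 2))) =
      (· + -∑ k, θ k * ((Var[W (f k); P] - Var[W t; P]) / 2)) ∘ A := by
    ext ω
    simp only [hA, Function.comp, ← sub_eq_add_neg, ← Finset.sum_sub_distrib]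
    refine Finset.sum_congr rfl fun k _ => ?_
    ring
  rw [hfun, ← Measure.map_map (by fun_prop) hAm, hmain, gaussianReal_map_add_const, hvar, hcov,
    ← sub_eq_add_neg, ← Finset.sum_sub_distrib, ← Finset.sum_neg_distrib]
  congr 1
  refine Finset.sum_congr rfl fun k _ => ?_
  ring

end IncrementalVariance

/-! ### Distribution functions of the limit process -/

section LimitDistribution

variable {Ω S T : Type*} [MeasurableSpace Ω] {P : Measure Ω}

/-- The drifted process `W - σ² / 2`. -/
noncomputable def drifted (W : S → Ω → ℝ) (P : Measure Ω) (t : S) (ω : Ω) : ℝ :=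
  W t ω - Var[W t; P] / 2

lemma measurable_drifted {W : S → Ω → ℝ} (hW : ∀ t, Measurable (W t)) (t : S) :
    Measurable (drifted W P t) :=
  (hW t).sub_const _

lemma HasIncrementalVariance.lintegral_exp_drifted {W : S → Ω → ℝ} {Γ : S → S → ℝ}
    (hW : HasIncrementalVariance W Γ P) (t : S) :
    ∫⁻ ω, ENNReal.ofReal (Real.exp (drifted W P t ω)) ∂P = 1 :=
  lintegral_exp_sub_variance (hW.gaussian.hasGaussianLaw_eval t) (hW.mean_zero t)

/-- The finite-dimensional distribution functions of `M_Γ`. -/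
lemma IsGaussPoissonMax.exists_measure_le {Γ : S → S → ℝ} {M : S → Ω → ℝ}
    (hM : IsGaussPoissonMax Γ M P) :
    ∃ W : S → Ω → ℝ, (∀ t, Measurable (W t)) ∧ HasIncrementalVariance W Γ P ∧
      ∀ (y : S → ℝ) (J : Finset S), P {ω | ∀ t ∈ J, M t ω ≤ y t} =
        ENNReal.ofReal (Real.exp (-(exceedance P (drifted W P) y J).toReal)) := by
  obtain ⟨U, W, hU, hWm, hW, hid, hindep, hUW, hmax⟩ := hM
  have hP := hU.isProbabilityMeasure
  refine ⟨W 0, hWm 0, hW, fun y J => ?_⟩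
  set D : Set (ℝ × (S → ℝ)) := {p | ∃ t ∈ J, y t < p.1 + (p.2 t - Var[W 0 t; P] / 2)} with hD
  have hDm : MeasurableSet D := by
    have : D = ⋃ t ∈ J, {p | y t < p.1 + (p.2 t - Var[W 0 t; P] / 2)} := by
      ext; simp [hD]
    rw [this]
    exact Finset.measurableSet_biUnion _ fun t _ =>
      measurableSet_lt measurable_const (by fun_prop)
  have hvoid := hU.measure_forall_notMem (W := fun i ω t => W i t ω)
    (fun i => measurable_pi_lambda _ fun t => hWm i t) hid hindep hUW hDm
    (exceedance_ne_top (fun t => measurable_drifted (hWm 0) t) hW.lintegral_exp_drifted y J)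
  refine Eq.trans (measure_congr ?_) hvoid
  have hall : ∀ᵐ ω ∂P, ∀ t : J,
      IsGreatest (Set.range fun i => U i ω + W i t ω - Var[W 0 t; P] / 2) (M t ω) :=
    ae_all_iff.2 fun t => hmax t
  filter_upwards [hall] with ω hω
  refine propext ?_
  change (∀ t ∈ J, M t ω ≤ y t) ↔ ∀ i, ¬ ∃ t ∈ J, y t < U i ω + (W i t ω - Var[W 0 t; P] / 2)
  push Not
  constructor
  · intro h i t ht
    have := (hω ⟨t, ht⟩).2 ⟨i, rfl⟩
    have h2 := h t ht
    simp only at this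
    linarith
  · intro h t ht
    obtain ⟨i, hi⟩ := (hω ⟨t, ht⟩).1
    have := h i t ht
    simp only at hi
    linarith

/-- Under `Q`, the process `η` has on the class of `t` the law of the increments from `t` of the
tilted process. -/
structure IsTiltedIncrement (Γ : T → T → ℝ≥0∞) (t : T) (η : T → Ω → ℝ) (Q : Measure Ω) : Prop where
  measurable : ∀ s, Measurable (η s)
  map_linComb : ∀ (J : Finset T) (θ : J → ℝ), (∀ s ∈ J, Γ s t ≠ ∞) →
    Q.map (fun ω => ∑ s, θ s * η s ω) = gaussianReal (-∑ s, θ s * (Γ s t).toReal / 2)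
      (∑ s, ∑ s', θ s * θ s' *
        (((Γ s t).toReal + (Γ s' t).toReal - (Γ s s').toReal) / 2)).toNNReal

/-- This collects all that the convergence proof uses about the limit: the exponent `Λ` and the
recursion determining it from `Λ ∅ = 0`. Independence of the classes makes `Λ` a sum over classes,
and a new index `t` affects only the summand of its own class. The larger set is described by
membership so that no decidable equality enters the statement. -/
lemma IsLimitProcess.exists_measure_le {Γ : T → T → ℝ≥0∞} {M : T → Ω → ℝ}
    [IsProbabilityMeasure P] (hM : IsLimitProcess Γ M P) (y : T → ℝ) :
    ∃ Λ : Finset T → ℝ≥0∞, Λ ∅ = 0 ∧ (∀ I, Λ I ≠ ∞) ∧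
      (∀ I : Finset T, P {ω | ∀ t ∈ I, M t ω ≤ y t} =
        ENNReal.ofReal (Real.exp (-(Λ I).toReal))) ∧
      ∀ t, ∃ (η : T → Ω → ℝ) (Q : Measure Ω), IsProbabilityMeasure Q ∧
        IsTiltedIncrement Γ t η Q ∧
        ∀ (I : Finset T) (I' : Finset T), t ∉ I → (∀ s, s ∈ I' ↔ s = t ∨ s ∈ I) →
          Λ I' = Λ I + ∫⁻ z in Set.Ioi (y t), ENNReal.ofReal (Real.exp (-z)) *
          Q {ω | ∀ s ∈ I, Γ s t ≠ ∞ → z + η s ω ≤ y s} := by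
  classical
  obtain ⟨hMm, s, hΓ, hmax, hindep⟩ := hM
  choose W hWm hW hdist using fun q => (hmax q).exists_measure_le
  set part : Finset T → (q : Quotient s) → Finset (Block s q) :=
    fun I q => I.subtype fun t => Quotient.mk s t = q with hpart
  set ex : Finset T → Quotient s → ℝ≥0∞ :=
    fun I q => exceedance P (drifted (W q) P) (fun t => y t) (part I q) with hex
  have hextop : ∀ I q, ex I q ≠ ∞ := fun I q =>
    exceedance_ne_top (fun t => measurable_drifted (hWm q) t) (hW q).lintegral_exp_drifted _ _
  refine ⟨fun I => ∑ q ∈ I.image (Quotient.mk s), ex I q, by simp, fun I =>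
    ENNReal.sum_ne_top.2 fun q _ => hextop I q, fun I => ?_, fun t => ?_⟩
  · have hset : {ω | ∀ t ∈ I, M t ω ≤ y t} = ⋂ q ∈ I.image (Quotient.mk s),
        (fun ω (t : Block s q) => M t ω) ⁻¹' {x | ∀ t ∈ part I q, x t ≤ y t} := by
      ext ω
      simp only [Set.mem_ofPred_eq, Set.mem_iInter, Set.mem_preimage, hpart, Finset.mem_subtype,
        Finset.mem_image]
      constructor
      · intro h q _ t ht
        exact h t ht
      · intro h t ht
        exact h (Quotient.mk s t) ⟨t, ht, rfl⟩ ⟨t, rfl⟩ ht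
    rw [hset, hindep.measure_inter_preimage_eq_mul]
    · rw [ENNReal.toReal_sum fun q _ => hextop I q, ← Finset.sum_neg_distrib, Real.exp_sum,
        ENNReal.ofReal_prod_of_nonneg fun _ _ => (Real.exp_pos _).le]
      exact Finset.prod_congr rfl fun q _ => hdist q (fun t => y t) (part I q)
    · intro q _
      have : {x : Block s q → ℝ | ∀ t ∈ part I q, x t ≤ y t} =
          ⋂ t ∈ part I q, {x | x t ≤ y t} := by ext; simp
      rw [this]
      exact Finset.measurableSet_biInter _ fun t _ =>
        measurableSet_le (measurable_pi_apply t) measurable_const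
  · set q₀ := Quotient.mk s t with hq₀
    set t₀ : Block s q₀ := ⟨t, rfl⟩ with ht₀
    set ξ := drifted (W q₀) P with hξ
    have hξm : ∀ r, Measurable (ξ r) := fun r => measurable_drifted (hWm q₀) r
    -- Outside the class of `t` the value is arbitrary, measurability aside: laws and recursion
    -- involve only indices with `Γ r t ≠ ∞`.
    set η : T → Ω → ℝ := fun r ω =>
      if h : Quotient.mk s r = q₀ then ξ ⟨r, h⟩ ω - ξ t₀ ω else 0 with hη
    set Q := P.withDensity fun ω => ENNReal.ofReal (Real.exp (ξ t₀ ω)) with hQ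
    refine ⟨η, Q, ⟨?_⟩, ⟨fun r => ?_, fun J θ hJ => ?_⟩, fun I I' htI hI' => ?_⟩
    · rw [hQ, withDensity_apply _ .univ, Measure.restrict_univ]
      exact (hW q₀).lintegral_exp_drifted t₀
    · by_cases h : Quotient.mk s r = q₀
      · simp only [hη, h, dif_pos]
        exact (hξm ⟨r, h⟩).sub (hξm t₀)
      · simp [hη, h]
    · have hJ' : ∀ r : J, Quotient.mk s (r : T) = q₀ :=
        fun r => (hΓ.ne_top_iff _ _).1 (hJ r r.2)
      have h := (hW q₀).map_withDensity_linComb (hWm q₀) t₀ (κ := J)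
        (fun r => ⟨r, hJ' r⟩) θ
      have hfun : (fun ω => ∑ r, θ r * η r ω) = fun ω => ∑ r : J, θ r *
          ((W q₀ ⟨r, hJ' r⟩ ω - Var[W q₀ ⟨r, hJ' r⟩; P] / 2) -
            (W q₀ t₀ ω - Var[W q₀ t₀; P] / 2)) := by
        ext ω
        refine Finset.sum_congr rfl fun r _ => ?_
        simp only [hη, hJ' r, dif_pos]
        rfl
      rw [hfun]
      exact h
    · have hsub : (I.image (Quotient.mk s)) ⊆ I'.image (Quotient.mk s) :=
        Finset.image_subset_image fun r hr => (hI' r).2 (Or.inr hr)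
      have hzero : ∀ q ∈ I'.image (Quotient.mk s), q ∉ I.image (Quotient.mk s) → ex I q = 0 := by
        intro q _ hq
        have : part I q = ∅ := by
          ext r
          simp only [hpart, Finset.mem_subtype, Finset.notMem_empty, iff_false]
          exact fun hr => hq (Finset.mem_image.2 ⟨r, hr, r.2⟩)
        simp only [hex, this, exceedance_empty]
      have hq₀mem : q₀ ∈ I'.image (Quotient.mk s) :=
        Finset.mem_image.2 ⟨t, (hI' t).2 (Or.inl rfl), rfl⟩
      have hother : ∀ q ∈ (I'.image (Quotient.mk s)).erase q₀, ex I' q = ex I q := by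
        intro q hq
        have : part I' q = part I q := by
          ext r
          simp only [hpart, Finset.mem_subtype, hI']
          refine or_iff_right fun hr => Finset.ne_of_mem_erase hq ?_
          rw [← r.2, hr]
        simp only [hex, this]
      have hins : part I' q₀ = insert t₀ (part I q₀) := by
        ext r
        simp [hpart, hI', ht₀, Subtype.ext_iff]
      beta_reduce
      -- Classes not met by `I` contribute zero, so both sums may run over the classes met by `I'`;
      -- they differ only in the class of `t`.
      rw [Finset.sum_subset hsub hzero, ← Finset.add_sum_erase _ _ hq₀mem,
        ← Finset.add_sum_erase _ (ex I) hq₀mem, Finset.sum_congr rfl hother, add_right_comm]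
      congr 1
      simp only [hex, hins]
      rw [exceedance_insert hξm,
        lintegral_first_exceedance (y := fun r : Block s q₀ => y r) hξm]
      congr 1
      refine lintegral_congr fun z => ?_
      congr 2
      ext ω
      simp only [Set.mem_ofPred_eq, hpart, Finset.mem_subtype]
      constructor
      · intro h r hr hΓr
        have hr' := (hΓ.ne_top_iff _ _).1 hΓr
        have e : η r ω = ξ ⟨r, hr'⟩ ω - ξ t₀ ω := dif_pos hr'
        rw [e]
        exact h ⟨r, hr'⟩ hr
      · intro h r hr
        have := h r hr ((hΓ.ne_top_iff _ _).2 r.2)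
        have e : η r ω = ξ r ω - ξ t₀ ω := dif_pos r.2
        rwa [e] at this

end LimitDistribution

/-! ### Convergence of Gaussian vectors on orthants -/

section GaussianConvergence

lemma charFun_map_toLp {Ω κ : Type*} [MeasurableSpace Ω] [Fintype κ] (P : Measure Ω)
    {V : κ → Ω → ℝ} (hV : ∀ k, AEMeasurable (V k) P) (θ : EuclideanSpace ℝ κ) :
    charFun (P.map fun ω => WithLp.toLp 2 fun k => V k ω) θ =
      charFun (P.map fun ω => ∑ k, θ k * V k ω) 1 := by
  rw [charFun_apply, charFun_apply, integral_map, integral_map]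
  · congr with ω
    simp [PiLp.inner_apply]
  · exact Finset.aemeasurable_fun_sum _ fun k _ => (hV k).const_mul _
  · fun_prop
  · exact (WithLp.measurable_toLp 2 _).comp_aemeasurable (aemeasurable_pi_lambda _ hV)
  · fun_prop

lemma tendsto_charFun_gaussianReal {m : ℕ → ℝ} {v : ℕ → ℝ≥0} {m' : ℝ} {v' : ℝ≥0}
    (hm : Tendsto m atTop (𝓝 m')) (hv : Tendsto v atTop (𝓝 v')) (x : ℝ) :
    Tendsto (fun n => charFun (gaussianReal (m n) (v n)) x) atTop
      (𝓝 (charFun (gaussianReal m' v') x)) := by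
  simp_rw [charFun_gaussianReal]
  have hv2 : Tendsto (fun n => ((v n : ℝ) : ℂ)) atTop (𝓝 ((v' : ℝ) : ℂ)) :=
    (Complex.continuous_ofReal.tendsto _).comp ((NNReal.continuous_coe.tendsto _).comp hv)
  have hm2 : Tendsto (fun n => (m n : ℂ)) atTop (𝓝 (m' : ℂ)) :=
    (Complex.continuous_ofReal.tendsto _).comp hm
  exact (Complex.continuous_exp.tendsto _).comp
    (((hm2.const_mul _).mul_const _).sub (((hv2.mul_const _)).div_const _))

/-- Cramér–Wold for Gaussian vectors, evaluated on lower orthants. -/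
lemma tendsto_measure_forall_le_of_gaussian {κ : Type*} [Fintype κ] {Ω : ℕ → Type*}
    [∀ n, MeasurableSpace (Ω n)] {P : (n : ℕ) → Measure (Ω n)} [∀ n, IsProbabilityMeasure (P n)]
    {Ω' : Type*} [MeasurableSpace Ω'] {Q : Measure Ω'} [IsProbabilityMeasure Q]
    {V : (n : ℕ) → κ → Ω n → ℝ} (hV : ∀ n k, Measurable (V n k))
    {η : κ → Ω' → ℝ} (hη : ∀ k, Measurable (η k))
    {m : (κ → ℝ) → ℕ → ℝ} {v : (κ → ℝ) → ℕ → ℝ≥0} {m' : (κ → ℝ) → ℝ} {v' : (κ → ℝ) → ℝ≥0}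
    (hVlaw : ∀ n θ, (P n).map (fun ω => ∑ k, θ k * V n k ω) = gaussianReal (m θ n) (v θ n))
    (hηlaw : ∀ θ, Q.map (fun ω => ∑ k, θ k * η k ω) = gaussianReal (m' θ) (v' θ))
    (hm : ∀ θ, Tendsto (m θ) atTop (𝓝 (m' θ))) (hv : ∀ θ, Tendsto (v θ) atTop (𝓝 (v' θ)))
    (b : κ → ℝ) (hb : ∀ k, Q {ω | η k ω = b k} = 0) :
    Tendsto (fun n => P n {ω | ∀ k, V n k ω ≤ b k}) atTop (𝓝 (Q {ω | ∀ k, η k ω ≤ b k})) := by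
  have hVm : ∀ n, Measurable fun ω => WithLp.toLp 2 fun k => V n k ω := fun n =>
    (WithLp.measurable_toLp 2 _).comp (measurable_pi_lambda _ (hV n))
  have hηm : Measurable fun ω => WithLp.toLp 2 fun k => η k ω :=
    (WithLp.measurable_toLp 2 _).comp (measurable_pi_lambda _ hη)
  set μ : ℕ → ProbabilityMeasure (EuclideanSpace ℝ κ) := fun n =>
    ⟨(P n).map fun ω => WithLp.toLp 2 fun k => V n k ω,
      Measure.isProbabilityMeasure_map (hVm n).aemeasurable⟩ with hμ
  set ν : ProbabilityMeasure (EuclideanSpace ℝ κ) :=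
    ⟨Q.map fun ω => WithLp.toLp 2 fun k => η k ω,
      Measure.isProbabilityMeasure_map hηm.aemeasurable⟩ with hν
  have hconv : Tendsto μ atTop (𝓝 ν) := by
    refine ProbabilityMeasure.tendsto_of_tendsto_charFun fun θ => ?_
    have h1 : ∀ n, charFun (μ n : Measure (EuclideanSpace ℝ κ)) θ =
        charFun (gaussianReal (m θ n) (v θ n)) 1 := fun n =>
      (charFun_map_toLp (P n) (fun k => (hV n k).aemeasurable) θ).trans (by rw [hVlaw])
    have h2 : charFun (ν : Measure (EuclideanSpace ℝ κ)) θ =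
        charFun (gaussianReal (m' θ) (v' θ)) 1 :=
      (charFun_map_toLp Q (fun k => (hη k).aemeasurable) θ).trans (by rw [hηlaw])
    simp_rw [h1, h2]
    exact tendsto_charFun_gaussianReal (hm θ) (hv θ) 1
  set A : Set (EuclideanSpace ℝ κ) := {x | ∀ k, x k ≤ b k} with hA
  have hAeq : A = ⋂ k, {x | x k ≤ b k} := by ext; simp [hA]
  have hAc : IsClosed A := by
    rw [hAeq]
    exact isClosed_iInter fun k => isClosed_le (by fun_prop) continuous_const
  -- The boundary of the orthant lies in the hyperplanes `x k = b k`. The limit may be degenerate,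
  -- so their nullity comes from `hb` and not from a density.
  have hfr : (ν : Measure (EuclideanSpace ℝ κ)) (frontier A) = 0 := by
    have hsub : frontier A ⊆ ⋃ k, {x : EuclideanSpace ℝ κ | x k = b k} := by
      intro x hx
      by_contra hcon
      simp only [Set.mem_iUnion, Set.mem_ofPred_eq, not_exists] at hcon
      have hxA : x ∈ A := hAc.frontier_subset hx
      have hopen : IsOpen {x : EuclideanSpace ℝ κ | ∀ k, x k < b k} := by
        have : {x : EuclideanSpace ℝ κ | ∀ k, x k < b k} = ⋂ k, {x | x k < b k} := by ext; simp
        rw [this]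
        exact isOpen_iInter_of_finite fun k => isOpen_lt (by fun_prop) continuous_const
      exact hx.2 (interior_maximal (fun z hz k => (hz k).le) hopen
        fun k => lt_of_le_of_ne (hxA k) (hcon k))
    refine measure_mono_null hsub (measure_iUnion_null fun k => ?_)
    change (Q.map _) _ = 0
    rw [Measure.map_apply hηm]
    · exact hb k
    · exact measurableSet_eq_fun (by fun_prop) measurable_const
  have := ProbabilityMeasure.tendsto_measure_of_null_frontier_of_tendsto' hconv hfr
  convert this using 2
  · change _ = ((P _).map _) A
    rw [Measure.map_apply (hVm _) hAc.measurableSet]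
    rfl
  · change _ = (Q.map _) A
    rw [Measure.map_apply hηm hAc.measurableSet]
    rfl

end GaussianConvergence

/-! ### Conditioning on the value at one index -/

section FirstExceedance

variable {Ω T : Type*} [MeasurableSpace Ω] {P : Measure Ω}

lemma isGaussianProcess_add_mul {X : T → Ω → ℝ} (hX : IsGaussianProcess X P) {ι : Type*}
    (f : ι → T) (t : T) (a b : ι → ℝ) :
    IsGaussianProcess (fun i ω => a i * X (f i) ω + b i * X t ω) P := by
  classical
  refine hX.of_isGaussianProcess fun i => ⟨{f i, t},
    a i • ContinuousLinearMap.proj (R := ℝ) (φ := fun _ => ℝ) (⟨f i, by simp⟩ : ({f i, t} : Finset T)) +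
    b i • ContinuousLinearMap.proj (R := ℝ) (φ := fun _ => ℝ) (⟨t, by simp⟩ : ({f i, t} : Finset T)),
    fun ω => ?_⟩
  simp

/-- A Gaussian process is the sum of its regression on the value at `t` and an independent
residual. -/
lemma indepFun_residual {X : T → Ω → ℝ} (hX : IsGaussianProcess X P)
    (hm : ∀ s, ∫ ω, X s ω ∂P = 0) {t : T} (hv : Var[X t; P] = 1) :
    IndepFun (X t) (fun ω s => X s ω - (∫ ω, X s ω * X t ω ∂P) * X t ω) P := by
  have hP := hX.isProbabilityMeasure
  set r : T → ℝ := fun s => ∫ ω, X s ω * X t ω ∂P with hr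
  have hL : ∀ s, MemLp (X s) 2 P := fun s => (hX.hasGaussianLaw_eval s).memLp_two
  have hG : IsGaussianProcess (Sum.elim (fun _ : Unit => X t)
      fun s ω => X s ω - r s * X t ω) P := by
    refine (isGaussianProcess_add_mul hX (Sum.elim (fun _ : Unit => t) id) t
      (Sum.elim (fun _ => 1) fun _ => 1) (Sum.elim (fun _ => 0) fun s => - r s)).congr ?_
    rintro (_ | s)
    · exact .of_forall fun ω => by simp
    · exact .of_forall fun ω => by simp [sub_eq_add_neg]
  have hcov : ∀ s, cov[X s, X t; P] = r s := fun s => by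
    rw [covariance_eq_sub (hL s) (hL t), hm, hm]; simp [hr]
  have := hG.indepFun_of_covariance_eq_zero (fun _ => hX.aemeasurable t)
    (fun s => (hX.aemeasurable s).sub ((hX.aemeasurable t).const_mul _)) ?_
  · exact this.comp (φ := fun x : Unit → ℝ => x ()) (measurable_pi_apply _) measurable_id
  · intro _ s
    change cov[X t, X s - fun ω => r s * X t ω; P] = 0
    rw [covariance_sub_right (hL t) (hL s) ((hL t).const_mul _), covariance_const_mul_right,
      covariance_comm, hcov, covariance_self (hX.aemeasurable t), hv, mul_one, sub_self]

/-- Expand `(z + u²)² / (2 u²) = z² / (2 u²) + z + u² / 2`. The constant term yields the factor that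
is asymptotically `1 / n` for the normalizing sequence, the linear term yields the intensity
`e^{-z}`, and the quadratic term disappears in the limit. -/
lemma gaussianPDF_neg_sq {u : ℝ} (hu : 0 < u) (z : ℝ) :
    gaussianPDF (-u ^ 2) (u ^ 2).toNNReal z =
      ENNReal.ofReal (1 / (√(2 * Real.pi) * u * Real.exp (u ^ 2 / 2))) *
        (ENNReal.ofReal (Real.exp (-z)) * ENNReal.ofReal (Real.exp (-(z ^ 2 / (2 * u ^ 2))))) := by
  rw [gaussianPDF, gaussianPDFReal, ← ENNReal.ofReal_mul (Real.exp_pos _).le,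
    ← ENNReal.ofReal_mul (by positivity), Real.coe_toNNReal _ (sq_nonneg u),
    Real.sqrt_mul (by positivity), Real.sqrt_sq hu.le, ← Real.exp_add]
  congr 1
  rw [one_div, mul_inv (√(2 * Real.pi) * u), ← Real.exp_neg, mul_assoc (_)⁻¹, ← Real.exp_add]
  congr 2
  field_simp
  ring

lemma map_mul_sub_eq_gaussianReal {X : Ω → ℝ} (hX : HasGaussianLaw X P)
    (hm : ∫ ω, X ω ∂P = 0) (hv : Var[X; P] = 1) (u : ℝ) :
    P.map (fun ω => u * (X ω - u)) = gaussianReal (-u ^ 2) (u ^ 2).toNNReal := by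
  have h := hX.map_eq_gaussianReal
  rw [hm, hv] at h
  have h1 : P.map (fun ω => u * (X ω - u)) = ((P.map X).map (· - u)).map (u * ·) := by
    rw [Measure.map_map (by fun_prop) (by fun_prop),
      AEMeasurable.map_map_of_aemeasurable (by fun_prop) hX.aemeasurable]
    rfl
  rw [h1, h, gaussianReal_map_sub_const, gaussianReal_map_const_mul]
  congr 1
  · ring
  · ext; simp [Real.coe_toNNReal _ (sq_nonneg u)]

/-- Probability that the rescaled process exceeds its level at `t` and nowhere on `I`. -/
lemma measure_exceedance_at {X : T → Ω → ℝ} (hX : IsGaussianProcess X P)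
    (hXm : ∀ s, Measurable (X s)) (hm : ∀ s, ∫ ω, X s ω ∂P = 0) {t : T} (hv : Var[X t; P] = 1)
    {u : ℝ} (hu : 0 < u) (y : T → ℝ) (I : Finset T) :
    P {ω | y t < u * (X t ω - u) ∧ ∀ s ∈ I, u * (X s ω - u) ≤ y s} =
      ENNReal.ofReal (1 / (√(2 * Real.pi) * u * Real.exp (u ^ 2 / 2))) *
        ∫⁻ z in Set.Ioi (y t), ENNReal.ofReal (Real.exp (-z)) *
          ENNReal.ofReal (Real.exp (-(z ^ 2 / (2 * u ^ 2)))) *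
          P {ω | ∀ s ∈ I, (∫ ω, X s ω * X t ω ∂P) * z - u ^ 2 * (1 - ∫ ω, X s ω * X t ω ∂P) +
            u * (X s ω - (∫ ω, X s ω * X t ω ∂P) * X t ω) ≤ y s} := by
  have hP := hX.isProbabilityMeasure
  set r : T → ℝ := fun s => ∫ ω, X s ω * X t ω ∂P with hr
  set Z : Ω → T → ℝ := fun ω s => X s ω - r s * X t ω with hZ
  have hZm : Measurable Z := measurable_pi_lambda _ fun s => (hXm s).sub ((hXm t).const_mul _)
  set D : Ω → ℝ := fun ω => u * (X t ω - u) with hD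
  have hDm : Measurable D := ((hXm t).sub_const u).const_mul u
  have hDZ : IndepFun D Z P :=
    (indepFun_residual hX hm hv).comp (φ := fun x : ℝ => u * (x - u)) (by fun_prop) measurable_id
  have hDlaw : P.map D = gaussianReal (-u ^ 2) (u ^ 2).toNNReal :=
    map_mul_sub_eq_gaussianReal (hX.hasGaussianLaw_eval t) (hm t) hv u
  set B : Set (ℝ × (T → ℝ)) := {p | y t < p.1 ∧ ∀ s ∈ I,
    r s * p.1 - u ^ 2 * (1 - r s) + u * p.2 s ≤ y s} with hB
  have hBm : MeasurableSet B := by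
    have : B = {p | y t < p.1} ∩ ⋂ s ∈ I, {p | r s * p.1 - u ^ 2 * (1 - r s) + u * p.2 s ≤ y s} := by
      ext; simp [hB]
    rw [this]
    exact (measurableSet_lt measurable_const measurable_fst).inter
      (Finset.measurableSet_biInter _ fun s _ => measurableSet_le (by fun_prop) measurable_const)
  have hset : {ω | y t < u * (X t ω - u) ∧ ∀ s ∈ I, u * (X s ω - u) ≤ y s} =
      (fun ω => (D ω, Z ω)) ⁻¹' B := by
    ext ω
    simp only [hB, hD, hZ, Set.mem_ofPred_eq, Set.mem_preimage]
    refine and_congr Iff.rfl (forall₂_congr fun s _ => ?_)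
    -- The decomposition of `X s` into regression on `X t` and residual, in terms of the rescaled
    -- height `z = u (X t - u)`.
    rw [show r s * (u * (X t ω - u)) - u ^ 2 * (1 - r s) + u * (X s ω - r s * X t ω) =
      u * (X s ω - u) by ring]
  have hv2 : (u ^ 2).toNNReal ≠ 0 := by simpa using hu.ne'
  have hslice : Measurable fun z => P (Z ⁻¹' (Prod.mk z ⁻¹' B)) := by
    have h : Measurable fun z => (P.map Z) (Prod.mk z ⁻¹' B) := measurable_measure_prodMk_left hBm
    simpa only [Measure.map_apply hZm (measurable_prodMk_left hBm)] using h
  rw [hset, ← Measure.map_apply (hDm.prodMk hZm) hBm,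
    (indepFun_iff_map_prod_eq_prod_map_map hDm.aemeasurable hZm.aemeasurable).1 hDZ,
    Measure.prod_apply hBm, hDlaw, gaussianReal_of_var_ne_zero _ hv2]
  simp_rw [Measure.map_apply hZm (measurable_prodMk_left hBm)]
  rw [lintegral_withDensity_eq_lintegral_mul _ (measurable_gaussianPDF _ _) hslice,
    ← lintegral_const_mul' _ _ ENNReal.ofReal_ne_top, ← lintegral_indicator measurableSet_Ioi]
  congr with z
  by_cases hz : y t < z
  · rw [Set.indicator_of_mem (Set.mem_Ioi.2 hz), Pi.mul_apply, gaussianPDF_neg_sq hu, mul_assoc]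
    refine congrArg₂ _ rfl (congrArg₂ _ rfl (congrArg P ?_))
    ext ω
    simp [hB, hZ, hz, hr]
  · rw [Set.indicator_of_notMem (by simpa using hz), Pi.mul_apply]
    have : Z ⁻¹' (Prod.mk z ⁻¹' B) = ∅ := by
      ext ω; simp [hB, hz]
    rw [this, measure_empty, mul_zero]

end FirstExceedance

/-! ### Asymptotics of the conditioned process -/

section CriticalArray

variable {T : Type*} {Ω : ℕ → Type*} [∀ n, MeasurableSpace (Ω n)] {P : (n : ℕ) → Measure (Ω n)}

/-- The standing assumptions on the Gaussian processes and the normalizing sequence, in terms of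
`u n ^ 2` instead of `log n`. -/
structure IsCriticalArray (P : (n : ℕ) → Measure (Ω n)) (X : (n : ℕ) → T → Ω n → ℝ)
    (Γ : T → T → ℝ≥0∞) (u : ℕ → ℝ) : Prop where
  measurable : ∀ n s, Measurable (X n s)
  gaussian : ∀ n, IsGaussianProcess (X n) (P n)
  mean_zero : ∀ n s, ∫ ω, X n s ω ∂(P n) = 0
  variance_one : ∀ n s, Var[X n s; P n] = 1
  tendsto_atTop : Tendsto u atTop atTop
  tendsto_ratio : Tendsto (fun n : ℕ => (n : ℝ) *
    (1 / (√(2 * Real.pi) * u n * Real.exp (u n ^ 2 / 2)))) atTop (𝓝 1)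
  tendsto_finite : ∀ s t, Γ s t ≠ ∞ → Tendsto
    (fun n => u n ^ 2 * (1 - ∫ ω, X n s ω * X n t ω ∂(P n))) atTop (𝓝 ((Γ s t).toReal / 2))
  tendsto_infinite : ∀ s t, Γ s t = ∞ → Tendsto
    (fun n => u n ^ 2 * (1 - ∫ ω, X n s ω * X n t ω ∂(P n))) atTop atTop

namespace IsCriticalArray

variable {X : (n : ℕ) → T → Ω n → ℝ} {Γ : T → T → ℝ≥0∞} {u : ℕ → ℝ}

lemma memLp (hA : IsCriticalArray P X Γ u) (n : ℕ) (s : T) : MemLp (X n s) 2 (P n) :=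
  ((hA.gaussian n).hasGaussianLaw_eval s).memLp_two

lemma covariance_eq (hA : IsCriticalArray P X Γ u) (n : ℕ) (s t : T) :
    cov[X n s, X n t; P n] = ∫ ω, X n s ω * X n t ω ∂(P n) := by
  have := (hA.gaussian n).isProbabilityMeasure
  rw [covariance_eq_sub (hA.memLp n s) (hA.memLp n t), hA.mean_zero, hA.mean_zero]
  simp

lemma covariance_residual (hA : IsCriticalArray P X Γ u) (n : ℕ) (s s' t : T) :
    cov[fun ω => X n s ω - (∫ ω, X n s ω * X n t ω ∂(P n)) * X n t ω,
      fun ω => X n s' ω - (∫ ω, X n s' ω * X n t ω ∂(P n)) * X n t ω; P n] =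
      (∫ ω, X n s ω * X n s' ω ∂(P n)) -
        (∫ ω, X n s ω * X n t ω ∂(P n)) * ∫ ω, X n s' ω * X n t ω ∂(P n) := by
  have := (hA.gaussian n).isProbabilityMeasure
  have hL := hA.memLp n
  simp_rw [← hA.covariance_eq]
  set r := cov[X n s, X n t; P n]
  set r' := cov[X n s', X n t; P n]
  change cov[X n s - fun ω => r * X n t ω, X n s' - fun ω => r' * X n t ω; P n] = _
  rw [covariance_sub_left (hL s) ((hL t).const_mul r) ((hL s').sub ((hL t).const_mul r')),
    covariance_sub_right (hL s) (hL s') ((hL t).const_mul r'),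
    covariance_sub_right ((hL t).const_mul r) (hL s') ((hL t).const_mul r'),
    covariance_const_mul_left, covariance_const_mul_left, covariance_const_mul_right,
    covariance_const_mul_right, covariance_comm (X n t) (X n s'),
    covariance_self (hA.memLp n t).aestronglyMeasurable.aemeasurable, hA.variance_one]
  ring

/-- The residual of `X n s` after regression on `X n t` has variance `1 - r²`, which is nonnegative.
-/
lemma abs_correlation_le_one (hA : IsCriticalArray P X Γ u) (n : ℕ) (s t : T) :
    |∫ ω, X n s ω * X n t ω ∂(P n)| ≤ 1 := by
  have := (hA.gaussian n).isProbabilityMeasure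
  have h := hA.covariance_residual n s s t
  rw [covariance_self (by have := hA.measurable n; fun_prop), ← hA.covariance_eq n s s,
    covariance_self (hA.measurable n s).aemeasurable, hA.variance_one] at h
  have h0 := variance_nonneg (fun ω => X n s ω - (∫ ω, X n s ω * X n t ω ∂(P n)) * X n t ω) (P n)
  exact abs_le_one_iff_mul_self_le_one.2 (by linarith)

/-- `u² (1 - r)` converges to a finite limit while `u²` tends to infinity. -/
lemma tendsto_correlation (hA : IsCriticalArray P X Γ u) {s t : T} (h : Γ s t ≠ ∞) :
    Tendsto (fun n => ∫ ω, X n s ω * X n t ω ∂(P n)) atTop (𝓝 1) := by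
  have h2 : Tendsto (fun n => u n ^ 2) atTop atTop :=
    (tendsto_pow_atTop two_ne_zero).comp hA.tendsto_atTop
  have h3 := (hA.tendsto_finite s t h).mul (tendsto_inv_atTop_zero.comp h2)
  rw [mul_zero] at h3
  have h4 := h3.const_sub 1
  rw [sub_zero] at h4
  refine h4.congr' ?_
  filter_upwards [h2.eventually_gt_atTop 0] with n hn
  rw [Function.comp_apply, mul_comm (u n ^ 2), mul_assoc, mul_inv_cancel₀ hn.ne']
  ring

/-- The residual of `X n s` after regression on `X n t`, recentred and rescaled. -/
noncomputable def shifted (P : (n : ℕ) → Measure (Ω n)) (X : (n : ℕ) → T → Ω n → ℝ) (u : ℕ → ℝ)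
    (t : T) (z : ℝ) (n : ℕ) (s : T) (ω : Ω n) : ℝ :=
  (∫ ω, X n s ω * X n t ω ∂(P n)) * z - u n ^ 2 * (1 - ∫ ω, X n s ω * X n t ω ∂(P n)) +
    u n * (X n s ω - (∫ ω, X n s ω * X n t ω ∂(P n)) * X n t ω)

lemma measurable_shifted (hA : IsCriticalArray P X Γ u) (t : T) (z : ℝ) (n : ℕ) (s : T) :
    Measurable (shifted P X u t z n s) := by
  have := hA.measurable n
  unfold shifted
  fun_prop

lemma variance_linComb_residual (hA : IsCriticalArray P X Γ u) (n : ℕ) (t : T) {κ : Type*}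
    [Fintype κ] (f : κ → T) (θ : κ → ℝ) :
    Var[fun ω => ∑ k, θ k *
      (X n (f k) ω - (∫ ω, X n (f k) ω * X n t ω ∂(P n)) * X n t ω); P n] =
      ∑ k, ∑ l, θ k * θ l * ((∫ ω, X n (f k) ω * X n (f l) ω ∂(P n)) -
        (∫ ω, X n (f k) ω * X n t ω ∂(P n)) * ∫ ω, X n (f l) ω * X n t ω ∂(P n)) := by
  have := (hA.gaussian n).isProbabilityMeasure
  rw [variance_linComb (P := P n)
    (X := fun s ω => X n s ω - (∫ ω, X n s ω * X n t ω ∂(P n)) * X n t ω)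
    (fun s => (hA.memLp n s).sub ((hA.memLp n t).const_mul _)) f θ]
  simp_rw [hA.covariance_residual]

lemma map_linComb_shifted (hA : IsCriticalArray P X Γ u) (n : ℕ) (t : T) (z : ℝ) {κ : Type*}
    [Fintype κ] (f : κ → T) (θ : κ → ℝ) :
    (P n).map (fun ω => ∑ k, θ k * shifted P X u t z n (f k) ω) =
      gaussianReal (∑ k, θ k * ((∫ ω, X n (f k) ω * X n t ω ∂(P n)) * z -
          u n ^ 2 * (1 - ∫ ω, X n (f k) ω * X n t ω ∂(P n))))
        (∑ k, ∑ l, θ k * θ l * (u n ^ 2 * ((∫ ω, X n (f k) ω * X n (f l) ω ∂(P n)) -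
          (∫ ω, X n (f k) ω * X n t ω ∂(P n)) * ∫ ω, X n (f l) ω * X n t ω ∂(P n)))).toNNReal := by
  have := (hA.gaussian n).isProbabilityMeasure
  have hm := hA.measurable n
  set r : T → ℝ := fun s => ∫ ω, X n s ω * X n t ω ∂(P n) with hr
  set c : ℝ := ∑ k, θ k * (r (f k) * z - u n ^ 2 * (1 - r (f k))) with hc
  set Z : Ω n → ℝ := fun ω => ∑ k, θ k * (X n (f k) ω - r (f k) * X n t ω) with hZ
  have hZG : HasGaussianLaw (fun ω => u n * Z ω) (P n) := by
    have h1 := isGaussianProcess_add_mul (hA.gaussian n) f t (fun _ => 1) (fun k => - r (f k))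
    have h2 : (fun ω => u n * Z ω) =
        fun ω => ∑ k, u n * θ k * (1 * X n (f k) ω + -r (f k) * X n t ω) := by
      funext ω
      simp only [hZ, Finset.mul_sum]
      exact Finset.sum_congr rfl fun k _ => by ring
    rw [h2]
    exact (isGaussianProcess_linComb h1 id (fun (_ : Unit) k => u n * θ k)).hasGaussianLaw_eval ()
  have hmean : ∫ ω, u n * Z ω ∂(P n) = 0 := by
    rw [integral_const_mul, hZ, integral_finsetSum]
    · refine mul_eq_zero_of_right _ (Finset.sum_eq_zero fun k _ => ?_)
      rw [integral_const_mul, integral_sub ((hA.memLp n _).integrable one_le_two)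
        (((hA.memLp n _).integrable one_le_two).const_mul _), integral_const_mul, hA.mean_zero,
        hA.mean_zero]
      simp
    · exact fun k _ => (((hA.memLp n _).integrable one_le_two).sub
        (((hA.memLp n _).integrable one_le_two).const_mul _)).const_mul _
  have hlaw := hZG.map_eq_gaussianReal
  rw [hmean, variance_const_mul, hA.variance_linComb_residual n t f θ] at hlaw
  have hfun : (fun ω => ∑ k, θ k * shifted P X u t z n (f k) ω) =
      (c + ·) ∘ fun ω => u n * Z ω := by
    ext ω
    simp only [hc, hZ, Function.comp_apply, shifted, Finset.mul_sum, ← Finset.sum_add_distrib]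
    exact Finset.sum_congr rfl fun k _ => by simp only [hr]; ring
  rw [hfun, ← Measure.map_map (by fun_prop) (by fun_prop), hlaw, gaussianReal_map_const_add,
    zero_add]
  congr 2
  simp only [Finset.mul_sum]
  exact Finset.sum_congr rfl fun k _ => Finset.sum_congr rfl fun l _ => by ring

/-- Write `r`, `r'`, `r''` for the correlations of `(s, t)`, `(s', t)`, `(s, s')`. Then `r'' - r r'
= (1 - r) + (1 - r') r - (1 - r'')`, and every term converges after multiplication by `u²` because
`r → 1`. -/
lemma tendsto_covariance_residual (hA : IsCriticalArray P X Γ u) {s s' t : T} (hs : Γ s t ≠ ∞)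
    (hs' : Γ s' t ≠ ∞) (hss' : Γ s s' ≠ ∞) :
    Tendsto (fun n => u n ^ 2 * ((∫ ω, X n s ω * X n s' ω ∂(P n)) -
      (∫ ω, X n s ω * X n t ω ∂(P n)) * ∫ ω, X n s' ω * X n t ω ∂(P n))) atTop
      (𝓝 (((Γ s t).toReal + (Γ s' t).toReal - (Γ s s').toReal) / 2)) := by
  have h := ((hA.tendsto_finite s t hs).add ((hA.tendsto_finite s' t hs').mul
    (hA.tendsto_correlation hs))).sub (hA.tendsto_finite s s' hss')
  convert h using 2
  · ring
  · ring

/-- With `d = u² (1 - r) → ∞`, the mean is at most `|z| - d` and the variance is `u² (1 - r²) ≤ 2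
d`. Once `d ≥ 2 (|z| + |y|)`, exceeding `y` forces a deviation of at least `d / 2`, and Chebyshev
bounds its probability by `2 d / (d / 2)² = 8 / d`. -/
lemma tendsto_measure_shifted_gt (hA : IsCriticalArray P X Γ u) {s t : T} (h : Γ s t = ∞)
    (z y : ℝ) :
    Tendsto (fun n => P n {ω | y < shifted P X u t z n s ω}) atTop (𝓝 0) := by
  have hinf := hA.tendsto_infinite s t h
  set d : ℕ → ℝ := fun n => u n ^ 2 * (1 - ∫ ω, X n s ω * X n t ω ∂(P n)) with hd
  have hlim : Tendsto (fun n => ENNReal.ofReal (8 / d n)) atTop (𝓝 0) := by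
    rw [← ENNReal.ofReal_zero]
    exact (ENNReal.continuous_ofReal.tendsto 0).comp (hinf.const_div_atTop 8)
  refine tendsto_of_tendsto_of_tendsto_of_le_of_le' tendsto_const_nhds hlim
    (.of_forall fun n => zero_le) ?_
  filter_upwards [hinf.eventually_gt_atTop 0, hinf.eventually_ge_atTop (2 * (|z| + |y|))]
    with n hn0 hn
  have := (hA.gaussian n).isProbabilityMeasure
  set r := ∫ ω, X n s ω * X n t ω ∂(P n) with hr
  have hr1 : |r| ≤ 1 := hA.abs_correlation_le_one n s t
  set Z : Ω n → ℝ := fun ω => X n s ω - r * X n t ω with hZ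
  have hZL : MemLp (fun ω => u n * Z ω) 2 (P n) :=
    ((hA.memLp n s).sub ((hA.memLp n t).const_mul r)).const_mul _
  have hZ0 : ∫ ω, u n * Z ω ∂(P n) = 0 := by
    rw [integral_const_mul, hZ, integral_sub ((hA.memLp n s).integrable one_le_two)
      (((hA.memLp n t).integrable one_le_two).const_mul _), integral_const_mul, hA.mean_zero,
      hA.mean_zero]
    simp
  have hZv : Var[fun ω => u n * Z ω; P n] ≤ 2 * d n := by
    have h1 := hA.covariance_residual n s s t
    rw [covariance_self (by have := hA.measurable n; fun_prop), ← hA.covariance_eq n s s,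
      covariance_self (hA.measurable n s).aemeasurable, hA.variance_one] at h1
    rw [variance_const_mul, h1, hd]
    have : 0 ≤ u n ^ 2 * (1 - r) ^ 2 := by positivity
    simp only
    nlinarith
  calc P n {ω | y < shifted P X u t z n s ω}
      ≤ P n {ω | d n / 2 ≤ |u n * Z ω - ∫ ω, u n * Z ω ∂(P n)|} := by
        refine measure_mono fun ω hω => ?_
        simp only [Set.mem_ofPred_eq, shifted] at hω ⊢
        rw [hZ0, sub_zero]
        refine le_trans ?_ (le_abs_self _)
        have h1 : r * z ≤ |z| := by
          calc r * z ≤ |r * z| := le_abs_self _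
            _ = |r| * |z| := abs_mul _ _
            _ ≤ 1 * |z| := by gcongr
            _ = |z| := one_mul _
        have h2 := neg_abs_le y
        have h3 : y < r * z - d n + u n * Z ω := hω
        linarith
    _ ≤ ENNReal.ofReal (Var[fun ω => u n * Z ω; P n] / (d n / 2) ^ 2) :=
        meas_ge_le_variance_div_sq hZL (by positivity)
    _ ≤ ENNReal.ofReal (8 / d n) := by
        refine ENNReal.ofReal_le_ofReal ?_
        rw [div_le_div_iff₀ (by positivity) hn0]
        nlinarith

end IsCriticalArray

end CriticalArray

/-! ### Convergence of the expected number of exceeding copies -/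

section CriticalArray

variable {T : Type*} {Ω : ℕ → Type*} [∀ n, MeasurableSpace (Ω n)] {P : (n : ℕ) → Measure (Ω n)}

namespace IsCriticalArray

variable {X : (n : ℕ) → T → Ω n → ℝ} {Γ : T → T → ℝ≥0∞} {u : ℕ → ℝ}

variable {Ω' : Type*} [MeasurableSpace Ω'] {Q : Measure Ω'} [IsProbabilityMeasure Q]

/-- Within the class of `t`, the conditional means `r z - u² (1 - r)` tend to `z - Γ / 2` and the
covariances converge to those of `η`. -/
lemma tendsto_measure_shifted_le_of_finite (hA : IsCriticalArray P X Γ u) {t : T}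
    {η : T → Ω' → ℝ} (hη : IsTiltedIncrement Γ t η Q) (y : T → ℝ) (J : Finset T)
    (hJ : ∀ s ∈ J, Γ s t ≠ ∞) (hJJ : ∀ s ∈ J, ∀ s' ∈ J, Γ s s' ≠ ∞) {z : ℝ}
    (hz : ∀ s ∈ J, Q {ω | η s ω = y s - z} = 0) :
    Tendsto (fun n => P n {ω | ∀ s ∈ J, shifted P X u t z n s ω ≤ y s}) atTop
      (𝓝 (Q {ω | ∀ s ∈ J, z + η s ω ≤ y s})) := by
  have hP := fun n => (hA.gaussian n).isProbabilityMeasure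
  have hlaw : ∀ θ : J → ℝ, Q.map (fun ω => ∑ s, θ s * (z + η s ω)) =
      gaussianReal (∑ s, θ s * (z - (Γ s t).toReal / 2)) (∑ s, ∑ s', θ s * θ s' *
        (((Γ s t).toReal + (Γ s' t).toReal - (Γ s s').toReal) / 2)).toNNReal := by
    intro θ
    have hm : Measurable fun ω => ∑ s : J, θ s * η s ω :=
      Finset.measurable_sum _ fun s _ => (hη.measurable s).const_mul _
    have hfun : (fun ω => ∑ s : J, θ s * (z + η s ω)) =
        (∑ s, θ s * z + ·) ∘ fun ω => ∑ s : J, θ s * η s ω := by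
      funext ω
      simp only [Function.comp_apply, ← Finset.sum_add_distrib, mul_add]
    rw [hfun, ← Measure.map_map (by fun_prop) hm, hη.map_linComb J θ hJ, gaussianReal_map_const_add]
    congr 1
    rw [neg_add_eq_sub, ← Finset.sum_sub_distrib]
    exact Finset.sum_congr rfl fun s _ => by ring
  have h := tendsto_measure_forall_le_of_gaussian (Q := Q)
    (V := fun n (s : J) => shifted P X u t z n s) (η := fun (s : J) ω => z + η s ω)
    (fun n s => hA.measurable_shifted t z n s) (fun s => (hη.measurable s).const_add z)
    (fun n θ => hA.map_linComb_shifted n t z (fun s : J => (s : T)) θ) hlaw ?_ ?_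
    (fun s => y s) ?_
  · simpa only [Subtype.forall] using h
  · intro θ
    refine tendsto_finsetSum _ fun s _ => Tendsto.const_mul _ ?_
    have := ((hA.tendsto_correlation (hJ s s.2)).mul_const z).sub (hA.tendsto_finite s t (hJ s s.2))
    rwa [one_mul] at this
  · intro θ
    refine (continuous_real_toNNReal.tendsto _).comp
      (tendsto_finsetSum _ fun s _ => tendsto_finsetSum _ fun s' _ => Tendsto.const_mul _ ?_)
    exact hA.tendsto_covariance_residual (hJ s s.2) (hJ s' s'.2) (hJJ s s.2 s' s'.2)
  · intro s
    rw [← hz s s.2]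
    congr 1
    ext ω
    simp only [Set.mem_ofPred_eq]
    constructor <;> intro h <;> linarith

/-- By a union bound, indices at infinite distance from `t` impose no constraint in the limit: there
the path falls below every level. -/
lemma tendsto_measure_shifted_le (hA : IsCriticalArray P X Γ u)
    (htrans : ∀ s s' t, Γ s t ≠ ∞ → Γ s' t ≠ ∞ → Γ s s' ≠ ∞) {t : T}
    {η : T → Ω' → ℝ} (hη : IsTiltedIncrement Γ t η Q) (y : T → ℝ) (I : Finset T) {z : ℝ}
    (hz : ∀ s ∈ I, Q {ω | η s ω = y s - z} = 0) :
    Tendsto (fun n => P n {ω | ∀ s ∈ I, shifted P X u t z n s ω ≤ y s}) atTop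
      (𝓝 (Q {ω | ∀ s ∈ I, Γ s t ≠ ∞ → z + η s ω ≤ y s})) := by
  classical
  set J := I.filter fun s => Γ s t ≠ ∞ with hJ
  set K := I.filter fun s => Γ s t = ∞ with hK
  have hJt : ∀ s ∈ J, Γ s t ≠ ∞ := fun s hs => (Finset.mem_filter.1 hs).2
  have h1 := hA.tendsto_measure_shifted_le_of_finite hη y J hJt
    (fun s hs s' hs' => htrans s s' t (hJt s hs) (hJt s' hs'))
    (fun s hs => hz s (Finset.mem_filter.1 hs).1)
  have hset : {ω | ∀ s ∈ J, z + η s ω ≤ y s} = {ω | ∀ s ∈ I, Γ s t ≠ ∞ → z + η s ω ≤ y s} := by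
    ext ω
    simp [hJ]
  rw [hset] at h1
  have h2 : Tendsto (fun n => ∑ s ∈ K, P n {ω | y s < shifted P X u t z n s ω}) atTop (𝓝 0) := by
    rw [← Finset.sum_const_zero (s := K)]
    exact tendsto_finsetSum _ fun s hs =>
      hA.tendsto_measure_shifted_gt (Finset.mem_filter.1 hs).2 z (y s)
  have h3 := ENNReal.Tendsto.sub h1 h2 (Or.inr ENNReal.zero_ne_top)
  rw [tsub_zero] at h3
  refine tendsto_of_tendsto_of_tendsto_of_le_of_le h3 h1 (fun n => ?_) (fun n => ?_)
  · refine tsub_le_iff_right.2 ?_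
    have hsub : {ω | ∀ s ∈ J, shifted P X u t z n s ω ≤ y s} ⊆
        {ω | ∀ s ∈ I, shifted P X u t z n s ω ≤ y s} ∪
          ⋃ s ∈ K, {ω | y s < shifted P X u t z n s ω} := by
      intro ω hω
      by_cases hcase : ∀ s ∈ K, shifted P X u t z n s ω ≤ y s
      · refine Or.inl fun s hs => ?_
        by_cases hst : Γ s t = ∞
        · exact hcase s (Finset.mem_filter.2 ⟨hs, hst⟩)
        · exact hω s (Finset.mem_filter.2 ⟨hs, hst⟩)
      · push Not at hcase
        obtain ⟨s, hs, hs'⟩ := hcase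
        exact Or.inr (Set.mem_biUnion hs hs')
    exact (measure_mono hsub).trans ((measure_union_le _ _).trans
      (add_le_add le_rfl (measure_biUnion_finset_le _ _)))
  · exact measure_mono fun ω hω s hs => hω s (Finset.mem_filter.1 hs).1

lemma measurable_measure_shifted_le (hA : IsCriticalArray P X Γ u) (n : ℕ) (t : T) (y : T → ℝ)
    (I : Finset T) :
    Measurable fun z => P n {ω | ∀ s ∈ I, shifted P X u t z n s ω ≤ y s} := by
  have hP := (hA.gaussian n).isProbabilityMeasure
  have hX := hA.measurable n
  have hm : MeasurableSet {p : ℝ × Ω n | ∀ s ∈ I, shifted P X u t p.1 n s p.2 ≤ y s} := by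
    have : {p : ℝ × Ω n | ∀ s ∈ I, shifted P X u t p.1 n s p.2 ≤ y s} =
        ⋂ s ∈ I, {p : ℝ × Ω n | shifted P X u t p.1 n s p.2 ≤ y s} := by ext; simp
    rw [this]
    refine Finset.measurableSet_biInter _ fun s _ => measurableSet_le ?_ measurable_const
    unfold shifted
    fun_prop
  exact measurable_measure_prodMk_left (ν := P n) hm

/-- The expected number of copies exceeding the level at `t` but nowhere on `I`. -/
lemma tendsto_mul_measure_exceedance_at (hA : IsCriticalArray P X Γ u)
    (htrans : ∀ s s' t, Γ s t ≠ ∞ → Γ s' t ≠ ∞ → Γ s s' ≠ ∞) {t : T}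
    {η : T → Ω' → ℝ} (hη : IsTiltedIncrement Γ t η Q) (y : T → ℝ) (I : Finset T) :
    Tendsto (fun n : ℕ => (n : ℝ≥0∞) *
      P n {ω | y t < u n * (X n t ω - u n) ∧ ∀ s ∈ I, u n * (X n s ω - u n) ≤ y s}) atTop
      (𝓝 (∫⁻ z in Set.Ioi (y t), ENNReal.ofReal (Real.exp (-z)) *
        Q {ω | ∀ s ∈ I, Γ s t ≠ ∞ → z + η s ω ≤ y s})) := by
  have hP := fun n => (hA.gaussian n).isProbabilityMeasure
  have hc : Tendsto (fun n : ℕ => ENNReal.ofReal ((n : ℝ) *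
      (1 / (√(2 * Real.pi) * u n * Real.exp (u n ^ 2 / 2))))) atTop (𝓝 1) := by
    rw [← ENNReal.ofReal_one]
    exact (ENNReal.continuous_ofReal.tendsto _).comp hA.tendsto_ratio
  have hu2 : Tendsto (fun n => 2 * u n ^ 2) atTop atTop :=
    ((tendsto_pow_atTop two_ne_zero).comp hA.tendsto_atTop).const_mul_atTop two_pos
  have hint : Tendsto (fun n => ∫⁻ z in Set.Ioi (y t), ENNReal.ofReal (Real.exp (-z)) *
      ENNReal.ofReal (Real.exp (-(z ^ 2 / (2 * u n ^ 2)))) *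
      P n {ω | ∀ s ∈ I, shifted P X u t z n s ω ≤ y s}) atTop
      (𝓝 (∫⁻ z in Set.Ioi (y t), ENNReal.ofReal (Real.exp (-z)) *
        Q {ω | ∀ s ∈ I, Γ s t ≠ ∞ → z + η s ω ≤ y s})) := by
    -- The dominating function `e^{-z}` is integrable because `z` is restricted to `(y t, ∞)`, the
    -- heights exceeding the level at `t`.
    refine tendsto_lintegral_of_dominated_convergence
      (fun z => ENNReal.ofReal (Real.exp (-z))) (fun n => ?_) (fun n => .of_forall fun z => ?_) ?_ ?_
    · have h1 : Measurable fun z : ℝ => ENNReal.ofReal (Real.exp (-z)) *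
          ENNReal.ofReal (Real.exp (-(z ^ 2 / (2 * u n ^ 2)))) := by fun_prop
      exact h1.mul (hA.measurable_measure_shifted_le n t y I)
    · refine (mul_le_mul' (mul_le_mul' (le_refl (ENNReal.ofReal (Real.exp (-z))))
        (ENNReal.ofReal_le_one.2 (Real.exp_le_one_iff.2 (neg_nonpos.2 ?_)))) prob_le_one).trans_eq
        (by simp)
      positivity
    · rw [lintegral_Ioi_exp_neg]
      exact ENNReal.ofReal_ne_top
    · refine ae_restrict_of_ae ?_
      -- Each `η s` has at most countably many atoms, so convergence on the orthant can fail only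
      -- for countably many `z`, a Lebesgue null set.
      have hN : (⋃ s ∈ I, (fun w => y s - w) '' {w | 0 < Q {ω | η s ω = w}}).Countable :=
        I.countable_toSet.biUnion fun s _ =>
          (Measure.countable_meas_level_set_pos (hη.measurable s)).image _
      filter_upwards [hN.ae_notMem volume] with z hz
      have hz' : ∀ s ∈ I, Q {ω | η s ω = y s - z} = 0 := by
        intro s hs
        by_contra hcon
        refine hz (Set.mem_biUnion (x := s) hs ⟨y s - z, pos_iff_ne_zero.2 hcon, ?_⟩)
        simp
      have h1 : Tendsto (fun n => ENNReal.ofReal (Real.exp (-(z ^ 2 / (2 * u n ^ 2))))) atTop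
          (𝓝 1) := by
        rw [← ENNReal.ofReal_one, ← Real.exp_zero, ← neg_zero]
        exact (ENNReal.continuous_ofReal.tendsto _).comp ((Real.continuous_exp.tendsto _).comp
          (hu2.const_div_atTop (z ^ 2)).neg)
      have h2 := hA.tendsto_measure_shifted_le htrans hη y I hz'
      have h3 := ENNReal.Tendsto.mul (ENNReal.Tendsto.const_mul h1
        (Or.inr (ENNReal.ofReal_ne_top (r := Real.exp (-z))))) (Or.inr (measure_ne_top Q _)) h2
        (Or.inr (by simp))
      rwa [mul_one] at h3
  have hprod := ENNReal.Tendsto.mul hc (Or.inl one_ne_zero) hint (Or.inr ENNReal.one_ne_top)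
  rw [one_mul] at hprod
  refine hprod.congr' ?_
  filter_upwards [hA.tendsto_atTop.eventually_gt_atTop 0] with n hn
  rw [measure_exceedance_at (hA.gaussian n) (hA.measurable n) (hA.mean_zero n)
    (hA.variance_one n t) hn y I, ← mul_assoc, ENNReal.ofReal_mul (Nat.cast_nonneg n),
    ENNReal.ofReal_natCast]
  rfl

/-- The expected number of copies exceeding the level somewhere on `I`. -/
lemma tendsto_mul_measure_exists_exceedance (hA : IsCriticalArray P X Γ u)
    (htrans : ∀ s s' t, Γ s t ≠ ∞ → Γ s' t ≠ ∞ → Γ s s' ≠ ∞) (y : T → ℝ)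
    {Λ : Finset T → ℝ≥0∞} (hΛ0 : Λ ∅ = 0)
    (hΛ : ∀ t, ∃ (η : T → Ω' → ℝ) (Q : Measure Ω'), IsProbabilityMeasure Q ∧
        IsTiltedIncrement Γ t η Q ∧
        ∀ (I : Finset T) (I' : Finset T), t ∉ I → (∀ s, s ∈ I' ↔ s = t ∨ s ∈ I) →
          Λ I' = Λ I + ∫⁻ z in Set.Ioi (y t), ENNReal.ofReal (Real.exp (-z)) *
          Q {ω | ∀ s ∈ I, Γ s t ≠ ∞ → z + η s ω ≤ y s}) (I : Finset T) :
    Tendsto (fun n : ℕ => (n : ℝ≥0∞) * P n {ω | ∃ s ∈ I, y s < u n * (X n s ω - u n)}) atTop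
      (𝓝 (Λ I)) := by
  classical
  induction I using Finset.induction_on with
  | empty => simp [hΛ0]
  | insert t I ht ih =>
    obtain ⟨η, Q, hQ, hη, hrec⟩ := hΛ t
    rw [hrec I (insert t I) ht fun s => Finset.mem_insert]
    refine (ih.add (hA.tendsto_mul_measure_exceedance_at htrans hη y I)).congr fun n => ?_
    have hX := hA.measurable n
    rw [← mul_add, ← measure_union]
    · congr 2
      ext ω
      simp only [Set.mem_union, Set.mem_ofPred_eq, Finset.mem_insert, exists_eq_or_imp]
      by_cases h : ∃ s ∈ I, y s < u n * (X n s ω - u n)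
      · simp [h]
      · have h' := h
        push Not at h'
        simp only [h, false_or, or_false, and_iff_left_iff_imp]
        exact fun _ => h'
    · rw [Set.disjoint_left]
      rintro ω ⟨s, hs, h⟩ ⟨_, h'⟩
      exact (h' s hs).not_gt h
    · have : {ω | y t < u n * (X n t ω - u n) ∧ ∀ s ∈ I, u n * (X n s ω - u n) ≤ y s} =
          {ω | y t < u n * (X n t ω - u n)} ∩ ⋂ s ∈ I, {ω | u n * (X n s ω - u n) ≤ y s} := by
        ext; simp
      rw [this]
      exact (measurableSet_lt measurable_const (by fun_prop)).inter
        (Finset.measurableSet_biInter _ fun s _ => measurableSet_le (by fun_prop) measurable_const)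

end IsCriticalArray

end CriticalArray

/-! ### Asymptotics of the normalizing sequence -/

section NormalizingSequence

variable {u : ℕ → ℝ}

/-- The function `x e^{x² / 2}` is nonpositive for `x ≤ 0` and increasing for `x ≥ 0`, hence bounded
above on `x ≤ C`. Positivity of `u n` is not presupposed. -/
lemma tendsto_atTop_of_isEquivalent
    (hu : (fun n => √(2 * Real.pi) * u n * Real.exp (u n ^ 2 / 2)) ~[atTop]
      (fun n : ℕ => (n : ℝ))) : Tendsto u atTop atTop := by
  have hf := hu.symm.tendsto_atTop tendsto_natCast_atTop_atTop
  refine tendsto_atTop.2 fun C => ?_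
  filter_upwards [hf.eventually_gt_atTop
    (√(2 * Real.pi) * max C 0 * Real.exp (max C 0 ^ 2 / 2))] with n hn
  by_contra! hlt
  refine hn.not_ge ?_
  rcases le_total (u n) 0 with h0 | h0
  · calc √(2 * Real.pi) * u n * Real.exp (u n ^ 2 / 2) ≤ 0 :=
        mul_nonpos_of_nonpos_of_nonneg (mul_nonpos_of_nonneg_of_nonpos (by positivity) h0)
          (Real.exp_pos _).le
      _ ≤ _ := by positivity
  · have h1 : u n ≤ max C 0 := hlt.le.trans (le_max_left _ _)
    gcongr

lemma tendsto_ratio_of_isEquivalent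
    (hu : (fun n => √(2 * Real.pi) * u n * Real.exp (u n ^ 2 / 2)) ~[atTop]
      (fun n : ℕ => (n : ℝ))) :
    Tendsto (fun n : ℕ => (n : ℝ) *
      (1 / (√(2 * Real.pi) * u n * Real.exp (u n ^ 2 / 2)))) atTop (𝓝 1) := by
  have hu0 := (tendsto_atTop_of_isEquivalent hu).eventually_gt_atTop 0
  have h := (Asymptotics.isEquivalent_iff_tendsto_one
    (hu0.mono fun n hn => by positivity)).1 hu.symm
  refine h.congr fun n => ?_
  rw [Pi.div_apply, mul_one_div]

/-- Taking logarithms, `log n = u² / 2 + log u + log √(2π) + o(1)`, and `log u` is negligible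
against `u²`. -/
lemma tendsto_log_div_sq_of_isEquivalent
    (hu : (fun n => √(2 * Real.pi) * u n * Real.exp (u n ^ 2 / 2)) ~[atTop]
      (fun n : ℕ => (n : ℝ))) :
    Tendsto (fun n : ℕ => Real.log n / u n ^ 2) atTop (𝓝 (1 / 2)) := by
  have hut := tendsto_atTop_of_isEquivalent hu
  have hu2 : Tendsto (fun n => u n ^ 2) atTop atTop :=
    (tendsto_pow_atTop two_ne_zero).comp hut
  have h1 := (tendsto_ratio_of_isEquivalent hu).log one_ne_zero
  rw [Real.log_one] at h1
  have h2 : Tendsto (fun n => Real.log (u n) / u n * (u n)⁻¹) atTop (𝓝 (0 * 0)) :=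
    (Real.isLittleO_log_id_atTop.tendsto_div_nhds_zero.comp hut).mul
      (tendsto_inv_atTop_zero.comp hut)
  have h3 := (((h1.add_const (Real.log √(2 * Real.pi))).div_atTop hu2).add h2).add_const (1 / 2 : ℝ)
  rw [mul_zero, add_zero, zero_add] at h3
  refine h3.congr' ?_
  filter_upwards [hut.eventually_gt_atTop 0, eventually_gt_atTop 0] with n hn hn0
  have hn0' : (0 : ℝ) < n := Nat.cast_pos.2 hn0
  have hpi : (0 : ℝ) < √(2 * Real.pi) := by positivity
  rw [mul_one_div, Real.log_div hn0'.ne' (by positivity), Real.log_mul (by positivity)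
    (Real.exp_ne_zero _), Real.log_mul hpi.ne' hn.ne', Real.log_exp]
  field_simp
  ring

/-- This ratio converts the limit of `4 log n (1 - r)` into that of `u² (1 - r)`; it is the source
of the factor in `Γ / 2`. -/
lemma tendsto_sq_div_log_of_isEquivalent
    (hu : (fun n => √(2 * Real.pi) * u n * Real.exp (u n ^ 2 / 2)) ~[atTop]
      (fun n : ℕ => (n : ℝ))) :
    Tendsto (fun n : ℕ => u n ^ 2 / (4 * Real.log n)) atTop (𝓝 (1 / 2)) := by
  have h := ((tendsto_log_div_sq_of_isEquivalent hu).const_mul 4).inv₀ (by norm_num)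
  convert h using 2
  · rw [← mul_div_assoc, inv_div]
  · norm_num

end NormalizingSequence

/-! ### Negative definiteness of the limit kernel -/

section CriticalArray

variable {T : Type*} {Ω : ℕ → Type*} [∀ n, MeasurableSpace (Ω n)] {P : (n : ℕ) → Measure (Ω n)}
  {X : (n : ℕ) → T → Ω n → ℝ} {Γ : T → T → ℝ≥0∞} {u : ℕ → ℝ}

lemma IsCriticalArray.of_tendsto_log (hXm : ∀ n s, Measurable (X n s))
    (hX_gauss : ∀ n, IsGaussianProcess (X n) (P n)) (hX_mean : ∀ n t, ∫ ω, X n t ω ∂(P n) = 0)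
    (hX_var : ∀ n t, Var[X n t; P n] = 1)
    (hΓ : ∀ t₁ t₂, Tendsto
      (fun n : ℕ => ((4 * Real.log n * (1 - ∫ ω, X n t₁ ω * X n t₂ ω ∂(P n)) : ℝ) : EReal))
      atTop (𝓝 (Γ t₁ t₂ : EReal)))
    (hu : (fun n => √(2 * Real.pi) * u n * Real.exp (u n ^ 2 / 2)) ~[atTop]
      (fun n : ℕ => (n : ℝ))) : IsCriticalArray P X Γ u where
  measurable := hXm
  gaussian := hX_gauss
  mean_zero := hX_mean
  variance_one := hX_var
  tendsto_atTop := tendsto_atTop_of_isEquivalent hu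
  tendsto_ratio := tendsto_ratio_of_isEquivalent hu
  tendsto_finite s t h := by
    have h1 := hΓ s t
    rw [← EReal.coe_ennreal_toReal h, EReal.tendsto_coe] at h1
    have h2 := (tendsto_sq_div_log_of_isEquivalent hu).mul h1
    rw [one_div_mul_eq_div] at h2
    refine h2.congr' ?_
    filter_upwards [eventually_gt_atTop 1] with n hn
    have : Real.log n ≠ 0 := (Real.log_pos (by exact_mod_cast hn)).ne'
    field_simp
  tendsto_infinite s t h := by
    have h1 := hΓ s t
    rw [h, EReal.coe_ennreal_top, EReal.tendsto_coe_nhds_top_iff] at h1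
    refine (Tendsto.pos_mul_atTop one_half_pos
      (tendsto_sq_div_log_of_isEquivalent hu) h1).congr' ?_
    filter_upwards [eventually_gt_atTop 1] with n hn
    have : Real.log n ≠ 0 := (Real.log_pos (by exact_mod_cast hn)).ne'
    field_simp

namespace IsCriticalArray

/-- The correlation functions are positive semidefinite. -/
lemma sum_correlation_nonneg (hA : IsCriticalArray P X Γ u) (n : ℕ) {κ : Type*} [Fintype κ]
    (f : κ → T) (a : κ → ℝ) :
    0 ≤ ∑ k, ∑ l, a k * a l * ∫ ω, X n (f k) ω * X n (f l) ω ∂(P n) := by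
  have := (hA.gaussian n).isProbabilityMeasure
  have h := variance_linComb (hA.memLp n) f a
  simp_rw [hA.covariance_eq] at h
  rw [← h]
  exact variance_nonneg _ _

lemma integral_mul_self (hA : IsCriticalArray P X Γ u) (n : ℕ) (t : T) :
    ∫ ω, X n t ω * X n t ω ∂(P n) = 1 := by
  rw [← hA.covariance_eq, covariance_self (hA.measurable n t).aemeasurable, hA.variance_one]

lemma integral_mul_comm (P : (n : ℕ) → Measure (Ω n)) (X : (n : ℕ) → T → Ω n → ℝ) (n : ℕ)
    (s t : T) :
    ∫ ω, X n s ω * X n t ω ∂(P n) = ∫ ω, X n t ω * X n s ω ∂(P n) := by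
  simp_rw [mul_comm]

lemma ne_top_self (hA : IsCriticalArray P X Γ u) (t : T) : Γ t t ≠ ∞ := by
  intro h
  have := hA.tendsto_infinite t t h
  simp only [hA.integral_mul_self, sub_self, mul_zero] at this
  exact not_tendsto_const_atTop _ _ this

lemma ne_top_symm (hA : IsCriticalArray P X Γ u) {s t : T} (h : Γ s t ≠ ∞) : Γ t s ≠ ∞ := by
  intro h'
  have h1 := hA.tendsto_infinite t s h'
  simp_rw [fun n => integral_mul_comm P X n t s] at h1
  exact not_tendsto_nhds_of_tendsto_atTop h1 _ (hA.tendsto_finite s t h)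

/-- Nonnegativity of the variance of `X s - 2 X t + X w` reads `1 - r(s,w) ≤ 2 (1 - r(s,t)) + 2 (1 -
r(t,w))`. -/
lemma ne_top_trans (hA : IsCriticalArray P X Γ u) {s t w : T} (hst : Γ s t ≠ ∞)
    (htw : Γ t w ≠ ∞) : Γ s w ≠ ∞ := by
  intro h'
  have h1 := hA.tendsto_infinite s w h'
  have h2 := ((hA.tendsto_finite s t hst).const_mul 2).add ((hA.tendsto_finite t w htw).const_mul 2)
  refine not_tendsto_nhds_of_tendsto_atTop (tendsto_atTop_mono (fun n => ?_) h1) _ h2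
  have h3 := hA.sum_correlation_nonneg n ![s, t, w] ![1, -2, 1]
  simp only [Fin.sum_univ_three, Matrix.cons_val_zero, Matrix.cons_val_one, Matrix.cons_val,
    hA.integral_mul_self] at h3
  rw [integral_mul_comm P X n t s, integral_mul_comm P X n w s, integral_mul_comm P X n w t] at h3
  nlinarith [sq_nonneg (u n)]

lemma toReal_self (hA : IsCriticalArray P X Γ u) (t : T) : (Γ t t).toReal = 0 := by
  have := hA.tendsto_finite t t (hA.ne_top_self t)
  simp only [hA.integral_mul_self, sub_self, mul_zero] at this
  have := tendsto_nhds_unique this tendsto_const_nhds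
  linarith

lemma toReal_symm (hA : IsCriticalArray P X Γ u) (s t : T) : (Γ s t).toReal = (Γ t s).toReal := by
  by_cases h : Γ s t = ∞
  · have h' : Γ t s = ∞ := by
      by_contra hcon
      exact hA.ne_top_symm hcon h
    rw [h, h']
  · have h1 := hA.tendsto_finite s t h
    have h2 := hA.tendsto_finite t s (hA.ne_top_symm h)
    simp_rw [fun n => integral_mul_comm P X n t s] at h2
    have := tendsto_nhds_unique h1 h2
    linarith

/-- Points at finite distance with respect to the limit kernel. -/
def setoid (hA : IsCriticalArray P X Γ u) : Setoid T where
  r s t := Γ s t ≠ ∞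
  iseqv := ⟨hA.ne_top_self, hA.ne_top_symm, hA.ne_top_trans⟩

/-- For weights of sum zero the constant in `1 - r` drops out, so `∑ a_i a_j (1 - r) = -∑ a_i a_j r
≤ 0`; the sign survives multiplication by `2 u²` and the limit. -/
lemma isExtNegDef (hA : IsCriticalArray P X Γ u) : IsExtNegDef Γ hA.setoid where
  ne_top_iff s t := (Quotient.eq (r := hA.setoid)).symm
  negDef q :=
    { nonneg := fun _ _ => ENNReal.toReal_nonneg
      diag := fun t => hA.toReal_self t
      symm := fun s t => hA.toReal_symm s t
      sum_nonpos := by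
        intro m t a ha
        have hfin : ∀ i j, Γ (t i) (t j) ≠ ∞ := fun i j =>
          (Quotient.eq (r := hA.setoid)).1 ((t i).2.trans (t j).2.symm)
        have hlim : Tendsto (fun n => ∑ i, ∑ j, a i * a j *
            (2 * (u n ^ 2 * (1 - ∫ ω, X n (t i) ω * X n (t j) ω ∂(P n))))) atTop
            (𝓝 (∑ i, ∑ j, a i * a j * (2 * ((Γ (t i) (t j)).toReal / 2)))) :=
          tendsto_finsetSum _ fun i _ => tendsto_finsetSum _ fun j _ =>
            ((hA.tendsto_finite _ _ (hfin i j)).const_mul 2).const_mul _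
        simp_rw [mul_div_cancel₀ _ (two_ne_zero' ℝ)] at hlim
        refine le_of_tendsto' hlim fun n => ?_
        have h0 := hA.sum_correlation_nonneg n (fun i => (t i : T)) a
        have h1 : ∑ i, ∑ j, a i * a j *
            (2 * (u n ^ 2 * (1 - ∫ ω, X n (t i) ω * X n (t j) ω ∂(P n)))) =
            2 * u n ^ 2 * ((∑ i, a i) * ∑ j, a j) - 2 * u n ^ 2 *
              ∑ i, ∑ j, a i * a j * ∫ ω, X n (t i) ω * X n (t j) ω ∂(P n) := by
          rw [Finset.sum_mul_sum, ← mul_sub, ← Finset.sum_sub_distrib, Finset.mul_sum]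
          refine Finset.sum_congr rfl fun i _ => ?_
          rw [← Finset.sum_sub_distrib, Finset.mul_sum]
          exact Finset.sum_congr rfl fun j _ => by ring
        rw [h1, ha]
        have : 0 ≤ 2 * u n ^ 2 *
              ∑ i, ∑ j, a i * a j * ∫ ω, X n (t i) ω * X n (t j) ω ∂(P n) := by positivity
        linarith }

end IsCriticalArray

end CriticalArray

/-! ### Convergence of the rescaled maxima -/

section Maxima

lemma tendsto_one_sub_pow_of_tendsto_mul {p : ℕ → ℝ≥0∞} (hp : ∀ n, p n ≤ 1) {c : ℝ≥0∞} (hc : c ≠ ∞)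
    (h : Tendsto (fun n : ℕ => (n : ℝ≥0∞) * p n) atTop (𝓝 c)) :
    Tendsto (fun n => (1 - p n) ^ n) atTop (𝓝 (ENNReal.ofReal (Real.exp (-c.toReal)))) := by
  have h1 := ((ENNReal.tendsto_toReal hc).comp h).neg
  have h2 : Tendsto (fun n : ℕ => (1 + -(p n).toReal) ^ n) atTop (𝓝 (Real.exp (-c.toReal))) := by
    refine Real.tendsto_one_add_pow_exp_of_tendsto (h1.congr fun n => ?_)
    simp
  refine ((ENNReal.continuous_ofReal.tendsto _).comp h2).congr fun n => ?_
  have hpt : p n ≠ ∞ := ne_top_of_le_ne_top ENNReal.one_ne_top (hp n)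
  have hp1 : (p n).toReal ≤ 1 := ENNReal.toReal_le_of_le_ofReal zero_le_one (by simpa using hp n)
  rw [Function.comp_apply, ENNReal.ofReal_pow (by linarith), ← sub_eq_add_neg,
    ENNReal.ofReal_sub _ ENNReal.toReal_nonneg, ENNReal.ofReal_one, ENNReal.ofReal_toReal hpt]

/-- Distribution function of the rescaled maximum of independent copies. -/
lemma measure_iSup_le_eq_pow {T Ω₀ Ω : Type*} [MeasurableSpace Ω₀] [MeasurableSpace Ω]
    {P₀ : Measure Ω₀} {P : Measure Ω} {n : ℕ} (hn : n ≠ 0)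
    {X : T → Ω₀ → ℝ} {Xc : Fin n → T → Ω → ℝ}
    (hcopy : ∀ i, IdentDistrib (fun ω t => Xc i t ω) (fun ω t => X t ω) P P₀)
    (hindep : iIndepFun (fun i ω t => Xc i t ω) P) {u : ℝ} (hu : 0 < u) (y : T → ℝ)
    (I : Finset T) :
    P {ω | ∀ t ∈ I, u * ((⨆ i, Xc i t ω) - u) ≤ y t} =
      P₀ {ω | ∀ t ∈ I, u * (X t ω - u) ≤ y t} ^ n := by
  -- For `n = 0` the supremum over `Fin 0` would be the default value `0`, not a maximum.
  have : NeZero n := ⟨hn⟩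
  set A : Set (T → ℝ) := {x | ∀ t ∈ I, u * (x t - u) ≤ y t} with hA
  have hAm : MeasurableSet A := by
    have : A = ⋂ t ∈ I, {x | u * (x t - u) ≤ y t} := by ext; simp [hA]
    rw [this]
    exact Finset.measurableSet_biInter _ fun t _ => measurableSet_le (by fun_prop) measurable_const
  have hset : {ω | ∀ t ∈ I, u * ((⨆ i, Xc i t ω) - u) ≤ y t} =
      ⋂ i ∈ (Finset.univ : Finset (Fin n)), (fun ω t => Xc i t ω) ⁻¹' A := by
    ext ω
    simp only [Set.mem_ofPred_eq, Finset.mem_univ, Set.iInter_true, Set.mem_iInter,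
      Set.mem_preimage, hA]
    have key : ∀ t x, u * (x - u) ≤ y t ↔ x ≤ y t / u + u := fun t x => by
      rw [← sub_le_iff_le_add, le_div_iff₀' hu]
    simp_rw [key]
    rw [forall_comm]
    refine forall_congr' fun t => ?_
    rw [forall_comm]
    exact forall_congr' fun _ => ciSup_le_iff (Set.finite_range _).bddAbove
  rw [hset, hindep.measure_inter_preimage_eq_mul _ (fun _ _ => hAm)]
  simp_rw [fun i => (hcopy i).measure_mem_eq hAm]
  simp
  rfl

/-- A Gaussian process is only almost everywhere measurable at each index, whereas the Fubini
arguments need measurable versions. -/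
lemma exists_measurable_modification {T Ω : Type*} [MeasurableSpace Ω] {P : Measure Ω}
    {X : T → Ω → ℝ} (hX : IsGaussianProcess X P) :
    ∃ X' : T → Ω → ℝ, (∀ t, Measurable (X' t)) ∧ ∀ t, X t =ᵐ[P] X' t :=
  ⟨fun t => (hX.aemeasurable t).mk, fun t => (hX.aemeasurable t).measurable_mk,
    fun t => (hX.aemeasurable t).ae_eq_mk⟩

/-- The probability that no copy exceeds is `(1 - p n) ^ n`, and `n * p n` has the finite limit `Λ
I`, the exponent of the limiting distribution function. -/
theorem tendstoFinDim_rescaled_max {T : Type*} {Ω₀ : ℕ → Type*} [∀ n, MeasurableSpace (Ω₀ n)]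
    {P₀ : (n : ℕ) → Measure (Ω₀ n)} {X X' : (n : ℕ) → T → Ω₀ n → ℝ} {Γ : T → T → ℝ≥0∞} {u : ℕ → ℝ}
    (hA : IsCriticalArray P₀ X' Γ u) (hXX' : ∀ n t, X n t =ᵐ[P₀ n] X' n t)
    {Ω : ℕ → Type*} [∀ n, MeasurableSpace (Ω n)]
    (P : (n : ℕ) → Measure (Ω n)) [∀ n, IsProbabilityMeasure (P n)]
    (Xc : (n : ℕ) → Fin n → T → Ω n → ℝ)
    (hXc_copy : ∀ n i, IdentDistrib (fun ω t => Xc n i t ω) (fun ω t => X n t ω) (P n) (P₀ n))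
    (hXc_indep : ∀ n, iIndepFun (fun i ω t => Xc n i t ω) (P n))
    {Ω' : Type*} [MeasurableSpace Ω'] (P' : Measure Ω') [IsProbabilityMeasure P']
    (M : T → Ω' → ℝ) (hM : IsLimitProcess Γ M P') :
    TendstoFinDim (fun n t ω => u n * ((⨆ i : Fin n, Xc n i t ω) - u n)) M P P' := by
  classical
  intro I
  refine tendstoInDistribution_of_tendsto_measure_le (fun n => ?_) ?_ fun y => ?_
  · refine aemeasurable_pi_lambda _ fun t => AEMeasurable.const_mul (AEMeasurable.sub_const ?_ _) _
    exact AEMeasurable.iSup fun i =>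
      (measurable_pi_apply (t : T)).comp_aemeasurable (hXc_copy n i).aemeasurable_fst
  · exact (measurable_pi_lambda _ fun t : I => hM.1 t).aemeasurable
  · set y' : T → ℝ := fun t => if h : t ∈ I then y ⟨t, h⟩ else 0 with hy'
    have hyy : ∀ t : I, y t = y' t := fun t => by simp [hy']
    obtain ⟨Λ, hΛ0, hΛtop, hΛM, hΛ⟩ := hM.exists_measure_le y'
    have hlim := hA.tendsto_mul_measure_exists_exceedance
      (fun s s' t h h' => hA.ne_top_trans h (hA.ne_top_symm h')) y' hΛ0 hΛ I
    have hP₀ := fun n => (hA.gaussian n).isProbabilityMeasure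
    have hlim2 := tendsto_one_sub_pow_of_tendsto_mul (fun n => prob_le_one) (hΛtop I) hlim
    simp_rw [hyy, Subtype.forall]
    rw [hΛM I]
    refine hlim2.congr' ?_
    filter_upwards [hA.tendsto_atTop.eventually_gt_atTop 0, eventually_ne_atTop 0] with n hn hn0
    rw [measure_iSup_le_eq_pow hn0 (hXc_copy n) (hXc_indep n) hn y' I]
    congr 1
    have hX := hA.measurable n
    have hmeas : MeasurableSet {ω | ∃ s ∈ I, y' s < u n * (X' n s ω - u n)} := by
      have : {ω | ∃ s ∈ I, y' s < u n * (X' n s ω - u n)} =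
          ⋃ s ∈ I, {ω | y' s < u n * (X' n s ω - u n)} := by ext; simp
      rw [this]
      exact Finset.measurableSet_biUnion _ fun s _ =>
        measurableSet_lt measurable_const (by fun_prop)
    rw [← prob_compl_eq_one_sub hmeas]
    refine measure_congr ?_
    have hall : ∀ᵐ ω ∂(P₀ n), ∀ t : I, X n t ω = X' n t ω := ae_all_iff.2 fun t => hXX' n t
    filter_upwards [hall] with ω hω
    refine propext ?_
    change (¬ ∃ s ∈ I, y' s < u n * (X' n s ω - u n)) ↔ ∀ t ∈ I, u n * (X n t ω - u n) ≤ y' t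
    push Not
    exact forall₂_congr fun t ht => by rw [hω ⟨t, ht⟩]

end Maxima

/-! ### The isonormal Gaussian process -/

section Isonormal

lemma dist_exp_I_mul_le (a b : ℝ) :
    ‖Complex.exp (Complex.I * a) - Complex.exp (Complex.I * b)‖ ≤ ‖a - b‖ := by
  have h : Complex.exp (Complex.I * a) - Complex.exp (Complex.I * b) =
      Complex.exp (Complex.I * b) * (Complex.exp (Complex.I * ((a - b : ℝ) : ℂ)) - 1) := by
    rw [mul_sub, ← Complex.exp_add, mul_one]
    congr 2
    push_cast
    ring
  rw [h, norm_mul, Complex.norm_exp_I_mul_ofReal, one_mul]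
  exact Real.norm_exp_I_mul_ofReal_sub_one_le

lemma integrable_exp_I_mul {Ω : Type*} [MeasurableSpace Ω] {P : Measure Ω} [IsFiniteMeasure P]
    {f : Ω → ℝ} (hf : AEStronglyMeasurable f P) :
    Integrable (fun ω => Complex.exp (Complex.I * f ω)) P := by
  refine Integrable.of_bound (C := 1) ?_ (.of_forall fun ω => ?_)
  · exact (by fun_prop : Continuous fun x : ℝ => Complex.exp (Complex.I * x)).comp_aestronglyMeasurable hf
  · rw [Complex.norm_exp_I_mul_ofReal]

/-- The characteristic function at `1` is continuous on `L²`. -/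
lemma continuous_integral_exp_I_mul {Ω : Type*} [MeasurableSpace Ω] (P : Measure Ω)
    [IsProbabilityMeasure P] :
    Continuous fun f : Lp ℝ 2 P => ∫ ω, Complex.exp (Complex.I * f ω) ∂P := by
  refine LipschitzWith.continuous (K := 1) (LipschitzWith.of_dist_le_mul fun f g => ?_)
  have hfg : Integrable (f - g : Lp ℝ 2 P) P := (Lp.memLp (f - g)).integrable one_le_two
  rw [NNReal.coe_one, one_mul, dist_eq_norm, dist_eq_norm,
    ← integral_sub (integrable_exp_I_mul (Lp.aestronglyMeasurable f))
      (integrable_exp_I_mul (Lp.aestronglyMeasurable g))]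
  calc ‖∫ ω, Complex.exp (Complex.I * f ω) - Complex.exp (Complex.I * g ω) ∂P‖
      ≤ ∫ ω, ‖(f - g : Lp ℝ 2 P) ω‖ ∂P := by
        refine norm_integral_le_of_norm_le hfg.norm ?_
        filter_upwards [Lp.coeFn_sub f g] with ω hω
        rw [hω, Pi.sub_apply]
        exact dist_exp_I_mul_le _ _
    _ = (eLpNorm (f - g : Lp ℝ 2 P) 1 P).toReal := by
        rw [eLpNorm_one_eq_lintegral_enorm, integral_norm_eq_lintegral_enorm hfg.1]
    _ ≤ (eLpNorm (f - g : Lp ℝ 2 P) 2 P).toReal :=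
        ENNReal.toReal_mono (Lp.eLpNorm_ne_top _)
          (eLpNorm_le_eLpNorm_of_exponent_le one_le_two (Lp.aestronglyMeasurable _))
    _ = ‖f - g‖ := (Lp.norm_def _).symm

lemma charFun_map_real {Ω : Type*} [MeasurableSpace Ω] {P : Measure Ω} {f : Ω → ℝ}
    (hf : AEMeasurable f P) (x : ℝ) :
    charFun (P.map f) x = ∫ ω, Complex.exp (Complex.I * ((x * f ω : ℝ) : ℂ)) ∂P := by
  rw [charFun_apply_real, integral_map hf (by fun_prop)]
  congr with ω
  push_cast
  ring_nf

variable {ι : Type*}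

/-- The product of standard Gaussian measures. -/
noncomputable abbrev stdGaussianPi (ι : Type*) : Measure (ι → ℝ) :=
  Measure.infinitePi fun _ : ι => gaussianReal 0 1

lemma map_eval_stdGaussianPi (i : ι) :
    (stdGaussianPi ι).map (fun x => x i) = gaussianReal 0 1 :=
  Measure.infinitePi_map_eval (fun _ : ι => gaussianReal 0 1) i

lemma aemeasurable_eval_stdGaussianPi (i : ι) :
    AEMeasurable (fun x : ι → ℝ => x i) (stdGaussianPi ι) :=
  (measurable_pi_apply i).aemeasurable

lemma memLp_eval_stdGaussianPi (i : ι) : MemLp (fun x : ι → ℝ => x i) 2 (stdGaussianPi ι) := by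
  have h := memLp_id_gaussianReal' (μ := 0) (v := 1) 2 (by simp)
  rw [← map_eval_stdGaussianPi i, memLp_map_measure_iff (by fun_prop) (aemeasurable_eval_stdGaussianPi i)] at h
  exact h

lemma integral_eval_stdGaussianPi (i : ι) : ∫ x, x i ∂(stdGaussianPi ι) = 0 := by
  have h : ∫ x, x ∂((stdGaussianPi ι).map fun x => x i) = 0 := by
    rw [map_eval_stdGaussianPi, integral_id_gaussianReal]
  rwa [integral_map (aemeasurable_eval_stdGaussianPi i) (by fun_prop)] at h

lemma integral_eval_sq_stdGaussianPi (i : ι) : ∫ x, x i * x i ∂(stdGaussianPi ι) = 1 := by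
  have h := variance_fun_id_gaussianReal (μ := 0) (v := 1)
  rw [← map_eval_stdGaussianPi i, variance_map (by fun_prop) (aemeasurable_eval_stdGaussianPi i)] at h
  change Var[fun x => x i; stdGaussianPi ι] = _ at h
  rw [variance_eq_sub (memLp_eval_stdGaussianPi i), integral_eval_stdGaussianPi] at h
  simpa [pow_two] using h

lemma iIndepFun_eval_stdGaussianPi : iIndepFun (fun (i : ι) (x : ι → ℝ) => x i) (stdGaussianPi ι) :=
  iIndepFun_infinitePi (X := fun _ x => x) fun _ => measurable_id

lemma orthonormal_eval_stdGaussianPi :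
    Orthonormal ℝ fun i : ι => (memLp_eval_stdGaussianPi i).toLp := by
  classical
  rw [orthonormal_iff_ite]
  intro i j
  have h : inner ℝ (memLp_eval_stdGaussianPi i).toLp (memLp_eval_stdGaussianPi j).toLp =
      ∫ x, x i * x j ∂(stdGaussianPi ι) := by
    rw [L2.inner_def]
    refine integral_congr_ae ?_
    filter_upwards [(memLp_eval_stdGaussianPi i).coeFn_toLp,
      (memLp_eval_stdGaussianPi j).coeFn_toLp] with x hi hj
    rw [hi, hj]
    simp [mul_comm]
  rw [h]
  split_ifs with hij
  · subst hij
    exact integral_eval_sq_stdGaussianPi i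
  · rw [(iIndepFun_eval_stdGaussianPi.indepFun hij).integral_fun_mul_eq_mul_integral
      (memLp_eval_stdGaussianPi i).1 (memLp_eval_stdGaussianPi j).1, integral_eval_stdGaussianPi,
      zero_mul]

lemma charFun_linComb_stdGaussianPi (s : Finset ι) (c : ι → ℝ) :
    ∫ x, Complex.exp (Complex.I * ((∑ i ∈ s, c i * x i : ℝ) : ℂ)) ∂(stdGaussianPi ι) =
      Complex.exp (-((∑ i ∈ s, c i * c i : ℝ) : ℂ) / 2) := by
  have hm : AEMeasurable (fun x : ι → ℝ => ∑ i ∈ s, c i * x i) (stdGaussianPi ι) :=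
    (Finset.measurable_sum _ fun i _ => (measurable_pi_apply i).const_mul _).aemeasurable
  have h1 := charFun_map_real hm 1
  simp only [one_mul] at h1
  rw [← h1]
  have hind : iIndepFun (fun (i : ι) (x : ι → ℝ) => c i * x i) (stdGaussianPi ι) :=
    iIndepFun_infinitePi (X := fun i x => c i * x) fun _ => by fun_prop
  rw [iIndepFun.charFun_map_fun_finsetSum_eq_prod
    (fun i _ => ((measurable_pi_apply i).const_mul _).aemeasurable) (hind.restrict s),
    Finset.prod_apply]
  have h2 : ∀ i, charFun ((stdGaussianPi ι).map fun x => c i * x i) 1 =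
      Complex.exp (-((c i * c i : ℝ) : ℂ) / 2) := by
    intro i
    have h3 : (stdGaussianPi ι).map (fun x => c i * x i) =
        ((stdGaussianPi ι).map (fun x => x i)).map (c i * ·) := by
      rw [Measure.map_map (by fun_prop) (by fun_prop)]; rfl
    rw [h3, map_eval_stdGaussianPi, gaussianReal_map_const_mul, charFun_gaussianReal]
    congr 1
    simp [pow_two, neg_div]
  simp_rw [h2]
  rw [← Complex.exp_sum]
  congr 1
  rw [← Finset.sum_div, Finset.sum_neg_distrib]
  push_cast
  rfl

/-- The isonormal Gaussian process of a Hilbert space. -/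
lemma exists_isonormal (H : Type*) [NormedAddCommGroup H] [InnerProductSpace ℝ H]
    [CompleteSpace H] :
    ∃ (κ : Set H) (Φ : H →ₗᵢ[ℝ] Lp ℝ 2 (stdGaussianPi κ)),
      ∀ h, (stdGaussianPi κ).map (Φ h) = gaussianReal 0 (‖h‖ ^ 2).toNNReal := by
  classical
  obtain ⟨κ, b, -⟩ := exists_hilbertBasis ℝ H
  -- The coordinates are orthonormal in `L²`, so sending a Hilbert basis to them extends to an
  -- isometry.
  set V := (orthonormal_eval_stdGaussianPi (ι := κ)).orthogonalFamily with hV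
  set Φ : H →ₗᵢ[ℝ] Lp ℝ 2 (stdGaussianPi κ) :=
    V.linearIsometry.comp b.repr.toLinearIsometry with hΦ
  have hΦb : ∀ i, Φ (b i) = (memLp_eval_stdGaussianPi i).toLp := by
    intro i
    change V.linearIsometry (b.repr (b i)) = _
    rw [b.repr_self, OrthogonalFamily.linearIsometry_apply_single]
    simp
  -- On finite linear combinations of the basis this is an explicit product of Gaussian
  -- characteristic functions; both sides are continuous in `h`, and the span is dense.
  have key : ∀ h, ∫ x, Complex.exp (Complex.I * Φ h x) ∂(stdGaussianPi κ) =
      Complex.exp (-((‖h‖ ^ 2 : ℝ) : ℂ) / 2) := by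
    have hcl : IsClosed {h | ∫ x, Complex.exp (Complex.I * Φ h x) ∂(stdGaussianPi κ) =
        Complex.exp (-((‖h‖ ^ 2 : ℝ) : ℂ) / 2)} :=
      isClosed_eq ((continuous_integral_exp_I_mul _).comp Φ.continuous) (by fun_prop)
    have hspan : (Submodule.span ℝ (Set.range b) : Set H) ⊆
        {h | ∫ x, Complex.exp (Complex.I * Φ h x) ∂(stdGaussianPi κ) =
          Complex.exp (-((‖h‖ ^ 2 : ℝ) : ℂ) / 2)} := by
      intro h hh
      obtain ⟨c, rfl⟩ := (Finsupp.mem_span_range_iff_exists_finsupp).1 hh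
      simp only [Set.mem_ofPred_eq, Finsupp.sum]
      rw [← real_inner_self_eq_norm_sq, b.orthonormal.inner_sum]
      simp only [RCLike.conj_to_real]
      rw [← charFun_linComb_stdGaussianPi]
      have hae : ∀ᵐ x ∂(stdGaussianPi κ), (Φ (∑ i ∈ c.support, c i • b i)) x =
          ∑ i ∈ c.support, c i * x i := by
        rw [map_sum]
        simp_rw [map_smul, hΦb]
        have h1 := Lp.coeFn_finsetSum (p := 2) (μ := stdGaussianPi κ) c.support
          fun i => c i • (memLp_eval_stdGaussianPi i).toLp
        have h2 : ∀ᵐ x ∂(stdGaussianPi κ), ∀ i : c.support,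
            (c i • (memLp_eval_stdGaussianPi (i : κ)).toLp) x = c i * x i := by
          refine ae_all_iff.2 fun i => ?_
          filter_upwards [Lp.coeFn_smul (c i) (memLp_eval_stdGaussianPi (i : κ)).toLp,
            (memLp_eval_stdGaussianPi (i : κ)).coeFn_toLp] with x h3 h4
          rw [h3, Pi.smul_apply, h4, smul_eq_mul]
        filter_upwards [h1, h2] with x h3 h4
        rw [h3, Finset.sum_apply]
        exact Finset.sum_congr rfl fun i hi => h4 ⟨i, hi⟩
      refine integral_congr_ae ?_
      filter_upwards [hae] with x hx
      rw [hx]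
    intro h
    have hd : h ∈ closure (Submodule.span ℝ (Set.range b) : Set H) := by
      rw [← Submodule.topologicalClosure_coe, b.dense_span]
      trivial
    exact closure_minimal hspan hcl hd
  refine ⟨κ, Φ, fun h => ?_⟩
  have hm : ∀ h, AEMeasurable (Φ h) (stdGaussianPi κ) := fun h =>
    (Lp.aestronglyMeasurable _).aemeasurable
  have : IsProbabilityMeasure ((stdGaussianPi κ).map (Φ h)) :=
    Measure.isProbabilityMeasure_map (hm h)
  refine Measure.ext_of_charFun ?_
  ext x
  rw [charFun_map_real (hm h), charFun_gaussianReal]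
  have hx := key (x • h)
  rw [map_smul] at hx
  have h1 : ∫ ω, Complex.exp (Complex.I * ((x * Φ h ω : ℝ) : ℂ)) ∂(stdGaussianPi κ) =
      ∫ ω, Complex.exp (Complex.I * (x • Φ h) ω) ∂(stdGaussianPi κ) := by
    refine integral_congr_ae ?_
    filter_upwards [Lp.coeFn_smul x (Φ h)] with ω hω
    rw [hω, Pi.smul_apply, smul_eq_mul]
  rw [h1, hx, Real.coe_toNNReal _ (sq_nonneg _), norm_smul, mul_pow]
  congr 1
  simp
  ring

end Isonormal

/-! ### Gaussian processes with given incremental variance -/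

section NegativeDefinite

variable {S : Type*} {Γ : S → S → ℝ}

lemma IsNegDef.sum_nonpos_fintype (hΓ : IsNegDef Γ) {κ : Type*} [Fintype κ] (t : κ → S) (a : κ → ℝ)
    (ha : ∑ k, a k = 0) : ∑ k, ∑ l, a k * a l * Γ (t k) (t l) ≤ 0 := by
  set e := (Fintype.equivFin κ).symm
  have h := hΓ.sum_nonpos (Fintype.card κ) (t ∘ e) (a ∘ e) (by
    rw [← ha]; exact e.sum_comp a)
  simp only [Function.comp_apply] at h
  rw [e.sum_comp fun k => ∑ j, a k * a (e j) * Γ (t k) (t (e j))] at h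
  simp_rw [fun k => e.sum_comp fun l => a k * a l * Γ (t k) (t l)] at h
  exact h

/-- The covariance function, vanishing at `o`, of the Gaussian process with incremental
variance `Γ`. -/
noncomputable def pinnedCov (Γ : S → S → ℝ) (o s t : S) : ℝ := (Γ s o + Γ t o - Γ s t) / 2

/-- Adjoining the base point `o` with weight `-∑ w` makes the weights sum to zero; negative
definiteness is then the claim up to the factor `-2`. -/
lemma IsNegDef.sum_pinnedCov_nonneg (hΓ : IsNegDef Γ) (o : S) (s : Finset S) (w : S → ℝ) :
    0 ≤ ∑ x ∈ s, ∑ y ∈ s, w x * w y * pinnedCov Γ o x y := by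
  have h := hΓ.sum_nonpos_fintype (κ := Option s) (fun k => k.elim o (fun x => (x : S)))
    (fun k => k.elim (-∑ x : s, w x) fun x => w x) (by simp [Fintype.sum_option])
  simp only [Fintype.sum_option, Option.elim, hΓ.diag, mul_zero, zero_add] at h
  rw [← Finset.sum_coe_sort]
  simp_rw [← Finset.sum_coe_sort s]
  set c := ∑ x : s, w x with hc
  set A := ∑ x : s, w x * Γ x o with hA
  have h1 : ∑ x : s, -c * w x * Γ o x = -c * A := by
    rw [hA, Finset.mul_sum]
    exact Finset.sum_congr rfl fun x _ => by rw [hΓ.symm o x]; ring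
  have h2 : ∑ x : s, w x * -c * Γ x o = -c * A := by
    rw [hA, Finset.mul_sum]
    exact Finset.sum_congr rfl fun x _ => by ring
  rw [h1, Finset.sum_add_distrib, h2] at h
  have h3 : ∑ x : s, ∑ y : s, w x * w y * pinnedCov Γ o x y =
      (A * c + c * A - ∑ x : s, ∑ y : s, w x * w y * Γ x y) / 2 := by
    rw [hA, hc, Finset.sum_mul_sum, Finset.sum_mul_sum, ← Finset.sum_add_distrib,
      ← Finset.sum_sub_distrib, Finset.sum_div]
    refine Finset.sum_congr rfl fun x _ => ?_
    rw [← Finset.sum_add_distrib, ← Finset.sum_sub_distrib, Finset.sum_div]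
    exact Finset.sum_congr rfl fun y _ => by rw [pinnedCov]; ring
  rw [h3]
  linarith

/-- Schoenberg's embedding: `Γ` is the square of a Hilbert space distance. -/
lemma IsNegDef.exists_embedding {S : Type u} {Γ : S → S → ℝ} (hΓ : IsNegDef Γ) [Nonempty S] :
    ∃ (H : Type u) (_ : NormedAddCommGroup H) (_ : InnerProductSpace ℝ H) (_ : CompleteSpace H)
      (h : S → H), ∀ s t, ‖h s - h t‖ ^ 2 = Γ s t := by
  obtain ⟨o⟩ := ‹Nonempty S›
  -- Reproducing kernels are operator-valued, so the scalar kernel is multiplied by the identity of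
  -- `ℝ`.
  set K : Matrix S S (ℝ →L[ℝ] ℝ) := Matrix.of fun s t => pinnedCov Γ o s t • (1 : ℝ →L[ℝ] ℝ)
    with hK
  have hpsd : K.PosSemidef := by
    have htfae := (RKHS.posSemidef_tfae (K := K)).out 0 2
    refine htfae.2 ⟨?_, fun v => ?_⟩
    · ext s t
      simp [hK, Matrix.conjTranspose_apply, pinnedCov, hΓ.symm s t, add_comm]
    · have := hΓ.sum_pinnedCov_nonneg o v.support v
      refine this.trans_eq ?_
      simp only [Finsupp.sum, hK, RCLike.re_to_real]
      refine Finset.sum_congr rfl fun x _ => Finset.sum_congr rfl fun y _ => ?_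
      simp [pinnedCov, hΓ.symm x y]
      ring
  have : Fact K.PosSemidef := ⟨hpsd⟩
  refine ⟨RKHS.OfKernel K, inferInstance, inferInstance, inferInstance,
    fun s => RKHS.kerFun (RKHS.OfKernel K) s 1, fun s t => ?_⟩
  have hin : ∀ s t, inner ℝ (RKHS.kerFun (RKHS.OfKernel K) s (1 : ℝ))
      (RKHS.kerFun (RKHS.OfKernel K) t 1) = pinnedCov Γ o s t := by
    intro s t
    rw [← RKHS.kernel_inner, RKHS.OfKernel.kernel_ofKernel]
    simp [hK, pinnedCov, hΓ.symm t s, add_comm]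
  -- The terms `Γ s o` and `Γ t o` cancel in `K s s - 2 K s t + K t t`, leaving `Γ s t`.
  rw [norm_sub_sq_real, ← real_inner_self_eq_norm_sq, ← real_inner_self_eq_norm_sq, hin, hin, hin]
  simp only [pinnedCov, hΓ.diag]
  ring

/-- Evaluate the isonormal process along the embedding, `W t = Φ (h t)`. Linear combinations of the
`W t` are again values of `Φ`, hence Gaussian, and increments have variance `‖h s - h t‖²`. -/
lemma exists_hasIncrementalVariance {S : Type u} {Γ : S → S → ℝ} (hΓ : IsNegDef Γ) [Nonempty S] :
    ∃ (Ω : Type u) (_ : MeasurableSpace Ω) (P : Measure Ω) (_ : IsProbabilityMeasure P)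
      (W : S → Ω → ℝ), (∀ t, Measurable (W t)) ∧ HasIncrementalVariance W Γ P := by
  obtain ⟨H, _, _, _, h, hh⟩ := hΓ.exists_embedding
  obtain ⟨κ, Φ, hΦ⟩ := exists_isonormal H
  have hm : ∀ x, Measurable (Φ x) := fun x => (Lp.stronglyMeasurable _).measurable
  have hmean : ∀ x, ∫ ω, Φ x ω ∂(stdGaussianPi κ) = 0 := fun x => by
    have h1 := integral_id_gaussianReal (μ := 0) (v := (‖x‖ ^ 2).toNNReal)
    rwa [← hΦ x, integral_map (hm x).aemeasurable (by fun_prop)] at h1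
  have hvar : ∀ x, Var[Φ x; stdGaussianPi κ] = ‖x‖ ^ 2 := fun x => by
    have h1 := variance_fun_id_gaussianReal (μ := 0) (v := (‖x‖ ^ 2).toNNReal)
    rw [← hΦ x, variance_map (by fun_prop) (hm x).aemeasurable,
      Real.coe_toNNReal _ (sq_nonneg _)] at h1
    exact h1
  refine ⟨κ → ℝ, inferInstance, stdGaussianPi κ, inferInstance, fun t => Φ (h t),
    fun t => hm _, ⟨⟨fun I => ⟨?_⟩⟩, fun t => hmean _, fun s t => ?_⟩⟩
  · refine isGaussian_of_map_eq_gaussianReal fun L => ?_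
    classical
    set x : H := ∑ i : I, L (Pi.single i 1) • h i with hx
    refine ⟨0, (‖x‖ ^ 2).toNNReal, ?_⟩
    have hrm : Measurable fun (ω : κ → ℝ) => I.restrict fun t => Φ (h t) ω :=
      measurable_pi_lambda _ fun i => hm _
    rw [Measure.map_map (by fun_prop) hrm, ← hΦ x]
    refine Measure.map_congr ?_
    have hx' : Φ x = ∑ i : I, L (Pi.single i 1) • Φ (h i) := by
      rw [hx, map_sum]
      simp_rw [map_smul]
    have h1 := Lp.coeFn_finsetSum (p := 2) (μ := stdGaussianPi κ) Finset.univ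
            fun i : I => L (Pi.single i 1) • Φ (h i)
    have h2 : ∀ᵐ ω ∂(stdGaussianPi κ), ∀ i : I,
        (L (Pi.single i 1) • Φ (h i)) ω = L (Pi.single i 1) * Φ (h i) ω :=
      ae_all_iff.2 fun i => Lp.coeFn_smul _ _
    filter_upwards [h1, h2] with ω h3 h4
    have hL : ∀ v : I → ℝ, L v = ∑ i, v i * L (Pi.single i 1) := fun v => by
      refine ((L : (I → ℝ) →ₗ[ℝ] ℝ).pi_apply_eq_sum_univ v).trans ?_
      refine Finset.sum_congr rfl fun i _ => ?_
      rw [smul_eq_mul, ContinuousLinearMap.coe_coe]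
      congr 2
      funext j
      simp [Pi.single_apply, eq_comm]
    rw [hx', h3, Finset.sum_apply, Function.comp_apply, hL]
    refine Finset.sum_congr rfl fun i _ => ?_
    rw [h4, mul_comm]
    rfl
  · rw [← hh s t, ← hvar, map_sub]
    exact variance_congr (Lp.coeFn_sub _ _).symm

end NegativeDefinite

/-! ### Independence under pointwise limits -/

section IndependenceLimit

lemma charFun_map_toLp_eq_integral {Ω κ : Type*} [MeasurableSpace Ω] [Fintype κ] {P : Measure Ω}
    {X : κ → Ω → ℝ} (hX : ∀ k, Measurable (X k)) (θ : EuclideanSpace ℝ κ) :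
    charFun (P.map fun ω => WithLp.toLp 2 fun k => X k ω) θ =
      ∫ ω, Complex.exp (Complex.I * ((∑ k, θ k * X k ω : ℝ) : ℂ)) ∂P := by
  rw [charFun_map_toLp P fun k => (hX k).aemeasurable, charFun_map_real
    (Finset.measurable_sum _ fun k _ => (hX k).const_mul _).aemeasurable]
  simp_rw [one_mul]

lemma tendsto_integral_exp_I_mul {Ω : Type*} [MeasurableSpace Ω] {P : Measure Ω}
    [IsFiniteMeasure P] {X : ℕ → Ω → ℝ} {Y : Ω → ℝ} (hX : ∀ n, Measurable (X n))
    (hXY : ∀ ω, Tendsto (fun n => X n ω) atTop (𝓝 (Y ω))) :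
    Tendsto (fun n => ∫ ω, Complex.exp (Complex.I * X n ω) ∂P) atTop
      (𝓝 (∫ ω, Complex.exp (Complex.I * Y ω) ∂P)) := by
  refine tendsto_integral_of_dominated_convergence (fun _ => 1)
    (fun n => (integrable_exp_I_mul (hX n).aestronglyMeasurable).1) (integrable_const 1)
    (fun n => .of_forall fun ω => by rw [Complex.norm_exp_I_mul_ofReal]) (.of_forall fun ω => ?_)
  exact ((by fun_prop : Continuous fun x : ℝ => Complex.exp (Complex.I * x)).tendsto _).comp (hXY ω)

/-- Independence is preserved under pointwise limits. -/
lemma iIndepFun_of_tendsto {Ω κ : Type*} [MeasurableSpace Ω] [Fintype κ] {P : Measure Ω}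
    [IsProbabilityMeasure P] {X : ℕ → κ → Ω → ℝ} {Y : κ → Ω → ℝ}
    (hX : ∀ n k, Measurable (X n k)) (hY : ∀ k, Measurable (Y k))
    (hXY : ∀ k ω, Tendsto (fun n => X n k ω) atTop (𝓝 (Y k ω))) (hind : ∀ n, iIndepFun (X n) P) :
    iIndepFun Y P := by
  rw [iIndepFun_iff_charFun_pi fun k => (hY k).aemeasurable]
  intro θ
  have h1 : ∀ n, ∫ ω, Complex.exp (Complex.I * ((∑ k, θ k * X n k ω : ℝ) : ℂ)) ∂P =
      ∏ k, ∫ ω, Complex.exp (Complex.I * ((θ k * X n k ω : ℝ) : ℂ)) ∂P := fun n => by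
    have := (iIndepFun_iff_charFun_pi fun k => (hX n k).aemeasurable).1 (hind n) θ
    rw [charFun_map_toLp_eq_integral (hX n)] at this
    rw [this]
    exact Finset.prod_congr rfl fun k _ => charFun_map_real (hX n k).aemeasurable _
  rw [charFun_map_toLp_eq_integral hY,
    Finset.prod_congr rfl fun k _ => charFun_map_real (hY k).aemeasurable _]
  have h2 := tendsto_integral_exp_I_mul (P := P) (X := fun n ω => ∑ k, θ k * X n k ω)
    (Y := fun ω => ∑ k, θ k * Y k ω)
    (fun n => Finset.measurable_sum _ fun k _ => (hX n k).const_mul _)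
    (fun ω => tendsto_finsetSum _ fun k _ => (hXY k ω).const_mul _)
  have h3 := tendsto_finsetProd Finset.univ fun k _ =>
    tendsto_integral_exp_I_mul (P := P) (X := fun n ω => θ k * X n k ω)
    (Y := fun ω => θ k * Y k ω) (fun n => (hX n k).const_mul _) (fun ω => (hXY k ω).const_mul _)
  simp_rw [h1] at h2
  exact tendsto_nhds_unique h2 h3

end IndependenceLimit

/-! ### Poisson clusters and their joint characteristic functions -/

section PoissonConstruction

/-- The number of the first `p.1` points of the sequence `p.2` falling into `A`. -/
noncomputable def blockCount (A : Set ℝ) (p : ℕ × (ℕ → ℝ)) : ℕ :=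
  ∑ j ∈ Finset.range p.1, A.indicator 1 (p.2 j)

lemma measurable_blockCount {A : Set ℝ} (hA : MeasurableSet A) : Measurable (blockCount A) := by
  refine measurable_from_prod_countable_right fun n => ?_
  have h : Measurable (A.indicator (1 : ℝ → ℕ)) := measurable_one.indicator hA
  exact Finset.measurable_sum (Finset.range n) fun j _ => h.comp (measurable_pi_apply j)

/-- The law of a Poisson number of independent points. -/
noncomputable abbrev blockMeasure (ν : Measure ℝ) [IsProbabilityMeasure ν] :
    Measure (ℕ × (ℕ → ℝ)) :=
  (poissonMeasure 1).prod (Measure.infinitePi fun _ : ℕ => ν)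

/-- Given the Poisson(1) number `N` of points, the product has mean `z ^ N` with `z = ∫ φ`, and the
mean of `z ^ N` is `e^{z - 1}`. -/
lemma integral_prod_range_blockMeasure (ν : Measure ℝ) [IsProbabilityMeasure ν] {φ : ℝ → ℂ}
    (hφ : Measurable φ) (hφ1 : ∀ x, ‖φ x‖ = 1) :
    ∫ p, ∏ j ∈ Finset.range p.1, φ (p.2 j) ∂(blockMeasure ν) =
      Complex.exp ((∫ x, φ x ∂ν) - 1) := by
  have hm : Measurable fun p : ℕ × (ℕ → ℝ) => ∏ j ∈ Finset.range p.1, φ (p.2 j) :=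
    measurable_from_prod_countable_right fun n =>
      Finset.measurable_prod (Finset.range n) fun j _ => hφ.comp (measurable_pi_apply j)
  have hint : Integrable (fun p : ℕ × (ℕ → ℝ) => ∏ j ∈ Finset.range p.1, φ (p.2 j))
      (blockMeasure ν) := by
    refine Integrable.of_bound (C := 1) hm.aestronglyMeasurable (.of_forall fun p => ?_)
    rw [norm_prod]
    simp [hφ1]
  have hind : iIndepFun (fun (j : ℕ) (v : ℕ → ℝ) => φ (v j))
      (Measure.infinitePi fun _ : ℕ => ν) := iIndepFun_infinitePi (X := fun _ x => φ x) fun _ => hφ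
  have hinner : ∀ n : ℕ, ∫ v, ∏ j ∈ Finset.range n, φ (v j) ∂(Measure.infinitePi fun _ : ℕ => ν) =
      (∫ x, φ x ∂ν) ^ n := by
    intro n
    have h1 := (hind.precomp (g := fun j : Fin n => (j : ℕ))
      Fin.val_injective).integral_fun_prod_eq_prod_integral
      fun j => (hφ.comp (measurable_pi_apply _)).aestronglyMeasurable
    simp_rw [Finset.prod_range]
    refine h1.trans ?_
    have h2 : ∀ j : ℕ, ∫ v, φ (v j) ∂(Measure.infinitePi fun _ : ℕ => ν) = ∫ x, φ x ∂ν := by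
      intro j
      have := Measure.infinitePi_map_eval (fun _ : ℕ => ν) j
      conv_rhs => rw [← this]
      rw [integral_map (measurable_pi_apply j).aemeasurable hφ.aestronglyMeasurable]
    simp [h2]
  rw [integral_prod _ hint]
  simp only [hinner]
  rw [integral_poissonMeasure]
  set z := ∫ x, φ x ∂ν with hz
  have hexp := (NormedSpace.expSeries_div_hasSum_exp z).tsum_eq
  rw [← Complex.exp_eq_exp_ℂ] at hexp
  rw [sub_eq_neg_add, Complex.exp_add, ← hexp, ← tsum_mul_left]
  refine tsum_congr fun n => ?_
  simp [Complex.real_smul]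
  ring

/-- Joint characteristic function of the counts of disjoint sets in one block. -/
lemma integral_exp_blockCount (ν : Measure ℝ) [IsProbabilityMeasure ν] {κ : Type*} [Fintype κ]
    {A : κ → Set ℝ} (hA : ∀ l, MeasurableSet (A l))
    (hdisj : Pairwise fun j l => Disjoint (A j) (A l)) (θ : κ → ℝ) :
    ∫ p, Complex.exp (Complex.I * ((∑ l, θ l * blockCount (A l) p : ℝ) : ℂ)) ∂(blockMeasure ν) =
      Complex.exp (∑ l, (ν (A l)).toReal * (Complex.exp (θ l * Complex.I) - 1)) := by
  classical
  set φ : ℝ → ℂ := fun x =>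
    Complex.exp (Complex.I * ((∑ l, θ l * (A l).indicator 1 x : ℝ) : ℂ)) with hφ
  have hmr : Measurable fun x => ∑ l, θ l * (A l).indicator (1 : ℝ → ℝ) x :=
    Finset.measurable_sum _ fun l _ => (measurable_one.indicator (hA l)).const_mul _
  have hφm : Measurable φ :=
    Complex.measurable_exp.comp ((Complex.measurable_ofReal.comp hmr).const_mul _)
  have hφ1 : ∀ x, ‖φ x‖ = 1 := fun x => Complex.norm_exp_I_mul_ofReal _
  have h1 : ∀ p : ℕ × (ℕ → ℝ),
      Complex.exp (Complex.I * ((∑ l, θ l * blockCount (A l) p : ℝ) : ℂ)) =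
        ∏ j ∈ Finset.range p.1, φ (p.2 j) := by
    intro p
    rw [← Complex.exp_sum, ← Finset.mul_sum, ← Complex.ofReal_sum, Finset.sum_comm]
    congr 3
    refine Finset.sum_congr rfl fun l _ => ?_
    rw [← Finset.mul_sum, blockCount]
    push_cast
    congr 1
    refine Finset.sum_congr rfl fun j _ => ?_
    by_cases h : p.2 j ∈ A l <;> simp [h]
  simp_rw [h1]
  rw [integral_prod_range_blockMeasure ν hφm hφ1]
  congr 1
  -- By disjointness `x` lies in at most one `A l`, which linearizes the exponential.
  have h2 : ∀ x, φ x = 1 + ∑ l, (A l).indicator (fun _ => Complex.exp (θ l * Complex.I) - 1) x := by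
    intro x
    by_cases hx : ∃ l, x ∈ A l
    · obtain ⟨l, hl⟩ := hx
      have hne : ∀ l', l' ≠ l → x ∉ A l' := fun l' hl' h =>
        Set.disjoint_left.1 (hdisj hl') h hl
      rw [hφ]
      simp only
      rw [Finset.sum_eq_single l, Finset.sum_eq_single l]
      · simp [hl, mul_comm]
      · exact fun l' _ hl' => Set.indicator_of_notMem (hne l' hl') _
      · simp
      · exact fun l' _ hl' => by rw [Set.indicator_of_notMem (hne l' hl'), mul_zero]
      · simp
    · push Not at hx
      rw [hφ]
      simp [hx]
  have h3 : ∀ l, Integrable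
      (fun x => (A l).indicator (fun _ => Complex.exp (θ l * Complex.I) - 1) x) ν :=
    fun l => (integrable_const _).indicator (hA l)
  simp_rw [h2]
  rw [integral_add (integrable_const _) (integrable_finsetSum _ fun l _ => h3 l),
    integral_finsetSum _ fun l _ => h3 l]
  simp only [integral_const, probReal_univ, one_smul, add_sub_cancel_left]
  refine Finset.sum_congr rfl fun l _ => ?_
  rw [integral_indicator (hA l), setIntegral_const, Complex.real_smul]
  rfl

variable (ν : ℕ → Measure ℝ) [∀ k, IsProbabilityMeasure (ν k)]

/-- The law of a sequence of independent blocks of points. -/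
noncomputable abbrev blocksMeasure : Measure (ℕ → ℕ × (ℕ → ℝ)) :=
  Measure.infinitePi fun k => blockMeasure (ν k)

/-- The number of points in `A` in the first `K` blocks. -/
noncomputable def partialCount (A : Set ℝ) (K : ℕ) (ω : ℕ → ℕ × (ℕ → ℝ)) : ℕ :=
  ∑ k ∈ Finset.range K, blockCount A (ω k)

lemma measurable_partialCount {A : Set ℝ} (hA : MeasurableSet A) (K : ℕ) :
    Measurable (partialCount A K) :=
  Finset.measurable_sum _ fun k _ => (measurable_blockCount hA).comp (measurable_pi_apply k)

/-- Independent blocks add the exponents over `k`. The factorization over `l` contains both the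
Poisson law of each count and the independence of the counts. -/
lemma integral_exp_partialCount {κ : Type*} [Fintype κ] {A : κ → Set ℝ}
    (hA : ∀ l, MeasurableSet (A l)) (hdisj : Pairwise fun j l => Disjoint (A j) (A l)) (θ : κ → ℝ)
    (K : ℕ) :
    ∫ ω, Complex.exp (Complex.I * ((∑ l, θ l * partialCount (A l) K ω : ℝ) : ℂ))
        ∂(blocksMeasure ν) =
      ∏ l, Complex.exp ((∑ k ∈ Finset.range K, (ν k (A l)).toReal : ℝ) *
        (Complex.exp (θ l * Complex.I) - 1)) := by
  have hfm : Measurable fun p : ℕ × (ℕ → ℝ) =>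
      Complex.exp (Complex.I * ((∑ l, θ l * blockCount (A l) p : ℝ) : ℂ)) := by
    refine Complex.measurable_exp.comp ((Complex.measurable_ofReal.comp ?_).const_mul _)
    exact Finset.measurable_sum _ fun l _ => ((measurable_from_top (f := fun n : ℕ => (n : ℝ))).comp
      (measurable_blockCount (hA l))).const_mul _
  have hind : iIndepFun (fun (k : ℕ) (ω : ℕ → ℕ × (ℕ → ℝ)) =>
      Complex.exp (Complex.I * ((∑ l, θ l * blockCount (A l) (ω k) : ℝ) : ℂ))) (blocksMeasure ν) :=
    iIndepFun_infinitePi (X := fun _ p =>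
      Complex.exp (Complex.I * ((∑ l, θ l * blockCount (A l) p : ℝ) : ℂ))) fun _ => hfm
  have h1 := (hind.precomp (g := fun j : Fin K => (j : ℕ))
      Fin.val_injective).integral_fun_prod_eq_prod_integral
      fun j => (hfm.comp (measurable_pi_apply _)).aestronglyMeasurable
  have h2 : ∀ ω : ℕ → ℕ × (ℕ → ℝ),
      Complex.exp (Complex.I * ((∑ l, θ l * partialCount (A l) K ω : ℝ) : ℂ)) =
      ∏ k : Fin K, Complex.exp (Complex.I * ((∑ l, θ l * blockCount (A l) (ω k) : ℝ) : ℂ)) := by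
    intro ω
    rw [← Complex.exp_sum, ← Finset.mul_sum, ← Complex.ofReal_sum, Finset.sum_comm]
    congr 3
    refine Finset.sum_congr rfl fun l _ => ?_
    rw [← Finset.mul_sum, partialCount, Finset.sum_range]
    push_cast
    rfl
  simp_rw [h2]
  rw [h1]
  have h3 : ∀ k : ℕ, ∫ ω : ℕ → ℕ × (ℕ → ℝ),
      Complex.exp (Complex.I * ((∑ l, θ l * blockCount (A l) (ω k) : ℝ) : ℂ)) ∂(blocksMeasure ν) =
      Complex.exp (∑ l, (ν k (A l)).toReal * (Complex.exp (θ l * Complex.I) - 1)) := by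
    intro k
    rw [← integral_exp_blockCount (ν k) hA hdisj θ]
    have := Measure.infinitePi_map_eval (fun k => blockMeasure (ν k)) k
    conv_rhs => rw [← this]
    rw [integral_map (measurable_pi_apply k).aemeasurable hfm.aestronglyMeasurable]
  simp_rw [h3]
  rw [← Complex.exp_sum, ← Complex.exp_sum, Finset.sum_comm]
  congr 1
  refine Finset.sum_congr rfl fun l _ => ?_
  rw [Finset.sum_range fun k => (ν k (A l)).toReal, Complex.ofReal_sum, Finset.sum_mul]

end PoissonConstruction

/-! ### Counts over infinitely many clusters -/

section PoissonConstruction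

/-- The codes of the points falling into `A`. -/
def pointSet (A : Set ℝ) (ω : ℕ → ℕ × (ℕ → ℝ)) : Set ℕ :=
  {m | m.unpair.2 < (ω m.unpair.1).1 ∧ (ω m.unpair.1).2 m.unpair.2 ∈ A}

lemma measurableSet_mem_pointSet {A : Set ℝ} (hA : MeasurableSet A) (m : ℕ) :
    MeasurableSet {ω | m ∈ pointSet A ω} := by
  have h1 : Measurable fun ω : ℕ → ℕ × (ℕ → ℝ) => (ω m.unpair.1).1 :=
    measurable_fst.comp (measurable_pi_apply _)
  have h2 : Measurable fun ω : ℕ → ℕ × (ℕ → ℝ) => (ω m.unpair.1).2 m.unpair.2 :=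
    (measurable_pi_apply _).comp (measurable_snd.comp (measurable_pi_apply _))
  exact (measurableSet_lt measurable_const h1).inter (h2 hA)

lemma measurable_encard_pointSet {A : Set ℝ} (hA : MeasurableSet A) :
    Measurable fun ω => (pointSet A ω).encard :=
  measurable_encard_setOf_mem fun m => measurableSet_mem_pointSet hA m

lemma encard_pointSet_lt (A : Set ℝ) (K : ℕ) (ω : ℕ → ℕ × (ℕ → ℝ)) :
    {m ∈ pointSet A ω | m.unpair.1 < K}.encard = partialCount A K ω := by
  classical
  set F : Finset (Σ _ : ℕ, ℕ) := (Finset.range K).sigma fun k =>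
    (Finset.range (ω k).1).filter fun j => (ω k).2 j ∈ A with hF
  have hset : {m ∈ pointSet A ω | m.unpair.1 < K} =
      (F.image fun q => Nat.pair q.1 q.2 : Finset ℕ) := by
    ext m
    simp only [Set.mem_ofPred_eq, pointSet, Finset.coe_image, Set.mem_image, Finset.mem_coe, hF,
      Finset.mem_sigma, Finset.mem_range, Finset.mem_filter]
    constructor
    · rintro ⟨⟨h1, h2⟩, h3⟩
      exact ⟨⟨m.unpair.1, m.unpair.2⟩, ⟨h3, h1, h2⟩, Nat.pair_unpair m⟩
    · rintro ⟨⟨k, j⟩, ⟨h3, h1, h2⟩, rfl⟩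
      simpa using ⟨⟨h1, h2⟩, h3⟩
  rw [hset, Set.encard_coe_eq_coe_finsetCard, Finset.card_image_of_injective, hF,
    Finset.card_sigma]
  · congr 1
    refine Finset.sum_congr rfl fun k _ => ?_
    rw [Finset.card_filter, blockCount]
    exact Finset.sum_congr rfl fun j _ => by simp [Set.indicator_apply]
  · rintro ⟨k, j⟩ ⟨k', j'⟩ h
    obtain ⟨rfl, rfl⟩ := Nat.pair_eq_pair.1 h
    rfl

/-- Transported to `ℝ≥0∞`, this is continuity from below of counting measure. -/
lemma tendsto_partialCount (A : Set ℝ) (ω : ℕ → ℕ × (ℕ → ℝ)) :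
    Tendsto (fun K => (partialCount A K ω : ℕ∞)) atTop (𝓝 (pointSet A ω).encard) := by
  rw [ENat.isClosedEmbedding_toENNReal.tendsto_nhds_iff]
  have hcount : ∀ s : Set ℕ, ENat.toENNReal s.encard = Measure.count s := fun s =>
    (Measure.count_apply (MeasurableSet.of_discrete)).symm
  have hU : pointSet A ω = ⋃ K, {m ∈ pointSet A ω | m.unpair.1 < K} := by
    ext m
    simp only [Set.mem_iUnion, Set.mem_ofPred_eq, exists_and_left]
    exact ⟨fun h => ⟨h, m.unpair.1 + 1, Nat.lt_succ_self _⟩, fun h => h.1⟩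
  have hmono : Monotone fun K => {m ∈ pointSet A ω | m.unpair.1 < K} :=
    fun K L hKL m hm => ⟨hm.1, hm.2.trans_le hKL⟩
  have h := tendsto_measure_iUnion_atTop (μ := (Measure.count : Measure ℕ)) hmono
  rw [← hU] at h
  simp_rw [← encard_pointSet_lt]
  refine Tendsto.congr (fun K => ?_) (h.trans_eq ?_)
  · exact (hcount _).symm
  · rw [hcount]

variable (ν : ℕ → Measure ℝ) [∀ k, IsProbabilityMeasure (ν k)]

lemma map_partialCount {A : Set ℝ} (hA : MeasurableSet A) (K : ℕ) :
    (blocksMeasure ν).map (fun ω => (partialCount A K ω : ℝ)) =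
      (poissonMeasure (∑ k ∈ Finset.range K, (ν k A).toNNReal)).map (Nat.cast : ℕ → ℝ) := by
  have hm : Measurable fun ω => (partialCount A K ω : ℝ) :=
    (measurable_from_top (f := fun n : ℕ => (n : ℝ))).comp (measurable_partialCount hA K)
  have : IsProbabilityMeasure ((blocksMeasure ν).map fun ω => (partialCount A K ω : ℝ)) :=
    Measure.isProbabilityMeasure_map hm.aemeasurable
  refine Measure.ext_of_charFun ?_
  ext x
  rw [charFun_map_cast_poissonMeasure, charFun_map_real hm.aemeasurable]
  have h := integral_exp_partialCount ν (κ := Unit) (A := fun _ => A) (fun _ => hA)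
    (fun i j hij => (hij (Subsingleton.elim _ _)).elim) (fun _ => x) K
  simp only [Finset.univ_unique, Finset.sum_singleton, Finset.prod_singleton] at h
  rw [h]
  congr 2
  push_cast
  rfl

lemma measure_partialCount_eq {A : Set ℝ} (hA : MeasurableSet A) (K c : ℕ) :
    blocksMeasure ν {ω | partialCount A K ω = c} =
      poissonMeasure (∑ k ∈ Finset.range K, (ν k A).toNNReal) {c} := by
  have hm : Measurable fun ω => (partialCount A K ω : ℝ) :=
    (measurable_from_top (f := fun n : ℕ => (n : ℝ))).comp (measurable_partialCount hA K)
  have h := congrArg (fun μ => μ {(c : ℝ)}) (map_partialCount ν hA K)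
  beta_reduce at h
  rw [Measure.map_apply hm (measurableSet_singleton _),
    Measure.map_apply measurable_from_top (measurableSet_singleton _)] at h
  convert h using 2
  · ext ω; simp
  · ext n; simp

lemma tendsto_poissonMeasure_singleton {r : ℕ → ℝ≥0} {r' : ℝ≥0} (h : Tendsto r atTop (𝓝 r'))
    (c : ℕ) : Tendsto (fun n => poissonMeasure (r n) {c}) atTop (𝓝 (poissonMeasure r' {c})) := by
  simp_rw [poissonMeasure_singleton]
  refine (ENNReal.continuous_ofReal.tendsto _).comp ?_
  exact ((by fun_prop : Continuous fun x : ℝ≥0 =>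
    Real.exp (-x) * (x : ℝ) ^ c / (c.factorial : ℝ)).tendsto r').comp h

/-- Finite values are isolated in `ℕ∞`, so for each `ω` the indicator of `partialCount = c` is
eventually that of the limiting event. -/
lemma tendsto_measure_partialCount {A : Set ℝ} (hA : MeasurableSet A) (c : ℕ) :
    Tendsto (fun K => blocksMeasure ν {ω | partialCount A K ω = c}) atTop
      (𝓝 (blocksMeasure ν {ω | (pointSet A ω).encard = c})) := by
  refine tendsto_measure_of_tendsto_indicator_of_isFiniteMeasure _ _
    (fun K => measurable_partialCount hA K (measurableSet_singleton c)) fun ω => ?_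
  have h := tendsto_partialCount A ω
  by_cases hc : (pointSet A ω).encard = c
  · rw [hc, ENat.nhds_natCast] at h
    filter_upwards [tendsto_pure.1 h] with K hK
    simpa [hc] using hK
  · filter_upwards [h.eventually_ne hc] with K hK
    simpa [hc] using hK

lemma measure_encard_pointSet_eq {A : Set ℝ} (hA : MeasurableSet A)
    (hfin : ∑' k, ν k A ≠ ∞) (c : ℕ) :
    blocksMeasure ν {ω | (pointSet A ω).encard = c} =
      poissonMeasure (∑' k, ν k A).toNNReal {c} := by
  refine tendsto_nhds_unique (tendsto_measure_partialCount ν hA c) ?_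
  simp_rw [measure_partialCount_eq ν hA]
  refine tendsto_poissonMeasure_singleton ?_ c
  have hsum : Summable fun k => (ν k A).toNNReal := ENNReal.summable_toNNReal_of_tsum_ne_top hfin
  have h := hsum.hasSum.tendsto_sum_nat
  rwa [← ENNReal.tsum_toNNReal_eq fun k => ENNReal.ne_top_of_tsum_ne_top hfin k] at h

/-- The first `K` blocks carry a Poisson(`K`) number of points, which takes any fixed value with
probability tending to zero. Infinitely many points are needed to label them by `ℕ`. -/
lemma ae_infinite_pointSet_univ : ∀ᵐ ω ∂(blocksMeasure ν), (pointSet Set.univ ω).Infinite := by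
  have h : ∀ c : ℕ, blocksMeasure ν {ω | (pointSet Set.univ ω).encard = c} = 0 := by
    intro c
    refine tendsto_nhds_unique (tendsto_measure_partialCount ν .univ c) ?_
    simp_rw [measure_partialCount_eq ν MeasurableSet.univ, poissonMeasure_singleton]
    rw [← ENNReal.ofReal_zero]
    refine (ENNReal.continuous_ofReal.tendsto _).comp ?_
    have h1 := ((Real.tendsto_pow_mul_exp_neg_atTop_nhds_zero c).comp
      tendsto_natCast_atTop_atTop).div_const (c.factorial : ℝ)
    rw [zero_div] at h1
    refine h1.congr fun K => ?_
    simp [mul_comm]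
  have h2 : ∀ᵐ ω ∂(blocksMeasure ν), ∀ c : ℕ, (pointSet Set.univ ω).encard ≠ c := by
    refine ae_all_iff.2 fun c => ?_
    rw [ae_iff]
    simpa using h c
  filter_upwards [h2] with ω hω hcon
  exact hω _ hcon.cast_ncard_eq.symm

lemma iIndepFun_partialCount {κ : Type*} [Fintype κ] {A : κ → Set ℝ}
    (hA : ∀ l, MeasurableSet (A l)) (hdisj : Pairwise fun j l => Disjoint (A j) (A l)) (K : ℕ) :
    iIndepFun (fun l ω => (partialCount (A l) K ω : ℝ)) (blocksMeasure ν) := by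
  have hm : ∀ l, Measurable fun ω => (partialCount (A l) K ω : ℝ) := fun l =>
    (measurable_from_top (f := fun n : ℕ => (n : ℝ))).comp (measurable_partialCount (hA l) K)
  rw [iIndepFun_iff_charFun_pi fun l => (hm l).aemeasurable]
  intro θ
  rw [charFun_map_toLp_eq_integral hm, integral_exp_partialCount ν hA hdisj]
  refine Finset.prod_congr rfl fun l _ => ?_
  rw [map_partialCount ν (hA l), charFun_map_cast_poissonMeasure]
  congr 2
  push_cast
  rfl

/-- A bounded continuous injective encoding of extended natural numbers. -/
noncomputable def countCode (c : ℕ∞) : ℝ := ((1 + (c : ℝ≥0∞))⁻¹).toReal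

lemma countCode_natCast (n : ℕ) : countCode n = (1 + (n : ℝ))⁻¹ := by
  rw [countCode, ENNReal.toReal_inv, ENat.toENNReal_coe, ENNReal.toReal_add (by simp) (by simp)]
  simp

lemma continuous_countCode : Continuous countCode := by
  refine continuous_iff_continuousAt.2 fun c => ?_
  refine (ENNReal.tendsto_toReal (by simp)).comp ?_
  exact ((continuous_const.add ENat.continuous_toENNReal).inv).continuousAt

lemma injective_countCode : Function.Injective countCode := by
  intro c d h
  have h1 := (ENNReal.toReal_eq_toReal_iff' (by simp) (by simp)).1 h
  rw [inv_inj, ENNReal.add_right_inj ENNReal.one_ne_top] at h1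
  exact ENat.toENNReal_strictMono.injective h1

/-- The limit theorem for independence concerns real variables. Encoding by `countCode` keeps the
convergence, by continuity, and loses no information, by injectivity on a countable space. -/
lemma iIndepFun_encard_pointSet {κ : Type*} [Fintype κ] {A : κ → Set ℝ}
    (hA : ∀ l, MeasurableSet (A l)) (hdisj : Pairwise fun j l => Disjoint (A j) (A l)) :
    iIndepFun (fun l ω => (pointSet (A l) ω).encard) (blocksMeasure ν) := by
  have hcm : Measurable countCode := measurable_from_top
  have hY : ∀ l, Measurable fun ω => countCode (pointSet (A l) ω).encard :=
    fun l => hcm.comp (measurable_encard_pointSet (hA l))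
  have hX : ∀ K l, Measurable fun ω => (1 + (partialCount (A l) K ω : ℝ))⁻¹ := fun K l =>
    ((((measurable_from_top (f := fun n : ℕ => (n : ℝ))).comp
      (measurable_partialCount (hA l) K))).const_add 1).inv
  have h : iIndepFun (fun l ω => countCode (pointSet (A l) ω).encard) (blocksMeasure ν) := by
    refine iIndepFun_of_tendsto (X := fun K l ω => (1 + (partialCount (A l) K ω : ℝ))⁻¹) hX hY
      (fun l ω => ?_) fun K => (iIndepFun_partialCount ν hA hdisj K).comp
        (fun _ x => (1 + x)⁻¹) fun _ => by fun_prop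
    simp_rw [← countCode_natCast]
    exact (continuous_countCode.tendsto _).comp (tendsto_partialCount (A l) ω)
  rw [iIndepFun_iff_measure_inter_preimage_eq_mul] at h ⊢
  intro s t _
  have hpre : ∀ l, (fun ω => (pointSet (A l) ω).encard) ⁻¹' t l =
      (fun ω => countCode (pointSet (A l) ω).encard) ⁻¹' (countCode '' t l) := by
    intro l
    ext ω
    simp [injective_countCode.mem_set_image]
  simp_rw [hpre]
  exact h s fun l _ => ((Set.to_countable (t l)).image countCode).measurableSet

end PoissonConstruction

/-! ### Existence of the Poisson process -/

section PoissonExistence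

/-- The `i`-th point in the enumeration of all present points by increasing code. -/
noncomputable def labelledPoint (i : ℕ) (ω : ℕ → ℕ × (ℕ → ℝ)) : ℝ :=
  (ω (Nat.nth (fun m => m ∈ pointSet Set.univ ω) i).unpair.1).2
    (Nat.nth (fun m => m ∈ pointSet Set.univ ω) i).unpair.2

lemma count_labelledPoint {ω : ℕ → ℕ × (ℕ → ℝ)} (hω : (pointSet Set.univ ω).Infinite) (A : Set ℝ) :
    count labelledPoint A ω = (pointSet A ω).encard := by
  set p : ℕ → Prop := fun m => m ∈ pointSet Set.univ ω with hp
  have hinf : (Set.ofPred p).Infinite := hω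
  rw [count, ← (Nat.nth_injective hinf).encard_image]
  congr 1
  ext m
  simp only [Set.mem_image, Set.mem_ofPred_eq]
  constructor
  · rintro ⟨i, hi, rfl⟩
    exact ⟨(Nat.nth_mem_of_infinite hinf i).1, hi⟩
  · intro hm
    have hpm : p m := ⟨hm.1, trivial⟩
    classical
    refine ⟨Nat.count p m, ?_, Nat.nth_count hpm⟩
    change (ω (Nat.nth p _).unpair.1).2 (Nat.nth p _).unpair.2 ∈ A
    rw [Nat.nth_count hpm]
    exact hm.2

lemma exists_measurable_labelledPoint {P : Measure (ℕ → ℕ × (ℕ → ℝ))}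
    (hP : ∀ᵐ ω ∂P, (pointSet Set.univ ω).Infinite) :
    ∃ U : ℕ → (ℕ → ℕ × (ℕ → ℝ)) → ℝ, (∀ i, Measurable (U i)) ∧
      ∀ᵐ ω ∂P, ∀ i, labelledPoint i ω = U i ω := by
  classical
  set c : ℕ → (ℕ → ℕ × (ℕ → ℝ)) → ℕ := fun m ω =>
    ∑ m' ∈ Finset.range m, {ω | m' ∈ pointSet Set.univ ω}.indicator 1 ω with hc
  have hcm : ∀ m, Measurable (c m) := fun m => Finset.measurable_sum _ fun m' _ =>
    measurable_one.indicator (measurableSet_mem_pointSet .univ m')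
  set q₀ : ℕ → ℕ → (ℕ → ℕ × (ℕ → ℝ)) → Prop := fun i m ω =>
    m ∈ pointSet Set.univ ω ∧ c m ω = i with hq₀
  have hq₀m : ∀ i m, MeasurableSet {ω | q₀ i m ω} := fun i m =>
    (measurableSet_mem_pointSet .univ m).inter (hcm m (measurableSet_singleton i))
  -- `q₀ i m` says that `m` codes a present point with exactly `i` predecessors. The second
  -- alternative makes the search for `m` succeed when there is no such point, so that the selection
  -- is measurable everywhere.
  set q : ℕ → ℕ → (ℕ → ℕ × (ℕ → ℝ)) → Prop := fun i m ω => q₀ i m ω ∨ ¬ ∃ m', q₀ i m' ω with hq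
  have hqm : ∀ i m, MeasurableSet {ω | q i m ω} := fun i m => by
    have h1 : MeasurableSet {ω | ∃ m', q₀ i m' ω} := by
      rw [Set.ofPred_exists]
      exact MeasurableSet.iUnion fun m' => hq₀m i m'
    exact (hq₀m i m).union h1.compl
  have hex : ∀ i ω, ∃ m, q i m ω := fun i ω => by
    by_cases h : ∃ m', q₀ i m' ω
    · exact h.imp fun m hm => Or.inl hm
    · exact ⟨0, Or.inr h⟩
  refine ⟨fun i ω => (ω (Nat.find (hex i ω)).unpair.1).2 (Nat.find (hex i ω)).unpair.2,
    fun i => ?_, ?_⟩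
  · exact Measurable.find (f := fun m (ω : ℕ → ℕ × (ℕ → ℝ)) => (ω m.unpair.1).2 m.unpair.2)
      (fun m => (measurable_pi_apply _).comp (measurable_snd.comp (measurable_pi_apply _)))
      (hqm i) (hex i)
  · filter_upwards [hP] with ω hω i
    set p : ℕ → Prop := fun m => m ∈ pointSet Set.univ ω with hp
    have hinf : (Set.ofPred p).Infinite := hω
    have hcount : ∀ m, c m ω = Nat.count p m := fun m => by
      rw [Nat.count_eq_card_filter_range, Finset.card_filter, hc]
      exact Finset.sum_congr rfl fun m' _ => by simp [Set.indicator_apply, hp]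
    have hnth : q₀ i (Nat.nth p i) ω :=
      ⟨Nat.nth_mem_of_infinite hinf i, by rw [hcount, Nat.count_nth_of_infinite hinf]⟩
    have huniq : ∀ m, q₀ i m ω → m = Nat.nth p i := fun m h => by
      rw [← h.2, hcount, Nat.nth_count h.1]
    have hfind : Nat.find (hex i ω) = Nat.nth p i := by
      rcases Nat.find_spec (hex i ω) with h | h
      · exact huniq _ h
      · exact (h ⟨_, hnth⟩).elim
    simp only [hfind]
    rfl

/-- Existence of Poisson processes with intensity a sum of infinitely many probability measures. -/
lemma exists_isPoissonProcess (ν : ℕ → Measure ℝ) [∀ k, IsProbabilityMeasure (ν k)]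
    {μ : Measure ℝ} (hμ : ∀ A, MeasurableSet A → ∑' k, ν k A = μ A) :
    ∃ U : ℕ → (ℕ → ℕ × (ℕ → ℝ)) → ℝ, IsPoissonProcess U μ (blocksMeasure ν) := by
  have hinf := ae_infinite_pointSet_univ ν
  obtain ⟨U, hUm, hU⟩ := exists_measurable_labelledPoint hinf
  have hcount : ∀ᵐ ω ∂(blocksMeasure ν), ∀ A, count U A ω = (pointSet A ω).encard := by
    filter_upwards [hinf, hU] with ω h1 h2 A
    rw [← count_labelledPoint h1 A, count, count]
    simp_rw [h2]
  refine ⟨U, hUm, fun A hA hfin c => ?_, fun m A hA hdisj => ?_⟩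
  · have h := measure_encard_pointSet_eq ν hA (by rwa [hμ A hA]) c
    rw [hμ A hA] at h
    rw [← h]
    refine measure_congr ?_
    filter_upwards [hcount] with ω hω
    refine propext ?_
    change count U A ω = c ↔ (pointSet A ω).encard = c
    rw [hω]
  · refine (iIndepFun_encard_pointSet ν hA hdisj).congr fun j => ?_
    filter_upwards [hcount] with ω hω
    exact (hω (A j)).symm

lemma expIntensity_Ioi (a : ℝ) : expIntensity (Set.Ioi a) = ENNReal.ofReal (Real.exp (-a)) := by
  rw [expIntensity, withDensity_apply _ measurableSet_Ioi, lintegral_Ioi_exp_neg]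

/-- Layers of unit mass for the intensity `e^{-u} du`. -/
def expLayer (k : ℕ) : Set ℝ := {u | ⌊Real.exp (-u)⌋₊ = k}

lemma measurableSet_expLayer (k : ℕ) : MeasurableSet (expLayer k) := by
  have h : Measurable fun u : ℝ => ⌊Real.exp (-u)⌋₊ :=
    Nat.measurable_floor.comp (by fun_prop)
  exact h (measurableSet_singleton k)

/-- For `k ≥ 1` the layer is `(-log (k + 1), -log k]`, of mass `(k + 1) - k`; for `k = 0` it is `(0,
∞)`. -/
lemma expIntensity_expLayer (k : ℕ) : expIntensity (expLayer k) = 1 := by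
  rcases Nat.eq_zero_or_pos k with rfl | hk
  · have : expLayer 0 = Set.Ioi 0 := by
      ext u
      simp [expLayer, Nat.floor_eq_zero]
    rw [this, expIntensity_Ioi]
    simp
  · have hk' : (0 : ℝ) < k := Nat.cast_pos.2 hk
    have hk1 : (0 : ℝ) < k + 1 := by positivity
    have : expLayer k = Set.Ioi (-Real.log (k + 1)) \ Set.Ioi (-Real.log k) := by
      ext u
      rw [expLayer, Set.mem_ofPred_eq, Nat.floor_eq_iff (Real.exp_pos _).le, Set.mem_sdiff,
        Set.mem_Ioi, Set.mem_Ioi, not_lt, ← Real.log_le_iff_le_exp hk', ← Real.lt_log_iff_exp_lt hk1]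
      constructor <;> rintro ⟨h1, h2⟩ <;> constructor <;> linarith
    rw [this, measure_sdiff _ measurableSet_Ioi.nullMeasurableSet, expIntensity_Ioi,
      expIntensity_Ioi, neg_neg, neg_neg, Real.exp_log hk1, Real.exp_log hk',
      ← ENNReal.ofReal_sub _ hk'.le]
    · simp
    · rw [expIntensity_Ioi]; simp
    · refine Set.Ioi_subset_Ioi (neg_le_neg (Real.log_le_log hk' (by linarith)))

lemma exists_isPoissonProcess_expIntensity :
    ∃ (Ω : Type) (_ : MeasurableSpace Ω) (P : Measure Ω) (_ : IsProbabilityMeasure P)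
      (U : ℕ → Ω → ℝ), IsPoissonProcess U expIntensity P := by
  set ν : ℕ → Measure ℝ := fun k => expIntensity.restrict (expLayer k) with hν
  have hprob : ∀ k, IsProbabilityMeasure (ν k) := fun k => ⟨by
    rw [hν, Measure.restrict_apply_univ, expIntensity_expLayer]⟩
  have hsum : ∀ A, MeasurableSet A → ∑' k, ν k A = expIntensity A := by
    intro A hA
    have hU : A = ⋃ k, A ∩ expLayer k := by
      ext u
      simp [expLayer]
    conv_rhs => rw [hU]
    rw [measure_iUnion]
    · exact tsum_congr fun k => Measure.restrict_apply hA
    · intro j k hjk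
      refine Set.disjoint_left.2 fun u hu hu' => hjk ?_
      rw [← hu.2, ← hu'.2]
    · exact fun k => hA.inter (measurableSet_expLayer k)
  obtain ⟨U, hU⟩ := exists_isPoissonProcess ν hsum
  exact ⟨_, inferInstance, _, inferInstance, U, hU⟩

end PoissonExistence

/-! ### Transport along measure-preserving maps -/

section MeasurePreserving

variable {Ω Ω' : Type*} [MeasurableSpace Ω] [MeasurableSpace Ω'] {P : Measure Ω}
  {P' : Measure Ω'} {f : Ω' → Ω}

lemma iIndepFun_comp_measurePreserving {ι : Type*} {β : ι → Type*} [∀ i, MeasurableSpace (β i)]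
    {X : ∀ i, Ω → β i} (hX : iIndepFun X P) (hXm : ∀ i, Measurable (X i))
    (hf : MeasurePreserving f P' P) : iIndepFun (fun i ω => X i (f ω)) P' := by
  rw [iIndepFun_iff_measure_inter_preimage_eq_mul] at hX ⊢
  intro S A hA
  have h1 := hX S hA
  rw [← hf.measure_preimage (Finset.measurableSet_biInter _ fun i hi =>
    hXm i (hA i hi)).nullMeasurableSet, Set.preimage_iInter₂] at h1
  refine h1.trans (Finset.prod_congr rfl fun i hi => ?_)
  exact (hf.measure_preimage (hXm i (hA i hi)).nullMeasurableSet).symm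

lemma indepFun_comp_measurePreserving {β γ : Type*} [MeasurableSpace β] [MeasurableSpace γ]
    {X : Ω → β} {Y : Ω → γ} (hXY : IndepFun X Y P) (hX : Measurable X) (hY : Measurable Y)
    (hf : MeasurePreserving f P' P) : IndepFun (fun ω => X (f ω)) (fun ω => Y (f ω)) P' := by
  rw [indepFun_iff_measure_inter_preimage_eq_mul] at hXY ⊢
  intro A B hA hB
  have h1 := hXY A B hA hB
  rw [← hf.measure_preimage ((hX hA).inter (hY hB)).nullMeasurableSet,
    ← hf.measure_preimage (hX hA).nullMeasurableSet,
    ← hf.measure_preimage (hY hB).nullMeasurableSet] at h1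
  exact h1

lemma identDistrib_comp_measurePreserving {β : Type*} [MeasurableSpace β] {X Y : Ω → β}
    (hXY : IdentDistrib X Y P P) (hX : Measurable X) (hY : Measurable Y)
    (hf : MeasurePreserving f P' P) :
    IdentDistrib (fun ω => X (f ω)) (fun ω => Y (f ω)) P' P' where
  aemeasurable_fst := (hX.comp hf.measurable).aemeasurable
  aemeasurable_snd := (hY.comp hf.measurable).aemeasurable
  map_eq := by
    have h1 := Measure.map_map (μ := P') hX hf.measurable
    have h2 := Measure.map_map (μ := P') hY hf.measurable
    rw [hf.map_eq] at h1 h2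
    exact h1.symm.trans (hXY.map_eq.trans h2)

lemma IsPoissonProcess.comp_measurePreserving {U : ℕ → Ω → ℝ} {μ : Measure ℝ}
    (hU : IsPoissonProcess U μ P) (hf : MeasurePreserving f P' P) :
    IsPoissonProcess (fun i ω => U i (f ω)) μ P' where
  measurable i := (hU.measurable i).comp hf.measurable
  count_law A hA hμA k := by
    rw [← hU.count_law A hA hμA k]
    exact hf.measure_preimage
      (hU.measurable_count hA (measurableSet_singleton (k : ℕ∞))).nullMeasurableSet
  count_indep m A hA hdisj :=
    iIndepFun_comp_measurePreserving (X := fun j => count U (A j))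
      (hU.count_indep m A hA hdisj) (fun j => hU.measurable_count (hA j)) hf

lemma HasIncrementalVariance.comp_measurePreserving {S : Type*} {W : S → Ω → ℝ} {Γ : S → S → ℝ}
    (hW : HasIncrementalVariance W Γ P) (hWm : ∀ t, Measurable (W t))
    (hf : MeasurePreserving f P' P) : HasIncrementalVariance (fun t ω => W t (f ω)) Γ P' where
  gaussian := ⟨fun I => ⟨by
    have h1 := (hW.gaussian.hasGaussianLaw I).isGaussian_map
    have h2 : Measurable fun ω => I.restrict fun t => W t ω :=
      measurable_pi_lambda _ fun t => hWm t
    rw [← hf.map_eq, Measure.map_map h2 hf.measurable] at h1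
    exact h1⟩⟩
  mean_zero t := by
    have h1 := hW.mean_zero t
    rwa [← hf.map_eq, integral_map hf.measurable.aemeasurable
      (hWm t).aestronglyMeasurable] at h1
  incr s t := (hf.variance_fun_comp (f := fun ω => W s ω - W t ω)
    ((hWm s).sub (hWm t)).aemeasurable).trans (hW.incr s t)

lemma IsGaussPoissonMax.comp_measurePreserving {S : Type*} {Γ : S → S → ℝ} {M : S → Ω → ℝ}
    (hM : IsGaussPoissonMax Γ M P) (hf : MeasurePreserving f P' P) :
    IsGaussPoissonMax Γ (fun t ω => M t (f ω)) P' := by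
  obtain ⟨U, W, hU, hWm, hW, hid, hind, hUW, hmax⟩ := hM
  have hm : ∀ i, Measurable fun ω t => W i t ω := fun i => measurable_pi_lambda _ (hWm i)
  refine ⟨fun i ω => U i (f ω), fun i t ω => W i t (f ω), hU.comp_measurePreserving hf,
    fun i t => (hWm i t).comp hf.measurable, hW.comp_measurePreserving (hWm 0) hf,
    fun i => identDistrib_comp_measurePreserving (hid i) (hm i) (hm 0) hf,
    iIndepFun_comp_measurePreserving hind hm hf,
    indepFun_comp_measurePreserving hUW (measurable_pi_lambda _ hU.measurable)
      (measurable_pi_lambda _ hm) hf, fun t => ?_⟩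
  rw [hf.variance_fun_comp (hWm 0 t).aemeasurable]
  exact hf.quasiMeasurePreserving.ae (hmax t)

end MeasurePreserving

/-! ### Attainment of the maximum -/

section Maximum

variable {Ω : Type*} [MeasurableSpace Ω] {P : Measure Ω} {U : ℕ → Ω → ℝ} {μ : Measure ℝ}

lemma tsum_mul_poissonMeasure (l : ℝ≥0) : ∑' k : ℕ, (k : ℝ≥0∞) * poissonMeasure l {k} = l := by
  have hsucc : ∀ k : ℕ, ((k + 1 : ℕ) : ℝ≥0∞) * poissonMeasure l {k + 1} =
      l * poissonMeasure l {k} := by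
    intro k
    rw [poissonMeasure_singleton, poissonMeasure_singleton, ← ENNReal.ofReal_natCast,
      ← ENNReal.ofReal_mul (by positivity), ← ENNReal.ofReal_coe_nnreal,
      ← ENNReal.ofReal_mul (by positivity)]
    congr 1
    rw [Nat.factorial_succ]
    push_cast
    field_simp
    ring
  rw [tsum_eq_zero_add' ENNReal.summable]
  simp_rw [hsucc]
  rw [ENNReal.tsum_mul_left, Nat.cast_zero, zero_mul, zero_add]
  have h1 : ∑' k : ℕ, poissonMeasure l {k} = 1 := by
    rw [← measure_iUnion (fun i j hij => by simpa using hij) fun _ => measurableSet_singleton _,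
      Set.iUnion_of_singleton, measure_univ]
  rw [h1, mul_one]

/-- The left side is the mean number of points in `A`. An inequality suffices for Borel–Cantelli and
makes the case of infinite mass trivial. -/
lemma IsPoissonProcess.tsum_measure_mem_le (hU : IsPoissonProcess U μ P) {A : Set ℝ}
    (hA : MeasurableSet A) : ∑' i, P (U i ⁻¹' A) ≤ μ A := by
  by_cases hμA : μ A = ∞
  · exact hμA ▸ le_top
  have h1 : ∀ i, P (U i ⁻¹' A) = ∫⁻ ω, (U i ⁻¹' A).indicator 1 ω ∂P := fun i =>
    (lintegral_indicator_one (hU.measurable i hA)).symm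
  simp_rw [h1]
  rw [← lintegral_tsum fun i => (measurable_one.indicator (hU.measurable i hA)).aemeasurable]
  have h2 : ∫⁻ ω, ∑' i, (U i ⁻¹' A).indicator 1 ω ∂P =
      ∫⁻ ω, ((count U A ω).toNat : ℝ≥0∞) ∂P := by
    refine lintegral_congr_ae ?_
    filter_upwards [hU.ae_count_ne_top hA hμA] with ω hω
    have h3 : ∀ i, (U i ⁻¹' A).indicator (1 : Ω → ℝ≥0∞) ω =
        {i : ℕ | U i ω ∈ A}.indicator (fun _ => 1) i := fun i => rfl
    simp_rw [h3]
    rw [← tsum_subtype, ENNReal.tsum_set_one]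
    change ((count U A ω : ℕ∞) : ℝ≥0∞) = _
    lift count U A ω to ℕ using hω with c
    simp
  rw [h2, hU.lintegral_comp_count hA hμA fun k => (k : ℝ≥0∞), tsum_mul_poissonMeasure,
    ENNReal.coe_toNNReal hμA]

/-- With the mark fixed at `x`, the expected number of points above `y - x` is at most `e^{x - y}`;
then integrate over the common law of the marks. -/
lemma IsPoissonProcess.tsum_measure_lt_add_le [IsProbabilityMeasure P]
    (hU : IsPoissonProcess U expIntensity P)
    {ξ : ℕ → Ω → ℝ} (hξ : ∀ i, Measurable (ξ i)) {ρ : Measure ℝ} [IsProbabilityMeasure ρ]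
    (hρ : ∀ i, P.map (ξ i) = ρ)
    (hind : ∀ i, IndepFun (U i) (ξ i) P) (y : ℝ) :
    ∑' i, P {ω | y < U i ω + ξ i ω} ≤
      ENNReal.ofReal (Real.exp (-y)) * ∫⁻ x, ENNReal.ofReal (Real.exp x) ∂ρ := by
  have hA : MeasurableSet {p : ℝ × ℝ | y < p.1 + p.2} :=
    measurableSet_lt measurable_const (by fun_prop)
  have h1 : ∀ i, P {ω | y < U i ω + ξ i ω} = ∫⁻ x, P (U i ⁻¹' Set.Ioi (y - x)) ∂ρ := by
    intro i
    have : IsProbabilityMeasure (P.map (U i)) :=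
      Measure.isProbabilityMeasure_map (hU.measurable i).aemeasurable
    have h2 := (indepFun_iff_map_prod_eq_prod_map_map (hU.measurable i).aemeasurable
      (hξ i).aemeasurable).1 (hind i)
    have h3 := congrArg (fun m => m {p : ℝ × ℝ | y < p.1 + p.2}) h2
    beta_reduce at h3
    rw [Measure.map_apply ((hU.measurable i).prodMk (hξ i)) hA, hρ,
      Measure.prod_apply_symm hA] at h3
    refine h3.trans (lintegral_congr fun x => ?_)
    rw [← Measure.map_apply (hU.measurable i) measurableSet_Ioi]
    congr 1
    ext a
    simp [sub_lt_iff_lt_add]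
  simp_rw [h1]
  have hm : ∀ i, Measurable fun x => P (U i ⁻¹' Set.Ioi (y - x)) := by
    intro i
    refine Monotone.measurable fun a b hab => measure_mono ?_
    exact Set.preimage_mono (Set.Ioi_subset_Ioi (by linarith))
  rw [← lintegral_tsum fun i => (hm i).aemeasurable,
    ← lintegral_const_mul _ (by fun_prop)]
  refine lintegral_mono fun x => ?_
  refine (hU.tsum_measure_mem_le measurableSet_Ioi).trans_eq ?_
  rw [expIntensity_Ioi, ← ENNReal.ofReal_mul (Real.exp_pos _).le, ← Real.exp_add]
  congr 2
  ring

lemma isGreatest_range_iSup {Z : ℕ → ℝ} (hZ : ∀ n : ℕ, {i | -(n : ℝ) < Z i}.Finite) :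
    IsGreatest (Set.range Z) (⨆ i, Z i) := by
  obtain ⟨n, hn⟩ := exists_nat_gt (-Z 0)
  have h0 : (0 : ℕ) ∈ {i | -(n : ℝ) < Z i} := by
    change -(n : ℝ) < Z 0
    linarith
  obtain ⟨i, hi, hmax⟩ := Set.exists_max_image _ Z (hZ n) ⟨0, h0⟩
  have h : IsGreatest (Set.range Z) (Z i) := by
    refine ⟨⟨i, rfl⟩, ?_⟩
    rintro _ ⟨j, rfl⟩
    by_cases hj : j ∈ {i | -(n : ℝ) < Z i}
    · exact hmax j hj
    · exact (not_lt.1 hj).trans hi.le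
  rw [iSup, h.csSup_eq]
  exact h

/-- By Borel–Cantelli, almost surely only finitely many terms lie above each level `-n`, so the
supremum is attained. -/
lemma IsPoissonProcess.ae_isGreatest [IsProbabilityMeasure P]
    (hU : IsPoissonProcess U expIntensity P)
    {ξ : ℕ → Ω → ℝ} (hξ : ∀ i, Measurable (ξ i)) {ρ : Measure ℝ} [IsProbabilityMeasure ρ]
    (hρ : ∀ i, P.map (ξ i) = ρ) (hind : ∀ i, IndepFun (U i) (ξ i) P)
    (hexp : ∫⁻ x, ENNReal.ofReal (Real.exp x) ∂ρ ≠ ∞) :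
    ∀ᵐ ω ∂P, IsGreatest (Set.range fun i => U i ω + ξ i ω) (⨆ i, (U i ω + ξ i ω)) := by
  have h : ∀ n : ℕ, ∀ᵐ ω ∂P, {i | -(n : ℝ) < U i ω + ξ i ω}.Finite := fun n =>
    ae_finite_setOfPred_mem (s := fun i => {ω | -(n : ℝ) < U i ω + ξ i ω})
      (ne_top_of_le_ne_top (ENNReal.mul_ne_top ENNReal.ofReal_ne_top hexp)
        (hU.tsum_measure_lt_add_le hξ hρ hind _))
  filter_upwards [ae_all_iff.2 h] with ω hω
  exact isGreatest_range_iSup hω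

end Maximum

/-! ### Existence of the limit process -/

section Existence

/-- The Poisson process and an i.i.d. sequence of Gaussian paths live on a product space. The
maximum is attained because the drifted marks have exponential moment one. -/
lemma exists_isGaussPoissonMax {S : Type u} {Γ : S → S → ℝ} (hΓ : IsNegDef Γ) [Nonempty S] :
    ∃ (Ω : Type u) (_ : MeasurableSpace Ω) (P : Measure Ω) (_ : IsProbabilityMeasure P)
      (M : S → Ω → ℝ), (∀ t, Measurable (M t)) ∧ IsGaussPoissonMax Γ M P := by
  obtain ⟨Ω₁, _, P₁, _, W, hWm, hW⟩ := exists_hasIncrementalVariance hΓ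
  obtain ⟨Ω₂, _, P₂, _, U, hU⟩ := exists_isPoissonProcess_expIntensity
  set Q : Measure (ℕ → Ω₁) := Measure.infinitePi fun _ => P₁ with hQ
  have hfst : MeasurePreserving Prod.fst (Q.prod P₂) Q := measurePreserving_fst
  have hsnd : MeasurePreserving Prod.snd (Q.prod P₂) P₂ := measurePreserving_snd
  have hev : ∀ i : ℕ, MeasurePreserving (fun ω : (ℕ → Ω₁) × Ω₂ => ω.1 i) (Q.prod P₂) P₁ :=
    fun i => (measurePreserving_eval_infinitePi (fun _ => P₁) i).comp hfst
  have hWp : Measurable fun ω t => W t ω := measurable_pi_lambda _ hWm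
  have hU' := hU.comp_measurePreserving hsnd
  have hWi : ∀ i t, Measurable fun ω : (ℕ → Ω₁) × Ω₂ => W t (ω.1 i) := fun i t =>
    (hWm t).comp (hev i).measurable
  have hUW : IndepFun (fun (ω : (ℕ → Ω₁) × Ω₂) i => U i ω.2) (fun ω i t => W t (ω.1 i))
      (Q.prod P₂) := by
    refine (indepFun_prod (X := fun (ω : ℕ → Ω₁) i t => W t (ω i)) (Y := fun ω i => U i ω)
      (measurable_pi_lambda _ fun i => hWp.comp (measurable_pi_apply i))
      (measurable_pi_lambda _ hU.measurable)).symm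
  have hvar : ∀ t, Var[fun ω : (ℕ → Ω₁) × Ω₂ => W t (ω.1 0); Q.prod P₂] = Var[W t; P₁] :=
    fun t => (hev 0).variance_fun_comp (hWm t).aemeasurable
  refine ⟨(ℕ → Ω₁) × Ω₂, inferInstance, Q.prod P₂, inferInstance,
    fun t ω => ⨆ i, (U i ω.2 + (W t (ω.1 i) - Var[W t; P₁] / 2)),
    fun t => Measurable.iSup fun i => (hU'.measurable i).add ((hWi i t).sub_const _),
    fun i ω => U i ω.2, fun i t ω => W t (ω.1 i), hU', hWi,
    hW.comp_measurePreserving hWm (hev 0), fun i => ?_, ?_, hUW, fun t => ?_⟩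
  · refine ⟨(hWp.comp (hev i).measurable).aemeasurable, (hWp.comp (hev 0).measurable).aemeasurable,
      ?_⟩
    have h1 := Measure.map_map (μ := Q.prod P₂) hWp (hev i).measurable
    have h2 := Measure.map_map (μ := Q.prod P₂) hWp (hev 0).measurable
    rw [(hev _).map_eq] at h1 h2
    exact h1.symm.trans h2
  · exact iIndepFun_comp_measurePreserving
      (iIndepFun_infinitePi (P := fun _ : ℕ => P₁) (X := fun _ ω t => W t ω) fun _ => hWp)
      (fun i => hWp.comp (measurable_pi_apply i)) hfst
  · have hD : Measurable fun ω => W t ω - Var[W t; P₁] / 2 := (hWm t).sub_const _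
    have : IsProbabilityMeasure (P₁.map fun ω => W t ω - Var[W t; P₁] / 2) :=
      Measure.isProbabilityMeasure_map hD.aemeasurable
    have h1 := hU'.ae_isGreatest (ξ := fun i ω => W t (ω.1 i) - Var[W t; P₁] / 2)
      (fun i => (hWi i t).sub_const _) (ρ := P₁.map fun ω => W t ω - Var[W t; P₁] / 2)
      (fun i => ?_) (fun i => ?_) ?_
    · rw [hvar]
      simp_rw [add_sub_assoc]
      exact h1
    · have h2 := Measure.map_map (μ := Q.prod P₂) hD (hev i).measurable
      rw [(hev i).map_eq] at h2
      exact h2.symm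
    · exact hUW.comp (φ := fun v : ℕ → ℝ => v i)
        (ψ := fun v : ℕ → S → ℝ => v i t - Var[W t; P₁] / 2) (by fun_prop) (by fun_prop)
    · rw [lintegral_map (by fun_prop) hD,
        lintegral_exp_sub_variance (hW.gaussian.hasGaussianLaw_eval t) (hW.mean_zero t)]
      exact ENNReal.one_ne_top

lemma IsExtNegDef.exists_isLimitProcess {T : Type u} {Γ : T → T → ℝ≥0∞} {s : Setoid T}
    (hΓ : IsExtNegDef Γ s) :
    ∃ (Ω' : Type u) (_ : MeasurableSpace Ω') (P' : Measure Ω') (_ : IsProbabilityMeasure P')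
      (M : T → Ω' → ℝ), IsLimitProcess Γ M P' := by
  have hne : ∀ q : Quotient s, Nonempty (Block s q) := fun q => by
    obtain ⟨t, ht⟩ := q.exists_rep
    exact ⟨⟨t, ht⟩⟩
  choose Ω mΩ P hP M hMm hM using fun q => exists_isGaussPoissonMax (hΓ.negDef q)
  -- On the block of `q`, the class computed from `t` is `q` only up to a propositional equality;
  -- eliminating that equality restores the `q`-th coordinate.
  have hMq : ∀ (q : Quotient s) (t : Block s q) (ω : ∀ q, Ω q),
      M (Quotient.mk s t) ⟨t, rfl⟩ (ω (Quotient.mk s t)) = M q t (ω q) := by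
    rintro _ ⟨t, rfl⟩ ω
    rfl
  refine ⟨∀ q, Ω q, inferInstance, Measure.infinitePi P, inferInstance,
    fun t ω => M (Quotient.mk s t) ⟨t, rfl⟩ (ω (Quotient.mk s t)),
    fun t => (hMm _ _).comp (measurable_pi_apply _), s, hΓ, fun q => ?_, ?_⟩
  · simp_rw [hMq q]
    exact (hM q).comp_measurePreserving (measurePreserving_eval_infinitePi P q)
  · simp_rw [hMq]
    exact iIndepFun_infinitePi (X := fun q ω t => M q t ω) fun q => measurable_pi_lambda _ (hMm q)

end Existence

end GaussMax

theorem theorem3p1 {T : Type u}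
    {Ω₀ : ℕ → Type*} [∀ n, MeasurableSpace (Ω₀ n)]
    (P₀ : (n : ℕ) → Measure (Ω₀ n)) [∀ n, IsProbabilityMeasure (P₀ n)]
    (X : (n : ℕ) → T → Ω₀ n → ℝ)
    (hX_gauss : ∀ n, IsGaussianProcess (X n) (P₀ n))
    (hX_mean : ∀ n t, ∫ ω, X n t ω ∂(P₀ n) = 0)
    (hX_var : ∀ n t, Var[X n t; P₀ n] = 1)
    {Ω : ℕ → Type*} [∀ n, MeasurableSpace (Ω n)]
    (P : (n : ℕ) → Measure (Ω n)) [∀ n, IsProbabilityMeasure (P n)]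
    (Xc : (n : ℕ) → Fin n → T → Ω n → ℝ)
    (hXc_copy : ∀ n i, IdentDistrib (fun ω t => Xc n i t ω) (fun ω t => X n t ω) (P n) (P₀ n))
    (hXc_indep : ∀ n, iIndepFun (fun i ω t => Xc n i t ω) (P n))
    (Γ : T → T → ℝ≥0∞)
    (hΓ : ∀ t₁ t₂, Tendsto
      (fun n : ℕ => ((4 * Real.log n * (1 - ∫ ω, X n t₁ ω * X n t₂ ω ∂(P₀ n)) : ℝ) : EReal))
      atTop (𝓝 (Γ t₁ t₂ : EReal)))
    (u : ℕ → ℝ)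
    (hu : (fun n => √(2 * Real.pi) * u n * Real.exp (u n ^ 2 / 2)) ~[atTop]
      (fun n : ℕ => (n : ℝ))) :
    (∃ (Ω' : Type u) (_ : MeasurableSpace Ω') (P' : Measure Ω') (_ : IsProbabilityMeasure P')
      (M : T → Ω' → ℝ), GaussMax.IsLimitProcess Γ M P') ∧
    ∀ (Ω' : Type*) [MeasurableSpace Ω'] (P' : Measure Ω') [IsProbabilityMeasure P']
      (M : T → Ω' → ℝ), GaussMax.IsLimitProcess Γ M P' →
      GaussMax.TendstoFinDim (fun n t ω => u n * ((⨆ i : Fin n, Xc n i t ω) - u n)) M P P' := by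
  -- Changing each value on a null set preserves Gaussianity, means, variances and correlations.
  choose X' hX'm hXX' using fun n => GaussMax.exists_measurable_modification (hX_gauss n)
  have hA : GaussMax.IsCriticalArray P₀ X' Γ u := by
    refine GaussMax.IsCriticalArray.of_tendsto_log hX'm
      (fun n => (hX_gauss n).congr (hXX' n)) (fun n t => ?_) (fun n t => ?_) (fun s t => ?_) hu
    · rw [← hX_mean n t]
      exact integral_congr_ae (hXX' n t).symm
    · rw [← hX_var n t]
      exact variance_congr (hXX' n t).symm
    · refine (hΓ s t).congr fun n => ?_
      have h : ∫ ω, X n s ω * X n t ω ∂(P₀ n) = ∫ ω, X' n s ω * X' n t ω ∂(P₀ n) :=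
        integral_congr_ae ((hXX' n s).mul (hXX' n t))
      rw [h]
  exact ⟨hA.isExtNegDef.exists_isLimitProcess, fun Ω' _ P' _ M hM =>
    GaussMax.tendstoFinDim_rescaled_max hA hXX' P Xc hXc_copy hXc_indep P' M hM⟩
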